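/- Throughout $|q|<1$, $(a;q)_n=\prod_{k=0}^{n-1}(1-aq^k)$ for $n\in\mathbb{Z}_{\ge 0}\cup\{\infty\}$, $J_m=(q^m;q^m)_\infty$ and $J_{a,m}=(q^a;q^m)_\infty(q^{m-a};q^m)_\infty(q^m;q^m)_\infty$. Then \begin{align*} \sum_{i,j\ge 0}\frac{q^{4i^2+3j^2-4ij-4i+2j}}{(q^8;q^8)_i(q^8;q^8)_j} &=2\frac{J_{16}J_{48,112}}{J_8^2}+q\frac{J_8J_{56}^2J_{112}J_{8,112}J_{24,112}}{J_4J_{4,112}J_{16,112}J_{28,112}J_{48,112}J_{52,112}},\\ \sum_{i,j\ge 0}\frac{q^{4i^2+3j^2-4ij}}{(q^8;q^8)_i(q^8;q^8)_j} &=\frac{J_8J_{56}^2J_{112}J_{24,112}J_{40,112}}{J_4J_{12,112}J_{28,112}J_{32,112}J_{44,112}J_{48,112}}+2q^3\frac{J_{16}J_{32,112}}{J_8^2},\\ \sum_{i,j\ge 0}\frac{q^{4i^2+3j^2-4ij+4j}}{(q^8;q^8)_i(q^8;q^8)_j} &=\frac{J_8J_{56}^2J_{112}J_{8,112}J_{40,112}}{J_4J_{16,112}J_{20,112}J_{28,112}J_{32,112}J_{36,112}}+2q^7\frac{J_{16}J_{16,112}}{J_8^2}.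 \end{align*} Moreover, for a real $r\times r$ matrix $A$, $B\in\mathbb{R}^r$ and $C\in\mathbb{R}$, let $$f_{A,B,C}(q)=\sum_{n=(n_1,\dots,n_r)^{\mathrm T}\in(\mathbb{Z}_{\ge 0})^r}\frac{q^{\frac12 n^{\mathrm T}An+n^{\mathrm T}B+C}}{(q;q)_{n_1}\cdots(q;q)_{n_r}},\qquad q=e^{2\pi i\tau},\ q^x=e^{2\pi i x\tau},\ \operatorname{Im}\tau>0.$$ If $A=\begin{pmatrix}1&-1/2\\-1/2&3/4\end{pmatrix}$ and $(B,C)$ is one of $$\left(\begin{pmatrix}-1/2\\1/4\end{pmatrix},\frac1{28}\right),\quad \left(\begin{pmatrix}0\\0\end{pmatrix},-\frac3{56}\right),\quad \left(\begin{pmatrix}0\\1/2\end{pmatrix},\frac1{56}\right),$$ then $\tau\mapsto f_{A,B,C}(q^{56})$ is a modular function on $\Gamma_1(3136)$, i.e. it is meromorphic on the upper half-plane, invariant under $\Gamma_1(3136)$, and meromorphic at all cusps. -/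

import Mathlib

open UpperHalfPlane
open scoped MatrixGroups

noncomputable section

namespace Nahm

/-- The finite `q`-shifted factorial `(a; q)_n = ∏_{k < n} (1 - a q^k)`. -/
def qPoch (a q : ℂ) (n : ℕ) : ℂ := ∏ k ∈ Finset.range n, (1 - a * q ^ k)

/-- The infinite `q`-shifted factorial `(a; q)_∞ = ∏_{k ≥ 0} (1 - a q^k)`, used for `|q| < 1`
(where the product converges absolutely). -/
def qPochInf (a q : ℂ) : ℂ := ∏' k : ℕ, (1 - a * q ^ k)

/-- `J_m = (q^m; q^m)_∞`. -/
def J (q : ℂ) (m : ℕ) : ℂ := qPochInf (q ^ m) (q ^ m)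

/-- `J_{a,m} = (q^a, q^{m-a}, q^m; q^m)_∞`, used for `0 < a < m`. -/
def JJ (q : ℂ) (a m : ℕ) : ℂ :=
  qPochInf (q ^ a) (q ^ m) * qPochInf (q ^ (m - a)) (q ^ m) * qPochInf (q ^ m) (q ^ m)

/-- The exponent `½ nᵀ A n + nᵀ B + C`. -/
def nahmExponent {r : ℕ} (A : Matrix (Fin r) (Fin r) ℝ) (B : Fin r → ℝ) (C : ℝ)
    (n : Fin r → ℕ) : ℝ :=
  (1 / 2) * ((fun i => (n i : ℝ)) ⬝ᵥ A.mulVec (fun i => (n i : ℝ)))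
    + (fun i => (n i : ℝ)) ⬝ᵥ B + C

/-- The Nahm sum `f_{A,B,C}(q) = ∑_n q^{½ nᵀ A n + nᵀ B + C} / ((q;q)_{n_1} ⋯ (q;q)_{n_r})`
as a function of `τ`, where `q = exp (2πiτ)` and `q^x = exp (2πixτ)` for real `x`. -/
def nahmSum {r : ℕ} (A : Matrix (Fin r) (Fin r) ℝ) (B : Fin r → ℝ) (C : ℝ) (τ : ℂ) : ℂ :=
  ∑' n : Fin r → ℕ,
    Complex.exp (2 * Real.pi * Complex.I * (nahmExponent A B C n : ℂ) * τ) /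
      ∏ i, qPoch (Complex.exp (2 * Real.pi * Complex.I * τ))
        (Complex.exp (2 * Real.pi * Complex.I * τ)) (n i)

/-- `f : ℍ → ℂ` is a modular function on `Γ₁(N)` (`N ≥ 1`): it is meromorphic on `ℍ`, invariant
under `Γ₁(N)`, and meromorphic at all cusps. Meromorphy on `ℍ` is in normal form (removable
singularities are filled in, and the value at a pole is `0`, there being no `∞` in `ℂ`).
For the cusps: every translate `τ ↦ f (γ τ)` with `γ ∈ SL₂(ℤ)` is `N`-periodic, hence a function
of `exp (2πiτ / N)`, and this function is required to be meromorphic at `0`. -/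
structure IsModularFunctionGammaOne (N : ℕ) (f : ℍ → ℂ) : Prop where
  meromorphic : MeromorphicNFOn (f ∘ ofComplex) upperHalfPlaneSet
  invariant : ∀ γ ∈ CongruenceSubgroup.Gamma1 N, ∀ τ : ℍ, f (γ • τ) = f τ
  meromorphic_cusps : ∀ γ : SL(2, ℤ),
    MeromorphicAt (Function.Periodic.cuspFunction (N : ℝ) ((fun τ : ℍ => f (γ • τ)) ∘ ofComplex)) 0

end Nahm

end

/-! ### The three double-sum identities -/

namespace Nahm

open Filter Topology Finset

/-! ### `q`-shifted factorials -/

/-! Identities. Summing over `i` first, Euler's expansion turns each double sum into a single sum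
over `j` whose terms contain `(-q^(4-4j+c); q^8)_∞` (`tsum_double`). For `j` of fixed parity this
product is a monomial times a fixed infinite product times a finite one (`qPochInf_div_pow`), and
the finite one cancels part of `(q^8; q^8)_j`. Hence one parity class becomes a modulus 14 sum of
Rogers in the base `q^8`, the other a Rogers–Selberg sum with `x = q^4` and the sign of the base
changed (`hasSum_double_one`, `hasSum_double_two`, `hasSum_double_three`). The factor `2` on the
right is `1 - (-1)` in `(-1; q^8)_∞ = 2 (-q^8; q^8)_∞`.

The Rogers and Rogers–Selberg identities come from Bailey's lemma in its limiting form (`bailey`), a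
consequence of the Durfee rectangle identity `tsum_durfee`. The Bailey pairs are the sums `pairSum`;
their closed forms follow from three contiguity relations: raising `k`, lowering `n`, and the
reflection of the summation index, which also forces some of these sums to vanish. The remaining
theta series is summed by `jacobi_triple_product`, itself Euler's expansion squared plus Durfee.
Both sides are finally written in the products `(x^k; x^28)_∞`, `x = q^4`, where the comparison is a
cancellation of nonzero factors.

Modularity. With `q = e^(2πiτ)`, the Nahm sum at `q^56` is `q^(56 C)` times a double sum at `q^7`,
so by the identities it is a combination of two terms `q^c` times `pairQuot`. Each is a constant
times a weight zero quotient of theta functions with characteristics `(n/28, 0)` at `784 τ`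
(`thetaQuot_eq`), the factors of eta type being supplied by powers of the product of the even theta
constants, which is `2 η^3` up to a root of unity. `SL(2, ℤ)` permutes the `thetaChar` through its
right action on characteristics, with an automorphy factor common to all of them
(`exists_thetaChar_smul`); in a quotient of weight zero this factor cancels, and only roots of unity
have to be checked (`thetaQuot_smul`).

At the cusps no expansions are computed. The bound `exp (C (Im τ + 1 / Im τ))`, obtained from
elementary estimates of the products, holds on the whole half plane and gives at most a pole at
every cusp simultaneously (`IsModerateModular.isModularFunctionGammaOne`). -/

lemma summable_mul_pow (a : ℂ) {q : ℂ} (hq : ‖q‖ < 1) : Summable fun k : ℕ => -(a * q ^ k) :=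
  ((summable_geometric_of_norm_lt_one hq).mul_left a).neg

lemma multipliable_one_sub_mul_pow (a : ℂ) {q : ℂ} (hq : ‖q‖ < 1) :
    Multipliable fun k : ℕ => 1 - a * q ^ k := by
  simpa [sub_eq_add_neg] using
    multipliable_one_add_of_summable (f := fun k : ℕ => -(a * q ^ k)) (summable_mul_pow a hq).norm

lemma tendsto_qPoch (a : ℂ) {q : ℂ} (hq : ‖q‖ < 1) :
    Tendsto (qPoch a q) atTop (𝓝 (qPochInf a q)) :=
  (multipliable_one_sub_mul_pow a hq).hasProd.tendsto_prod_nat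

lemma qPochInf_ne_zero {a q : ℂ} (hq : ‖q‖ < 1) (ha : ∀ k : ℕ, a * q ^ k ≠ 1) :
    qPochInf a q ≠ 0 := by
  have := tprod_one_add_ne_zero_of_summable (f := fun k : ℕ => -(a * q ^ k))
    (fun k h => ha k (by linear_combination -h)) (summable_mul_pow a hq).norm
  simpa [qPochInf, sub_eq_add_neg] using this

lemma qPochInf_ne_zero_of_norm_lt {a q : ℂ} (hq : ‖q‖ < 1) (ha : ‖a‖ < 1) :
    qPochInf a q ≠ 0 := by
  refine qPochInf_ne_zero hq fun k h => ?_
  have h1 : ‖a * q ^ k‖ < 1 := by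
    rw [norm_mul, norm_pow]
    exact mul_lt_one_of_nonneg_of_lt_one_left (norm_nonneg _) ha
      (pow_le_one₀ (norm_nonneg _) hq.le)
  simp [h] at h1

lemma qPoch_succ (a q : ℂ) (n : ℕ) : qPoch a q (n + 1) = qPoch a q n * (1 - a * q ^ n) := by
  simp [qPoch, prod_range_succ]

lemma qPochInf_eq_qPoch_mul (a : ℂ) {q : ℂ} (hq : ‖q‖ < 1) (n : ℕ) :
    qPochInf a q = qPoch a q n * qPochInf (a * q ^ n) q := by
  have h1 := (tendsto_qPoch a hq).comp (tendsto_add_atTop_nat n)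
  have h2 := (tendsto_qPoch (a * q ^ n) hq).const_mul (qPoch a q n)
  refine tendsto_nhds_unique h1 (h2.congr fun K => ?_)
  rw [Function.comp_apply, add_comm K n, qPoch, qPoch, qPoch, prod_range_add]
  congr 1
  exact prod_congr rfl fun k _ => by ring

lemma qPochInf_eq_one_sub_mul (a : ℂ) {q : ℂ} (hq : ‖q‖ < 1) :
    qPochInf a q = (1 - a) * qPochInf (a * q) q := by
  simpa [qPoch] using qPochInf_eq_qPoch_mul a hq 1

lemma qPochInf_eq_prod (a : ℂ) {q : ℂ} (hq : ‖q‖ < 1) {m : ℕ} (hm : 0 < m) :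
    qPochInf a q = ∏ i ∈ range m, qPochInf (a * q ^ i) (q ^ m) := by
  have hqm : ‖q ^ m‖ < 1 := by
    rw [norm_pow]; exact pow_lt_one₀ (norm_nonneg _) hq hm.ne'
  have h1 : Tendsto (fun K => qPoch a q (m * K)) atTop (𝓝 (qPochInf a q)) :=
    (tendsto_qPoch a hq).comp (tendsto_id.const_mul_atTop' hm)
  have h2 : Tendsto (fun K => ∏ i ∈ range m, qPoch (a * q ^ i) (q ^ m) K) atTop
      (𝓝 (∏ i ∈ range m, qPochInf (a * q ^ i) (q ^ m))) :=
    tendsto_finsetProd _ fun i _ => tendsto_qPoch _ hqm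
  refine tendsto_nhds_unique h1 (h2.congr fun K => ?_)
  induction K with
  | zero => simp [qPoch]
  | succ K ih =>
    simp only [qPoch_succ, prod_mul_distrib, ih]
    rw [mul_add, mul_one, qPoch, qPoch, prod_range_add]
    congr 1
    exact prod_congr rfl fun i _ => by ring

lemma qPochInf_mul_neg (a : ℂ) {q : ℂ} (hq : ‖q‖ < 1) :
    qPochInf a q * qPochInf (-a) q = qPochInf (a ^ 2) (q ^ 2) := by
  rw [qPochInf, qPochInf, ← (multipliable_one_sub_mul_pow a hq).tprod_mul
    (multipliable_one_sub_mul_pow (-a) hq), qPochInf]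
  exact tprod_congr fun k => by ring

lemma qPoch_mul_neg (a q : ℂ) (n : ℕ) :
    qPoch a q n * qPoch (-a) q n = qPoch (a ^ 2) (q ^ 2) n := by
  rw [qPoch, qPoch, ← prod_mul_distrib, qPoch]
  exact prod_congr rfl fun k _ => by ring

lemma qPoch_two_mul (a q : ℂ) (n : ℕ) :
    qPoch a q (2 * n) = qPoch a (q ^ 2) n * qPoch (a * q) (q ^ 2) n := by
  induction n with
  | zero => simp [qPoch]
  | succ n ih =>
    rw [show 2 * (n + 1) = 2 * n + 1 + 1 by ring, qPoch_succ, qPoch_succ, ih, qPoch_succ, qPoch_succ]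
    ring

lemma qPoch_two_mul_add_one (a q : ℂ) (n : ℕ) :
    qPoch a q (2 * n + 1) = qPoch a (q ^ 2) (n + 1) * qPoch (a * q) (q ^ 2) n := by
  rw [qPoch_succ, qPoch_two_mul, qPoch_succ]
  ring

lemma qPoch_ne_zero {a q : ℂ} (hq : ‖q‖ < 1) (ha : ‖a‖ < 1) (n : ℕ) : qPoch a q n ≠ 0 := by
  have h := qPochInf_ne_zero_of_norm_lt hq ha
  rw [qPochInf_eq_qPoch_mul a hq n] at h
  exact left_ne_zero_of_mul h

lemma exists_norm_inv_qPoch_le {q : ℂ} (hq : ‖q‖ < 1) :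
    ∃ M : ℝ, 0 ≤ M ∧ ∀ n, ‖(qPoch q q n)⁻¹‖ ≤ M := by
  have h := ((tendsto_qPoch q hq).inv₀ (qPochInf_ne_zero_of_norm_lt hq hq)).norm
  obtain ⟨M, hM⟩ := h.bddAbove_range
  exact ⟨M, (norm_nonneg _).trans (hM ⟨0, rfl⟩), fun n => hM ⟨n, rfl⟩⟩

/-- `1 / (q; q)_m` for an integer `m`, which is `0` for `m < 0`. -/
noncomputable def invPoch (q : ℂ) (m : ℤ) : ℂ := if 0 ≤ m then (qPoch q q m.toNat)⁻¹ else 0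

lemma invPoch_natCast (q : ℂ) (n : ℕ) : invPoch q n = (qPoch q q n)⁻¹ := by simp [invPoch]

lemma invPoch_of_neg (q : ℂ) {m : ℤ} (hm : m < 0) : invPoch q m = 0 := by
  simp [invPoch, hm]

/-- The factor `1 - q ^ m` vanishes at `m = 0`, so the recurrence also holds across the boundary to
negative `m`. This is what allows bilateral sums to be shifted without boundary terms. -/
lemma invPoch_sub_one {q : ℂ} (hq : ‖q‖ < 1) (m : ℤ) :
    invPoch q (m - 1) = (1 - q ^ m) * invPoch q m := by
  rcases lt_trichotomy m 0 with hm | rfl | hm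
  · rw [invPoch_of_neg q hm, invPoch_of_neg q (by omega), mul_zero]
  · simp [invPoch]
  · obtain ⟨n, rfl⟩ : ∃ n : ℕ, m = n + 1 := ⟨(m - 1).toNat, by omega⟩
    rw [add_sub_cancel_right, invPoch_natCast]
    have h := invPoch_natCast q (n + 1)
    push_cast at h
    have h1 := qPoch_ne_zero hq hq (n + 1)
    rw [h]
    rw [qPoch_succ] at h1 ⊢
    rw [show q ^ ((n : ℤ) + 1) = q * q ^ n by rw [mul_comm]; exact_mod_cast pow_succ q n]
    field_simp [left_ne_zero_of_mul h1, right_ne_zero_of_mul h1]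

lemma exists_norm_invPoch_le {q : ℂ} (hq : ‖q‖ < 1) :
    ∃ M : ℝ, 0 ≤ M ∧ ∀ m, ‖invPoch q m‖ ≤ M := by
  obtain ⟨M, hM, h⟩ := exists_norm_inv_qPoch_le hq
  refine ⟨M, hM, fun m => ?_⟩
  unfold invPoch
  split_ifs
  · exact h _
  · simpa

lemma tendsto_invPoch {q : ℂ} (hq : ‖q‖ < 1) :
    Tendsto (fun n : ℕ => invPoch q n) atTop (𝓝 (qPochInf q q)⁻¹) := by
  simp only [invPoch_natCast]
  exact (tendsto_qPoch q hq).inv₀ (qPochInf_ne_zero_of_norm_lt hq hq)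

/-! ### Euler's sum, the Durfee identity and the Jacobi triple product -/

lemma summable_norm_pow_choose_two_mul_pow {b : ℂ} (hb : ‖b‖ < 1) (z : ℂ) :
    Summable fun i : ℕ => ‖b ^ (i.choose 2) * z ^ i‖ := by
  have hlim : Tendsto (fun i : ℕ => ‖b‖ ^ i * ‖z‖) atTop (𝓝 0) := by
    simpa using (tendsto_pow_atTop_nhds_zero_of_lt_one (norm_nonneg b) hb).mul_const ‖z‖
  refine (summable_of_ratio_norm_eventually_le (r := 1 / 2) (by norm_num) ?_)
  filter_upwards [hlim.eventually (gt_mem_nhds (show (0 : ℝ) < 1 / 2 by norm_num))] with i hi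
  have : b ^ ((i + 1).choose 2) * z ^ (i + 1) = (b ^ i * z) * (b ^ (i.choose 2) * z ^ i) := by
    rw [Nat.choose_succ_succ' i 1, Nat.choose_one_right]; ring
  rw [this, norm_norm, norm_norm, norm_mul, norm_mul (b ^ i), norm_pow]
  exact mul_le_mul_of_nonneg_right hi.le (norm_nonneg _)

lemma summable_norm_euler {b : ℂ} (hb : ‖b‖ < 1) (z : ℂ) :
    Summable fun i : ℕ => ‖b ^ (i.choose 2) * z ^ i * (qPoch b b i)⁻¹‖ := by
  obtain ⟨M, hM, h⟩ := exists_norm_inv_qPoch_le hb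
  refine .of_nonneg_of_le (fun _ => norm_nonneg _) (fun i => ?_)
    ((summable_norm_pow_choose_two_mul_pow hb z).mul_right M)
  rw [norm_mul]
  exact mul_le_mul_of_nonneg_left (h i) (norm_nonneg _)

/-- In the difference of the series at `z` and at `z * b`, the factor `1 - b ^ i` cancels the last
factor of `(b; b)_i`; what remains is `z` times the series at `z * b`. -/
lemma tsum_euler_step {b : ℂ} (hb : ‖b‖ < 1) (z : ℂ) :
    ∑' i : ℕ, b ^ (i.choose 2) * z ^ i * (qPoch b b i)⁻¹ =
      (1 + z) * ∑' i : ℕ, b ^ (i.choose 2) * (z * b) ^ i * (qPoch b b i)⁻¹ := by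
  have h1 := (summable_norm_euler hb z).of_norm
  have h2 := (summable_norm_euler hb (z * b)).of_norm
  have h3 := h1.sub h2
  have key : ∑' i : ℕ, (b ^ (i.choose 2) * z ^ i * (qPoch b b i)⁻¹ -
      b ^ (i.choose 2) * (z * b) ^ i * (qPoch b b i)⁻¹) =
      z * ∑' i : ℕ, b ^ (i.choose 2) * (z * b) ^ i * (qPoch b b i)⁻¹ := by
    rw [h3.tsum_eq_zero_add, ← tsum_mul_left]
    simp only [Nat.choose_zero_succ, pow_zero, one_mul, sub_self, zero_add]
    refine tsum_congr fun i => ?_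
    have h0 := qPoch_ne_zero hb hb (i + 1)
    rw [qPoch_succ] at h0 ⊢
    rw [Nat.choose_succ_succ' i 1, Nat.choose_one_right, mul_inv]
    have h4 := right_ne_zero_of_mul h0
    calc _ = b ^ (i + i.choose 2) * z ^ (i + 1) * (qPoch b b i)⁻¹ *
        ((1 - b * b ^ i) * (1 - b * b ^ i)⁻¹) := by ring
      _ = _ := by rw [mul_inv_cancel₀ h4]; ring
  rw [h1.tsum_sub h2] at key
  linear_combination key

/-- Euler's expansion of `(-z; b)_∞`. -/
lemma tsum_euler {b : ℂ} (hb : ‖b‖ < 1) (z : ℂ) :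
    ∑' i : ℕ, b ^ (i.choose 2) * z ^ i * (qPoch b b i)⁻¹ = qPochInf (-z) b := by
  have h1 : ∀ n : ℕ, ∑' i : ℕ, b ^ (i.choose 2) * z ^ i * (qPoch b b i)⁻¹ =
      qPoch (-z) b n * ∑' i : ℕ, b ^ (i.choose 2) * (z * b ^ n) ^ i * (qPoch b b i)⁻¹ := by
    intro n
    induction n with
    | zero => simp [qPoch]
    | succ n ih =>
      rw [ih, tsum_euler_step hb (z * b ^ n), qPoch_succ, pow_succ, ← mul_assoc z]
      ring
  -- Since `b ^ n → 0`, only the term `i = 0` survives in the limit of the iterated functional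
  -- equation.
  have h2 : Tendsto (fun n : ℕ => ∑' i : ℕ, b ^ (i.choose 2) * (z * b ^ n) ^ i * (qPoch b b i)⁻¹)
      atTop (𝓝 (∑' i : ℕ, if i = 0 then 1 else 0)) := by
    refine tendsto_tsum_of_dominated_convergence (summable_norm_euler hb z) (fun i => ?_)
      (.of_forall fun n i => ?_)
    · rcases Nat.eq_zero_or_pos i with rfl | hi
      · simp [qPoch]
      · rw [if_neg hi.ne']
        have h3 : Tendsto (fun n : ℕ => (z * b ^ n) ^ i) atTop (𝓝 0) := by
          simpa [hi.ne'] using ((tendsto_pow_atTop_nhds_zero_of_norm_lt_one hb).const_mul z).pow i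
        simpa using (h3.const_mul (b ^ (i.choose 2))).mul_const (qPoch b b i)⁻¹
    · rw [norm_mul, norm_mul, norm_mul, norm_mul]
      refine mul_le_mul_of_nonneg_right (mul_le_mul_of_nonneg_left ?_ (norm_nonneg _))
        (norm_nonneg _)
      rw [norm_pow, norm_pow]
      refine pow_le_pow_left₀ (norm_nonneg _) ?_ _
      rw [norm_mul, norm_pow]
      exact mul_le_of_le_one_right (norm_nonneg _) (pow_le_one₀ (norm_nonneg _) hb.le)
  rw [tsum_ite_eq] at h2
  have h4 := (tendsto_qPoch (-z) hb).mul h2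
  rw [mul_one] at h4
  exact tendsto_nhds_unique (tendsto_const_nhds.congr h1) h4

lemma sq_eq_two_mul_choose_add (n : ℕ) : n ^ 2 = 2 * n.choose 2 + n := by
  rw [Nat.choose_two_right, Nat.mul_div_cancel' (Nat.even_mul_pred_self n).two_dvd]
  rcases n with _ | n
  · rfl
  · rw [Nat.add_sub_cancel]; ring

lemma summable_norm_pow_sq (z : ℂ) {p : ℂ} (hp : ‖p‖ < 1) :
    Summable fun n : ℕ => ‖z ^ n * p ^ (n ^ 2)‖ := by
  have h := summable_norm_pow_choose_two_mul_pow (b := p ^ 2)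
    (by rw [norm_pow]; exact pow_lt_one₀ (norm_nonneg _) hp two_ne_zero) (z * p)
  refine h.congr fun n => ?_
  congr 1
  rw [sq_eq_two_mul_choose_add, mul_pow, pow_add, pow_mul]
  ring

lemma summable_norm_zpow_sq (z : ℂ) {p : ℂ} (hp : ‖p‖ < 1) :
    Summable fun n : ℤ => ‖z ^ n * p ^ (n ^ 2)‖ := by
  refine .of_nat_of_neg ?_ ?_
  · refine (summable_norm_pow_sq z hp).congr fun n => ?_
    congr 1
  · refine (summable_norm_pow_sq z⁻¹ hp).congr fun n => ?_
    congr 1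
    rw [neg_sq, ← zpow_natCast p, zpow_neg, zpow_natCast, inv_pow]
    rfl

lemma summable_norm_zpow_quad (a : ℤ) {b : ℂ} (hb : ‖b‖ < 1) (hb0 : b ≠ 0) :
    Summable fun m : ℤ => ‖b ^ (m ^ 2 + a * m)‖ := by
  refine (summable_norm_zpow_sq (b ^ a) hb).congr fun m => ?_
  rw [zpow_add₀ hb0, zpow_mul, mul_comm]

lemma summable_norm_durfee (a l : ℤ) (c : ℤ) {b : ℂ} (hb : ‖b‖ < 1) (hb0 : b ≠ 0) :
    Summable fun m : ℤ => ‖b ^ (m ^ 2 + a * m) * invPoch b (m + c) * invPoch b (m + l)‖ := by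
  obtain ⟨M, hM, h⟩ := exists_norm_invPoch_le hb
  refine .of_nonneg_of_le (fun _ => norm_nonneg _) (fun i => ?_)
    (((summable_norm_zpow_quad a hb hb0).mul_right M).mul_right M)
  rw [norm_mul, norm_mul]
  gcongr <;> apply h

/-- The difference of the two summands is `F m - F (m + 1)` with `F m = b ^ (m ^ 2 + l * m) *
invPoch b (m - 1) * invPoch b (m + l)`, so it telescopes to zero over `ℤ`. -/
lemma tsum_durfee_step {b : ℂ} (hb : ‖b‖ < 1) (hb0 : b ≠ 0) (l : ℤ) :
    ∑' m : ℤ, b ^ (m ^ 2 + l * m) * invPoch b m * invPoch b (m + l) =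
      ∑' m : ℤ, b ^ (m ^ 2 + (l + 1) * m) * invPoch b m * invPoch b (m + (l + 1)) := by
  have h1 : Summable fun m : ℤ => b ^ (m ^ 2 + l * m) * invPoch b m * invPoch b (m + l) := by
    simpa using (summable_norm_durfee l l 0 hb hb0).of_norm
  have h2 : Summable fun m : ℤ =>
      b ^ (m ^ 2 + (l + 1) * m) * invPoch b m * invPoch b (m + (l + 1)) := by
    simpa using (summable_norm_durfee (l + 1) (l + 1) 0 hb hb0).of_norm
  have h3 : Summable fun m : ℤ => b ^ (m ^ 2 + l * m) * invPoch b (m - 1) * invPoch b (m + l) := by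
    simpa [sub_eq_add_neg] using (summable_norm_durfee l l (-1) hb hb0).of_norm
  have h4 := (Equiv.addRight (1 : ℤ)).summable_iff.mpr h3
  have h5 := (Equiv.addRight (1 : ℤ)).tsum_eq
    fun m : ℤ => b ^ (m ^ 2 + l * m) * invPoch b (m - 1) * invPoch b (m + l)
  have h6 := h3.tsum_sub h4
  simp only [Function.comp_def] at h6
  rw [h5, sub_self] at h6
  rw [← sub_eq_zero, ← h1.tsum_sub h2, ← h6]
  refine tsum_congr fun m => ?_
  simp only [Equiv.coe_addRight]
  rw [invPoch_sub_one hb m, show m + l = m + (l + 1) - 1 by ring, invPoch_sub_one hb (m + (l + 1)),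
    add_sub_cancel_right, show m + 1 + l = m + (l + 1) by ring,
    show (m + 1) ^ 2 + l * (m + 1) = (m ^ 2 + l * m) + m + (m + (l + 1)) by ring,
    show m ^ 2 + (l + 1) * m = (m ^ 2 + l * m) + m by ring]
  simp only [zpow_add₀ hb0 (_ + _) (m + (l + 1)), zpow_add₀ hb0 (_ + _) m]
  ring

lemma tsum_durfee_natCast {b : ℂ} (hb : ‖b‖ < 1) (hb0 : b ≠ 0) (l k : ℤ) :
    ∑' m : ℤ, b ^ (m ^ 2 + l * m) * invPoch b m * invPoch b (m + l) =
      ∑' m : ℤ, b ^ (m ^ 2 + k * m) * invPoch b m * invPoch b (m + k) := by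
  have h : ∀ (l : ℤ) (n : ℕ),
      ∑' m : ℤ, b ^ (m ^ 2 + l * m) * invPoch b m * invPoch b (m + l) =
        ∑' m : ℤ, b ^ (m ^ 2 + (l + n) * m) * invPoch b m * invPoch b (m + (l + n)) := by
    intro l n
    induction n with
    | zero => simp
    | succ n ih => rw [ih, tsum_durfee_step hb hb0]; push_cast; simp only [add_assoc]
  rcases le_total l k with hlk | hlk
  · have := h l (k - l).toNat
    rwa [show l + ((k - l).toNat : ℤ) = k by omega] at this
  · have := h k (l - k).toNat
    rw [show k + ((l - k).toNat : ℤ) = l by omega] at this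
    exact this.symm

/-- The Durfee rectangle identity, in bilateral form. -/
lemma tsum_durfee {b : ℂ} (hb : ‖b‖ < 1) (hb0 : b ≠ 0) (l : ℤ) :
    ∑' m : ℤ, b ^ (m ^ 2 + l * m) * invPoch b m * invPoch b (m + l) = (qPochInf b b)⁻¹ := by
  obtain ⟨M, hM, hle⟩ := exists_norm_invPoch_le hb
  have hbound : Summable fun m : ℤ => ‖b ^ (m ^ 2)‖ * M * M := by
    simpa using ((summable_norm_zpow_quad 0 hb hb0).mul_right M).mul_right M
  -- The sum does not depend on `l`, so it may be evaluated as `l → +∞`: terms with `m > 0` tend to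
  -- zero, those with `m < 0` vanish, and `m = 0` contributes the limit of `1 / (b; b)_l`.
  have h2 : Tendsto (fun n : ℕ =>
      ∑' m : ℤ, b ^ (m ^ 2 + (n : ℤ) * m) * invPoch b m * invPoch b (m + n))
      atTop (𝓝 (∑' m : ℤ, if m = 0 then (qPochInf b b)⁻¹ else 0)) := by
    refine tendsto_tsum_of_dominated_convergence hbound (fun m => ?_) (.of_forall fun n m => ?_)
    · rcases lt_trichotomy m 0 with hm | rfl | hm
      · simp [invPoch_of_neg b hm, hm.ne]
      · have : invPoch b 0 = 1 := by simpa [qPoch] using invPoch_natCast b 0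
        simpa [this] using tendsto_invPoch hb
      · rw [if_neg hm.ne']
        obtain ⟨j, rfl⟩ : ∃ j : ℕ, m = j + 1 := ⟨(m - 1).toNat, by omega⟩
        have h3 : Tendsto (fun n : ℕ => ‖b‖ ^ n * (M * M)) atTop (𝓝 0) := by
          simpa using (tendsto_pow_atTop_nhds_zero_of_lt_one (norm_nonneg b) hb).mul_const (M * M)
        refine squeeze_zero_norm (fun n => ?_) h3
        rw [norm_mul, norm_mul, mul_assoc]
        gcongr ?_ * (?_ * ?_)
        · rw [show ((j : ℤ) + 1) ^ 2 + n * ((j : ℤ) + 1) = ((((j + 1) ^ 2 + n * j) + n : ℕ) : ℤ) by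
            push_cast; ring, zpow_natCast, norm_pow, pow_add]
          exact mul_le_of_le_one_left (by positivity) (pow_le_one₀ (norm_nonneg _) hb.le)
        · apply hle
        · apply hle
    · rcases lt_or_ge m 0 with hm | hm
      · simp only [invPoch_of_neg b hm, mul_zero, zero_mul, norm_zero]
        positivity
      · obtain ⟨j, rfl⟩ := Int.eq_ofNat_of_zero_le hm
        rw [norm_mul, norm_mul]
        gcongr ?_ * ?_ * ?_
        · rw [show (j : ℤ) ^ 2 + n * (j : ℤ) = ((j ^ 2 + n * j : ℕ) : ℤ) by push_cast; ring,
            show (j : ℤ) ^ 2 = ((j ^ 2 : ℕ) : ℤ) by push_cast; ring, zpow_natCast, zpow_natCast,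
            norm_pow, norm_pow]
          exact pow_le_pow_of_le_one (norm_nonneg _) hb.le (by omega)
        · apply hle
        · apply hle
  rw [tsum_ite_eq] at h2
  exact tendsto_nhds_unique
    (tendsto_const_nhds.congr fun n : ℕ => tsum_durfee_natCast hb hb0 l n) h2

lemma summable_norm_euler_int {p : ℂ} (hp : ‖p‖ < 1) (z : ℂ) :
    Summable fun i : ℤ => ‖p ^ (i ^ 2) * z ^ i * invPoch (p ^ 2) i‖ := by
  have hp2 : ‖p ^ 2‖ < 1 := by
    rw [norm_pow]; exact pow_lt_one₀ (norm_nonneg _) hp two_ne_zero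
  obtain ⟨M, hM, h⟩ := exists_norm_invPoch_le hp2
  refine .of_nonneg_of_le (fun _ => norm_nonneg _) (fun i => ?_)
    ((summable_norm_zpow_sq z hp).mul_right M)
  rw [norm_mul, mul_comm (p ^ _)]
  gcongr
  apply h

lemma tsum_euler_int {p : ℂ} (hp : ‖p‖ < 1) (z : ℂ) :
    ∑' i : ℤ, p ^ (i ^ 2) * z ^ i * invPoch (p ^ 2) i = qPochInf (-(z * p)) (p ^ 2) := by
  have hp2 : ‖p ^ 2‖ < 1 := by
    rw [norm_pow]; exact pow_lt_one₀ (norm_nonneg _) hp two_ne_zero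
  rw [← tsum_euler hp2, ← Function.Injective.tsum_eq (Nat.cast_injective (R := ℤ))]
  · refine tsum_congr fun n => ?_
    rw [invPoch_natCast, show ((n : ℤ) ^ 2) = ((n ^ 2 : ℕ) : ℤ) by push_cast; rfl, zpow_natCast,
      zpow_natCast, sq_eq_two_mul_choose_add, mul_pow, pow_add, pow_mul]
    ring
  · intro i hi
    rw [Function.mem_support] at hi
    refine ⟨i.toNat, Int.toNat_of_nonneg ?_⟩
    by_contra h
    exact hi (by rw [invPoch_of_neg _ (not_le.mp h), mul_zero])

/-- The Jacobi triple product identity. -/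
theorem jacobi_triple_product {p z : ℂ} (hp : ‖p‖ < 1) (hp0 : p ≠ 0) (hz : z ≠ 0) :
    ∑' l : ℤ, z ^ l * p ^ (l ^ 2) =
      qPochInf (p ^ 2) (p ^ 2) * qPochInf (-(z * p)) (p ^ 2) * qPochInf (-(z⁻¹ * p)) (p ^ 2) := by
  have hp2 : ‖p ^ 2‖ < 1 := by
    rw [norm_pow]; exact pow_lt_one₀ (norm_nonneg _) hp two_ne_zero
  have hs1 := summable_norm_euler_int hp z
  have hs2 := summable_norm_euler_int hp z⁻¹
  -- In the product of Euler's series at `z` and `z⁻¹`, the pair of indices is written `(l + m, m)`.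
  -- The powers of `z` then depend on `l` only, and the sum over `m` is a Durfee sum.
  let e : ℤ × ℤ ≃ ℤ × ℤ :=
    { toFun := fun x => (x.2 + x.1, x.2)
      invFun := fun x => (x.1 - x.2, x.2)
      left_inv := fun x => by simp
      right_inv := fun x => by simp }
  have hprod := tsum_mul_tsum_of_summable_norm hs1 hs2
  have hsum := summable_mul_of_summable_norm hs1 hs2
  have hsum' := e.summable_iff.mpr hsum
  rw [tsum_euler_int hp, tsum_euler_int hp, ← e.tsum_eq] at hprod
  have hterm : ∀ x : ℤ × ℤ, p ^ ((x.2 + x.1) ^ 2) * z ^ (x.2 + x.1) * invPoch (p ^ 2) (x.2 + x.1) *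
      (p ^ (x.2 ^ 2) * z⁻¹ ^ x.2 * invPoch (p ^ 2) x.2) =
      z ^ x.1 * p ^ (x.1 ^ 2) * ((p ^ 2) ^ (x.2 ^ 2 + x.1 * x.2) * invPoch (p ^ 2) x.2 *
        invPoch (p ^ 2) (x.2 + x.1)) := by
    intro x
    have h1 : p ^ ((x.2 + x.1) ^ 2) * p ^ (x.2 ^ 2) =
        p ^ (x.1 ^ 2) * (p ^ 2) ^ (x.2 ^ 2 + x.1 * x.2) := by
      rw [← zpow_natCast p 2, ← zpow_mul, ← zpow_add₀ hp0, ← zpow_add₀ hp0]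
      congr 1; push_cast; ring
    have h2 : z ^ (x.2 + x.1) * z⁻¹ ^ x.2 = z ^ x.1 := by
      rw [inv_zpow, zpow_add₀ hz]; field_simp
    calc _ = (z ^ (x.2 + x.1) * z⁻¹ ^ x.2) * (p ^ ((x.2 + x.1) ^ 2) * p ^ (x.2 ^ 2)) *
          (invPoch (p ^ 2) x.2 * invPoch (p ^ 2) (x.2 + x.1)) := by ring
      _ = _ := by rw [h1, h2]; ring
  have hsum'' : Summable fun x : ℤ × ℤ => z ^ x.1 * p ^ (x.1 ^ 2) *
      ((p ^ 2) ^ (x.2 ^ 2 + x.1 * x.2) * invPoch (p ^ 2) x.2 * invPoch (p ^ 2) (x.2 + x.1)) :=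
    hsum'.congr fun x => (hterm x)
  replace hprod := hprod.trans (tsum_congr hterm)
  rw [hsum''.tsum_prod] at hprod
  simp only [tsum_mul_left, tsum_durfee hp2 (pow_ne_zero 2 hp0)] at hprod
  rw [tsum_mul_right] at hprod
  have h0 := qPochInf_ne_zero_of_norm_lt hp2 hp2
  rw [mul_assoc, hprod]
  field_simp

/-- The limiting case of Bailey's lemma, for pairs relative to `1` (`k = 0`) and `b` (`k = 1`). -/
lemma bailey {b : ℂ} (hb : ‖b‖ < 1) (hb0 : b ≠ 0) {k : ℕ} (hk : k ≤ 1) {c : ℤ → ℂ}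
    (hc : Summable fun s => ‖c s‖) (ρ : ℤ → ℤ) :
    ∑' n : ℕ, b ^ (n ^ 2 + k * n) * ∑' s : ℤ, c s * invPoch b (n - ρ s) * invPoch b (n + ρ s + k) =
      (qPochInf b b)⁻¹ * ∑' s : ℤ, c s * b ^ (ρ s ^ 2 + k * ρ s) := by
  obtain ⟨M, hM, hle⟩ := exists_norm_invPoch_le hb
  have hsum : Summable fun x : ℤ × ℤ => b ^ (x.1 ^ 2 + k * x.1) *
      (c x.2 * invPoch b (x.1 - ρ x.2) * invPoch b (x.1 + ρ x.2 + k)) := by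
    refine .of_norm_bounded
      (g := fun x : ℤ × ℤ => ‖b ^ (x.1 ^ 2 + k * x.1)‖ * (‖c x.2‖ * M * M)) ?_ fun x => ?_
    · exact (summable_norm_zpow_quad k hb hb0).mul_of_nonneg ((hc.mul_right M).mul_right M)
        (fun _ => norm_nonneg _) (fun _ => by positivity)
    · rw [norm_mul, norm_mul, norm_mul]
      gcongr <;> apply hle
  have h1 : ∑' n : ℕ, b ^ (n ^ 2 + k * n) *
      ∑' s : ℤ, c s * invPoch b (n - ρ s) * invPoch b (n + ρ s + k) =
      ∑' n : ℤ, ∑' s : ℤ, b ^ (n ^ 2 + k * n) *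
        (c s * invPoch b (n - ρ s) * invPoch b (n + ρ s + k)) := by
    rw [← Function.Injective.tsum_eq (Nat.cast_injective (R := ℤ))]
    · refine tsum_congr fun n => ?_
      rw [← tsum_mul_left]
      refine tsum_congr fun s => ?_
      rw [← zpow_natCast]
      push_cast
      rfl
    · intro n hn
      rw [Function.mem_support] at hn
      refine ⟨n.toNat, Int.toNat_of_nonneg ?_⟩
      by_contra h
      refine hn ?_
      rw [← tsum_zero (β := ℤ)]
      refine tsum_congr fun s => ?_
      -- The two indices add up to `2 n + k`, which is negative for `n < 0` because `k ≤ 1`; one of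
      -- the two reciprocal factorials is therefore zero.
      rcases lt_or_ge (n - ρ s) 0 with h2 | h2
      · rw [invPoch_of_neg b h2]; ring
      · rw [invPoch_of_neg b (show n + ρ s + k < 0 by omega)]; ring
  have h2 := Summable.tsum_comm (f := fun n s : ℤ => b ^ (n ^ 2 + k * n) *
    (c s * invPoch b (n - ρ s) * invPoch b (n + ρ s + k))) hsum
  rw [h1, ← h2, ← tsum_mul_left]
  refine tsum_congr fun s => ?_
  -- After `n = m + ρ s` the sum over `n` is the Durfee sum with `l = 2 * ρ s + k`, up to the factor
  -- `b ^ (ρ s ^ 2 + k * ρ s)`.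
  rw [← tsum_durfee hb hb0 (2 * ρ s + k), mul_comm, ← tsum_mul_left,
    ← (Equiv.addRight (ρ s)).tsum_eq]
  refine tsum_congr fun m => ?_
  simp only [Equiv.coe_addRight, add_sub_cancel_right]
  rw [show (m + ρ s) ^ 2 + k * (m + ρ s) = (ρ s ^ 2 + k * ρ s) + (m ^ 2 + (2 * ρ s + k) * m) by ring,
    zpow_add₀ hb0, show m + ρ s + ρ s + k = m + (2 * ρ s + k) by ring]
  ring

/-! ### Bailey pairs and Rogers' identities -/

/-- The sums defining the `β`-side of the Bailey pairs of Slater's families C and G. -/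
noncomputable def pairSum (p b : ℂ) (d α k n : ℤ) : ℂ :=
  ∑' s : ℤ, (-1) ^ s * p ^ (3 * s ^ 2 + α * s) * invPoch b (n - d * s) * invPoch b (n + d * s + k)

lemma summable_norm_neg_one_zpow_mul (α : ℤ) {p : ℂ} (hp : ‖p‖ < 1) (hp0 : p ≠ 0) :
    Summable fun s : ℤ => ‖(-1) ^ s * p ^ (3 * s ^ 2 + α * s)‖ := by
  have hp3 : ‖p ^ 3‖ < 1 := by
    rw [norm_pow]; exact pow_lt_one₀ (norm_nonneg _) hp (by norm_num)
  refine (summable_norm_zpow_sq (-p ^ α) hp3).congr fun s => ?_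
  rw [← zpow_natCast p 3, ← zpow_mul, neg_eq_neg_one_mul (p ^ α), mul_zpow, ← zpow_mul, mul_assoc,
    ← zpow_add₀ hp0]
  congr 3
  push_cast; ring

lemma summable_pairSum {p b : ℂ} (hp : ‖p‖ < 1) (hp0 : p ≠ 0) (hb : ‖b‖ < 1) (d α k n : ℤ) :
    Summable fun s : ℤ => (-1) ^ s * p ^ (3 * s ^ 2 + α * s) * invPoch b (n - d * s) *
      invPoch b (n + d * s + k) := by
  obtain ⟨M, hM, hle⟩ := exists_norm_invPoch_le hb
  refine .of_norm_bounded (((summable_norm_neg_one_zpow_mul α hp hp0).mul_right M).mul_right M)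
    fun s => ?_
  rw [norm_mul, norm_mul _ (invPoch b (n - d * s))]
  gcongr <;> apply hle

/-- Raising the second index costs the factor `1 - b ^ (n + d * s + k + 1)`. Its `s`-dependent part
`b ^ (d * s) = p ^ (σ * s)` is absorbed into `α`. -/
lemma pairSum_eq_sub_raise {p b : ℂ} (hp : ‖p‖ < 1) (hp0 : p ≠ 0) (hb : ‖b‖ < 1) (hb0 : b ≠ 0)
    {d σ : ℤ} (hσ : b ^ d = p ^ σ) (α k n : ℤ) :
    pairSum p b d α k n =
      pairSum p b d α (k + 1) n - b ^ (n + k + 1) * pairSum p b d (α + σ) (k + 1) n := by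
  unfold pairSum
  rw [← tsum_mul_left, ← (summable_pairSum hp hp0 hb d α (k + 1) n).tsum_sub
    ((summable_pairSum hp hp0 hb d (α + σ) (k + 1) n).mul_left _)]
  refine tsum_congr fun s => ?_
  rw [show n + d * s + k = n + d * s + (k + 1) - 1 by ring, invPoch_sub_one hb,
    show n + d * s + (k + 1) = (n + k + 1) + d * s by ring, zpow_add₀ hb0 _ (d * s), zpow_mul b, hσ,
    ← zpow_mul, show 3 * s ^ 2 + (α + σ) * s = (3 * s ^ 2 + α * s) + σ * s by ring,
    zpow_add₀ hp0 _ (σ * s)]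
  ring

/-- The same manipulation for the first index; here `b ^ (-d * s)` lowers `α` by `σ`, while `k + 1`
keeps the second index unchanged. -/
lemma pairSum_sub_one {p b : ℂ} (hp : ‖p‖ < 1) (hp0 : p ≠ 0) (hb : ‖b‖ < 1) (hb0 : b ≠ 0)
    {d σ : ℤ} (hσ : b ^ d = p ^ σ) (α k n : ℤ) :
    pairSum p b d α (k + 1) (n - 1) =
      pairSum p b d α k n - b ^ n * pairSum p b d (α - σ) k n := by
  unfold pairSum
  rw [← tsum_mul_left, ← (summable_pairSum hp hp0 hb d α k n).tsum_sub
    ((summable_pairSum hp hp0 hb d (α - σ) k n).mul_left _)]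
  refine tsum_congr fun s => ?_
  rw [show n - 1 - d * s = n - d * s - 1 by ring, invPoch_sub_one hb,
    show n - 1 + d * s + (k + 1) = n + d * s + k by ring, zpow_sub₀ hb0 _ (d * s), zpow_mul b, hσ,
    ← zpow_mul, show 3 * s ^ 2 + (α - σ) * s = (3 * s ^ 2 + α * s) - σ * s by ring,
    zpow_sub₀ hp0 _ (σ * s)]
  ring

/-- The substitution `s ↦ -s - j` exchanges the two reciprocal factorials when `k = d * j`. For odd
`j` and `α = 3 * j` it equates the sum with its negative, so that sum vanishes; this supplies the
extra relations needed below. -/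
lemma pairSum_symm {p : ℂ} (hp0 : p ≠ 0) (b : ℂ) (d α j n : ℤ) :
    pairSum p b d α (d * j) n =
      (-1) ^ j * p ^ (3 * j ^ 2 - α * j) * pairSum p b d (6 * j - α) (d * j) n := by
  unfold pairSum
  rw [← tsum_mul_left, ← ((Equiv.neg ℤ).trans (Equiv.subRight j)).tsum_eq]
  refine tsum_congr fun s => ?_
  simp only [Equiv.trans_apply, Equiv.neg_apply, Equiv.subRight_apply]
  have h1 : (-1 : ℂ) ^ (-s - j) = (-1) ^ j * (-1) ^ s := by
    rw [zpow_sub₀ (by norm_num), zpow_neg, ← inv_zpow, div_eq_mul_inv, ← inv_zpow]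
    norm_num [mul_comm]
  rw [h1, show 3 * (-s - j) ^ 2 + α * (-s - j) =
      (3 * j ^ 2 - α * j) + (3 * s ^ 2 + (6 * j - α) * s) by ring, zpow_add₀ hp0,
    show n - d * (-s - j) = n + d * s + d * j by ring,
    show n + d * (-s - j) + d * j = n - d * s by ring]
  ring

lemma pairSum_zero {p b : ℂ} {d : ℤ} (hd : 0 < d) (α : ℤ) : pairSum p b d α 0 0 = 1 := by
  unfold pairSum
  rw [tsum_eq_single 0]
  · have : invPoch b 0 = 1 := by simpa [qPoch] using invPoch_natCast b 0
    simp [this]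
  · intro s hs
    rcases lt_or_gt_of_ne hs with h | h
    · rw [invPoch_of_neg b (show 0 + d * s + 0 < 0 by nlinarith), mul_zero]
    · rw [invPoch_of_neg b (show 0 - d * s < 0 by nlinarith), mul_zero, zero_mul]

/-! ### Slater's family C: base `p`, step `d = 2` -/

lemma pairSum_C_one_one {p : ℂ} (hp : ‖p‖ < 1) (hp0 : p ≠ 0) (n : ℤ) :
    pairSum p p 2 1 1 n = pairSum p p 2 1 2 n := by
  have h1 := pairSum_eq_sub_raise hp hp0 hp hp0 (d := 2) (σ := 2) rfl 1 1 n
  have h2 := pairSum_symm hp0 p 2 3 1 n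
  norm_num at h1 h2
  have h3 : pairSum p p 2 3 2 n = 0 := by linear_combination h2 / 2
  rw [h1, h3, mul_zero, sub_zero]

/-- After raising `k` to `2`, the term with `α = 3` vanishes by reflection, and the one with `α = 5`
reflects to `α = 1`. -/
lemma pairSum_C_three_one {p : ℂ} (hp : ‖p‖ < 1) (hp0 : p ≠ 0) (n : ℤ) :
    pairSum p p 2 3 1 n = p ^ n * pairSum p p 2 1 1 n := by
  have h1 := pairSum_eq_sub_raise hp hp0 hp hp0 (d := 2) (σ := 2) rfl 3 1 n
  have h2 := pairSum_symm hp0 p 2 3 1 n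
  have h4 := pairSum_symm hp0 p 2 5 1 n
  norm_num at h1 h2 h4
  have h3 : pairSum p p 2 3 2 n = 0 := by linear_combination h2 / 2
  have h5 : p ^ (n + 1 + 1) = p ^ n * p ^ 2 := by
    rw [add_assoc, zpow_add₀ hp0]; norm_cast
  rw [pairSum_C_one_one hp hp0, h1, h3, h4, h5]
  field_simp
  ring

lemma pairSum_C_one_zero {p : ℂ} (hp : ‖p‖ < 1) (hp0 : p ≠ 0) (n : ℤ) :
   
    pairSum p p 2 1 0 n = (1 - p ^ (2 * n + 1)) * pairSum p p 2 1 1 n := by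
  have h1 := pairSum_eq_sub_raise hp hp0 hp hp0 (d := 2) (σ := 2) rfl 1 0 n
  norm_num at h1
  rw [h1, pairSum_C_three_one hp hp0, show 2 * n + 1 = (n + 1) + n by ring, zpow_add₀ hp0 _ n]
  ring

lemma pairSum_C_sub_one {p : ℂ} (hp : ‖p‖ < 1) (hp0 : p ≠ 0) (n : ℤ) :
   
    pairSum p p 2 1 1 (n - 1) = (1 - p ^ n) * pairSum p p 2 1 0 n := by
  have h1 := pairSum_sub_one hp hp0 hp hp0 (d := 2) (σ := 2) rfl 1 0 n
  have h2 := pairSum_symm hp0 p 2 1 0 n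
  norm_num at h1 h2
  rw [h1, ← h2]
  ring

/-- The Bailey pair relative to `1`. -/
lemma pairSum_C_zero_natCast {p : ℂ} (hp : ‖p‖ < 1) (hp0 : p ≠ 0) (n : ℕ) :
   
    pairSum p p 2 1 0 n = (qPoch p p n * qPoch p (p ^ 2) n)⁻¹ := by
  have hp2 : ‖p ^ 2‖ < 1 := by
    rw [norm_pow]; exact pow_lt_one₀ (norm_nonneg _) hp two_ne_zero
  induction n with
  | zero => simpa [qPoch] using pairSum_zero (by norm_num) 1
  | succ n ih =>
    have h1 := pairSum_C_sub_one hp hp0 (n + 1)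
    have h2 := pairSum_C_one_zero hp hp0 n
    rw [add_sub_cancel_right] at h1
    rw [ih, h1] at h2
    have e1 : p ^ ((n : ℤ) + 1) = p * p ^ n := by
      rw [mul_comm]; exact_mod_cast pow_succ p n
    have e2 : p ^ (2 * (n : ℤ) + 1) = p * (p ^ 2) ^ n := by
      rw [← pow_mul, mul_comm p]; exact_mod_cast pow_succ p (2 * n)
    rw [e1, e2] at h2
    have n1 := qPoch_ne_zero hp hp (n + 1)
    have n2 := qPoch_ne_zero hp2 hp (n + 1)
    rw [qPoch_succ] at n1 n2
    push_cast
    rw [qPoch_succ, qPoch_succ]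
    have n3 := left_ne_zero_of_mul n1
    have n4 := left_ne_zero_of_mul n2
    rw [← mul_eq_one_iff_eq_inv₀ (mul_ne_zero n1 n2)]
    have h3 := mul_inv_cancel₀ (mul_ne_zero n3 n4)
    rw [h2] at h3
    linear_combination h3

/-- The Bailey pair relative to `p`. -/
lemma pairSum_C_one_natCast {p : ℂ} (hp : ‖p‖ < 1) (hp0 : p ≠ 0) (n : ℕ) :
   
    pairSum p p 2 1 1 n = (qPoch p p n * qPoch p (p ^ 2) (n + 1))⁻¹ := by
  have hp2 : ‖p ^ 2‖ < 1 := by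
    rw [norm_pow]; exact pow_lt_one₀ (norm_nonneg _) hp two_ne_zero
  have h2 := pairSum_C_one_zero hp hp0 n
  have n2 := qPoch_ne_zero hp2 hp (n + 1)
  have e2 : p ^ (2 * (n : ℤ) + 1) = p * (p ^ 2) ^ n := by
    rw [← pow_mul, mul_comm p]; exact_mod_cast pow_succ p (2 * n)
  rw [qPoch_succ] at n2 ⊢
  rw [pairSum_C_zero_natCast hp hp0, e2] at h2
  rw [← mul_assoc, mul_inv, h2]
  field_simp [right_ne_zero_of_mul n2]

/-! ### Slater's family G: base `p ^ 4`, step `d = 1` -/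

lemma pairSum_G_neg_one_one {p : ℂ} (hp : ‖p‖ < 1) (hp0 : p ≠ 0) (n : ℤ) :
    pairSum p (p ^ 4) 1 (-1) 1 n = pairSum p (p ^ 4) 1 1 0 n := by
  have hb : ‖p ^ 4‖ < 1 := by rw [norm_pow]; exact pow_lt_one₀ (norm_nonneg _) hp four_ne_zero
  have hb0 := pow_ne_zero 4 hp0
  have hσ : (p ^ 4) ^ (1 : ℤ) = p ^ (4 : ℤ) := by rw [zpow_one]; rfl
  have h1 := pairSum_eq_sub_raise hp hp0 hb hb0 hσ (-1) 0 n
  have h2 := pairSum_symm hp0 (p ^ 4) 1 (-1) 0 n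
  have h3 := pairSum_symm hp0 (p ^ 4) 1 3 1 n
  norm_num at h1 h2 h3
  have h4 : pairSum p (p ^ 4) 1 3 1 n = 0 := by linear_combination h3 / 2
  rw [← h2, h1, h4, mul_zero, sub_zero]

lemma pairSum_G_one_zero {p : ℂ} (hp : ‖p‖ < 1) (hp0 : p ≠ 0) (n : ℤ) :
   
    pairSum p (p ^ 4) 1 1 0 n = (1 + p ^ (4 * n + 2)) * pairSum p (p ^ 4) 1 1 1 n := by
  have hb : ‖p ^ 4‖ < 1 := by rw [norm_pow]; exact pow_lt_one₀ (norm_nonneg _) hp four_ne_zero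
  have hb0 := pow_ne_zero 4 hp0
  have hσ : (p ^ 4) ^ (1 : ℤ) = p ^ (4 : ℤ) := by rw [zpow_one]; rfl
  have h1 := pairSum_eq_sub_raise hp hp0 hb hb0 hσ 1 0 n
  have h2 := pairSum_symm hp0 (p ^ 4) 1 5 1 n
  norm_num at h1 h2
  have e : p ^ (4 * n + 2) = (p ^ 4) ^ (n + 1) * (p ^ 2)⁻¹ := by
    rw [show 4 * n + 2 = 4 * (n + 1) - 2 by ring, zpow_sub₀ hp0, zpow_mul p]; norm_cast
  rw [h1, h2, e]
  ring

/-- Write `U`, `W`, `X` for the sums with `k = 0` and `α = 1, -5, 3`. Lowering `n` gives `U - b ^ n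
* W` with `b = p ^ 4`. Two relations are obtained by raising `k` from `-1`: the vanishing of the sum
with `(α, k) = (-3, -1)` gives `X = b ^ n * U`, and the reflection exchanging `α = -1` and `α = -5`
at `k = -1` gives `U - b ^ n * X = -p ^ 2 * (W - b ^ n * U)`. Eliminating `W` and `X` leaves the
stated factor. -/
lemma pairSum_G_sub_one {p : ℂ} (hp : ‖p‖ < 1) (hp0 : p ≠ 0) (n : ℤ) :
   
    pairSum p (p ^ 4) 1 1 0 (n - 1) =
      (1 - p ^ (8 * n)) * (1 + p ^ (4 * n - 2)) * pairSum p (p ^ 4) 1 1 0 n := by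
  have hb : ‖p ^ 4‖ < 1 := by rw [norm_pow]; exact pow_lt_one₀ (norm_nonneg _) hp four_ne_zero
  have hb0 := pow_ne_zero 4 hp0
  have hσ : (p ^ 4) ^ (1 : ℤ) = p ^ (4 : ℤ) := by rw [zpow_one]; rfl
  have h1 := pairSum_sub_one hp hp0 hb hb0 hσ (-1) 0 n
  have s1 := pairSum_symm hp0 (p ^ 4) 1 1 0 n
  have s3 := pairSum_symm hp0 (p ^ 4) 1 3 0 n
  have t3 := pairSum_symm hp0 (p ^ 4) 1 (-3) (-1) n
  have t1 := pairSum_symm hp0 (p ^ 4) 1 (-1) (-1) n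
  have r3 := pairSum_eq_sub_raise hp hp0 hb hb0 hσ (-3) (-1) n
  have r1 := pairSum_eq_sub_raise hp hp0 hb hb0 hσ (-1) (-1) n
  have r5 := pairSum_eq_sub_raise hp hp0 hb hb0 hσ (-5) (-1) n
  norm_num at h1 s1 s3 t3 t1 r3 r1 r5
  rw [pairSum_G_neg_one_one hp hp0] at h1
  have e1 : p ^ (8 * n) = (p ^ 4) ^ n * (p ^ 4) ^ n := by
    rw [← mul_zpow, ← pow_add, zpow_mul]; norm_cast
  have e2 : p ^ (4 * n - 2) = (p ^ 4) ^ n * (p ^ 2)⁻¹ := by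
    rw [zpow_sub₀ hp0, zpow_mul]; norm_cast
  have z3 : pairSum p (p ^ 4) 1 (-3) (-1) n = 0 := by linear_combination t3 / 2
  rw [r1, r5] at t1
  rw [z3] at r3
  rw [← s3] at r3
  rw [← s1] at h1 t1
  rw [h1, e1, e2]
  set U := pairSum p (p ^ 4) 1 1 0 n
  set W := pairSum p (p ^ 4) 1 (-5) 0 n
  set X := pairSum p (p ^ 4) 1 3 0 n
  have hp2 := pow_ne_zero 2 hp0
  field_simp
  linear_combination (-(p ^ 4) ^ n) * t1 + (p ^ 4) ^ n * (p ^ 4) ^ n * r3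

/-- The Bailey pair relative to `1`, with `x = -p ^ 2`. -/
lemma pairSum_G_zero_natCast {p : ℂ} (hp : ‖p‖ < 1) (hp0 : p ≠ 0) {x : ℂ} (hx : p ^ 2 = -x)
    (n : ℕ) :
    pairSum p (p ^ 4) 1 1 0 n = (qPoch (x ^ 4) (x ^ 4) n * qPoch x (x ^ 2) n)⁻¹ := by
  have hx1 : ‖x‖ < 1 := by
    rw [← norm_neg, ← hx, norm_pow]; exact pow_lt_one₀ (norm_nonneg _) hp two_ne_zero
  have hx2 : ‖x ^ 2‖ < 1 := by rw [norm_pow]; exact pow_lt_one₀ (norm_nonneg _) hx1 two_ne_zero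
  have hx4 : ‖x ^ 4‖ < 1 := by rw [norm_pow]; exact pow_lt_one₀ (norm_nonneg _) hx1 four_ne_zero
  induction n with
  | zero => simpa [qPoch] using pairSum_zero (by norm_num) 1
  | succ n ih =>
    have h1 := pairSum_G_sub_one hp hp0 (n + 1)
    rw [add_sub_cancel_right, ih] at h1
    have e1 : p ^ (8 * ((n : ℤ) + 1)) = x ^ 4 * (x ^ 4) ^ n := by
      rw [show 8 * ((n : ℤ) + 1) = ((2 * (4 * (n + 1)) : ℕ) : ℤ) by push_cast; ring, zpow_natCast,
        pow_mul, hx, pow_mul, neg_pow, pow_succ]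
      norm_num [mul_comm]
    have e2 : p ^ (4 * ((n : ℤ) + 1) - 2) = -(x * (x ^ 2) ^ n) := by
      rw [show 4 * ((n : ℤ) + 1) - 2 = ((2 * (2 * n + 1) : ℕ) : ℤ) by push_cast; ring,
        zpow_natCast, pow_mul, hx, pow_succ, pow_mul]
      norm_num [mul_comm]
    rw [e1, e2] at h1
    have n1 := qPoch_ne_zero hx4 hx4 (n + 1)
    have n2 := qPoch_ne_zero hx2 hx1 (n + 1)
    rw [qPoch_succ] at n1 n2
    push_cast
    rw [qPoch_succ, qPoch_succ]
    have n3 := left_ne_zero_of_mul n1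
    have n4 := left_ne_zero_of_mul n2
    rw [← mul_eq_one_iff_eq_inv₀ (mul_ne_zero n1 n2)]
    have h3 := mul_inv_cancel₀ (mul_ne_zero n3 n4)
    rw [h1] at h3
    linear_combination h3

/-- The Bailey pair relative to `p ^ 4`, with `x = -p ^ 2`. -/
lemma pairSum_G_one_natCast {p : ℂ} (hp : ‖p‖ < 1) (hp0 : p ≠ 0) {x : ℂ} (hx : p ^ 2 = -x)
    (n : ℕ) :
    pairSum p (p ^ 4) 1 1 1 n = (qPoch (x ^ 4) (x ^ 4) n * qPoch x (x ^ 2) (n + 1))⁻¹ := by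
  have hx1 : ‖x‖ < 1 := by
    rw [← norm_neg, ← hx, norm_pow]; exact pow_lt_one₀ (norm_nonneg _) hp two_ne_zero
  have hx2 : ‖x ^ 2‖ < 1 := by rw [norm_pow]; exact pow_lt_one₀ (norm_nonneg _) hx1 two_ne_zero
  have h2 := pairSum_G_one_zero hp hp0 n
  have n2 := qPoch_ne_zero hx2 hx1 (n + 1)
  have e2 : p ^ (4 * (n : ℤ) + 2) = -(x * (x ^ 2) ^ n) := by
    rw [show 4 * (n : ℤ) + 2 = ((2 * (2 * n + 1) : ℕ) : ℤ) by push_cast; ring,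
      zpow_natCast, pow_mul, hx, pow_succ, pow_mul]
    norm_num [mul_comm]
  rw [qPoch_succ] at n2 ⊢
  rw [pairSum_G_zero_natCast hp hp0 hx, e2, ← sub_eq_add_neg] at h2
  rw [← mul_assoc, mul_inv, h2]
  field_simp [right_ne_zero_of_mul n2]

/-- The theta series attached to Rogers' identities. -/
lemma tsum_theta_seven {p : ℂ} (hp : ‖p‖ < 1) (hp0 : p ≠ 0) {α : ℕ} (hα : α ≤ 7) :
    ∑' s : ℤ, (-1) ^ s * p ^ (7 * s ^ 2 + α * s) =
      qPochInf (p ^ 14) (p ^ 14) * qPochInf (p ^ (7 + α)) (p ^ 14) *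
        qPochInf (p ^ (7 - α)) (p ^ 14) := by
  have hp7 : ‖p ^ 7‖ < 1 := by
    rw [norm_pow]; exact pow_lt_one₀ (norm_nonneg _) hp (by norm_num)
  have h := jacobi_triple_product (z := -p ^ α) hp7 (pow_ne_zero 7 hp0)
    (neg_ne_zero.mpr (pow_ne_zero α hp0))
  rw [← pow_mul, inv_neg, neg_mul, neg_mul, neg_neg, neg_neg, ← pow_add, mul_comm (p ^ α)⁻¹,
    ← pow_sub₀ p hp0 hα, add_comm α 7] at h
  rw [← h]
  refine tsum_congr fun s => ?_
  rw [neg_eq_neg_one_mul (p ^ α), mul_zpow, ← zpow_natCast p α, ← zpow_natCast p 7, ← zpow_mul,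
    ← zpow_mul, mul_assoc, ← zpow_add₀ hp0]
  congr 2
  push_cast; ring

/-- Bailey's lemma adds the exponent `4 s² + (α - α') s` of `hd` to the exponent `3 s² + α' s` of
the pair, producing the theta series with `7 s² + α s`. -/
lemma tsum_pairSum {p b : ℂ} (hp : ‖p‖ < 1) (hp0 : p ≠ 0) (hb : ‖b‖ < 1) (hb0 : b ≠ 0)
    {k α : ℕ} {α' d : ℤ} (hk : k ≤ 1) (hα : α ≤ 7)
    (hd : ∀ s : ℤ, b ^ ((d * s) ^ 2 + k * (d * s)) = p ^ (4 * s ^ 2 + (α - α') * s)) :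
    ∑' n : ℕ, b ^ (n ^ 2 + k * n) * pairSum p b d α' k n =
      (qPochInf b b)⁻¹ * (qPochInf (p ^ 14) (p ^ 14) * qPochInf (p ^ (7 + α)) (p ^ 14) *
        qPochInf (p ^ (7 - α)) (p ^ 14)) := by
  rw [← tsum_theta_seven hp hp0 hα]
  refine (bailey hb hb0 hk (summable_norm_neg_one_zpow_mul α' hp hp0) (fun s => d * s)).trans ?_
  congr 1
  refine tsum_congr fun s => ?_
  rw [hd, mul_assoc, ← zpow_add₀ hp0]
  congr 2
  ring

/-- Rogers' modulus 14 identity with `(p⁶, p⁸, p¹⁴; p¹⁴)_∞`. -/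
theorem rogers_fourteen_one {p : ℂ} (hp : ‖p‖ < 1) (hp0 : p ≠ 0) :
    ∑' n : ℕ, p ^ (n ^ 2) * (qPoch p p n * qPoch p (p ^ 2) n)⁻¹ =
      (qPochInf p p)⁻¹ *
        (qPochInf (p ^ 14) (p ^ 14) * qPochInf (p ^ 8) (p ^ 14) * qPochInf (p ^ 6) (p ^ 14)) := by
  refine .trans ?_ (tsum_pairSum hp hp0 hp hp0 (k := 0) (α := 1) (α' := 1) (d := 2) (by norm_num)
    (by norm_num) fun s => ?_)
  · refine tsum_congr fun n => ?_
    rw [← pairSum_C_zero_natCast hp hp0]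
    simp
  · congr 1; push_cast; ring

/-- Rogers' modulus 14 identity with `(p⁴, p¹⁰, p¹⁴; p¹⁴)_∞`. -/
theorem rogers_fourteen_two {p : ℂ} (hp : ‖p‖ < 1) (hp0 : p ≠ 0) :
    ∑' n : ℕ, p ^ (n ^ 2 + n) * (qPoch p p n * qPoch p (p ^ 2) (n + 1))⁻¹ =
      (qPochInf p p)⁻¹ *
        (qPochInf (p ^ 14) (p ^ 14) * qPochInf (p ^ 10) (p ^ 14) * qPochInf (p ^ 4) (p ^ 14)) := by
  refine .trans ?_ (tsum_pairSum hp hp0 hp hp0 (k := 1) (α := 3) (α' := 1) (d := 2) (by norm_num)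
    (by norm_num) fun s => ?_)
  · refine tsum_congr fun n => ?_
    rw [← pairSum_C_one_natCast hp hp0]
    simp
  · congr 1; push_cast; ring

/-- Rogers' modulus 14 identity with `(p², p¹², p¹⁴; p¹⁴)_∞`. -/
theorem rogers_fourteen_three {p : ℂ} (hp : ‖p‖ < 1) (hp0 : p ≠ 0) :
    ∑' n : ℕ, p ^ (n ^ 2 + 2 * n) * (qPoch p p n * qPoch p (p ^ 2) (n + 1))⁻¹ =
      (qPochInf p p)⁻¹ *
        (qPochInf (p ^ 14) (p ^ 14) * qPochInf (p ^ 12) (p ^ 14) * qPochInf (p ^ 2) (p ^ 14)) := by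
  refine .trans ?_ (tsum_pairSum hp hp0 hp hp0 (k := 1) (α := 5) (α' := 3) (d := 2) (by norm_num)
    (by norm_num) fun s => ?_)
  · refine tsum_congr fun n => ?_
    rw [Nat.cast_one, pairSum_C_three_one hp hp0, pairSum_C_one_natCast hp hp0, zpow_natCast]
    ring
  · congr 1; push_cast; ring

/-- The Rogers–Selberg identities live in the base `-x`. Its square root `p` is chosen so that the
exponents `(3 s² + s) / 2` of family G become integral. -/
lemma exists_sq_eq_neg {x : ℂ} (hx : ‖x‖ < 1) (hx0 : x ≠ 0) :
    ∃ p : ℂ, ‖p‖ < 1 ∧ p ≠ 0 ∧ p ^ 2 = -x := by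
  obtain ⟨p, hp⟩ := IsAlgClosed.exists_pow_nat_eq (-x) two_pos
  refine ⟨p, ?_, ?_, hp⟩
  · have : ‖p‖ ^ 2 < 1 := by rw [← norm_pow, hp, norm_neg]; exact hx
    nlinarith [norm_nonneg p]
  · rintro rfl
    exact hx0 (by simpa using hp.symm)

/-- The Rogers–Selberg identity with `(x³, x⁴, x⁷; x⁷)_∞`, after `x ↦ -x`. -/
theorem rogers_selberg_one {x : ℂ} (hx : ‖x‖ < 1) (hx0 : x ≠ 0) :
    ∑' n : ℕ, x ^ (2 * n ^ 2) * (qPoch (x ^ 4) (x ^ 4) n * qPoch x (x ^ 2) n)⁻¹ =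
      (qPochInf (x ^ 2) (x ^ 2))⁻¹ *
        (qPochInf (-x ^ 7) (-x ^ 7) * qPochInf (x ^ 4) (-x ^ 7) * qPochInf (-x ^ 3) (-x ^ 7)) := by
  obtain ⟨p, hp, hp0, hpx⟩ := exists_sq_eq_neg hx hx0
  have hb : ‖p ^ 4‖ < 1 := by rw [norm_pow]; exact pow_lt_one₀ (norm_nonneg _) hp four_ne_zero
  have e4 : p ^ 4 = x ^ 2 := by rw [show 4 = 2 * 2 by rfl, pow_mul, hpx]; ring
  have e14 : p ^ 14 = -x ^ 7 := by rw [show 14 = 2 * 7 by rfl, pow_mul, hpx]; ring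
  have e8 : p ^ 8 = x ^ 4 := by rw [show 8 = 2 * 4 by rfl, pow_mul, hpx]; ring
  have e6 : p ^ 6 = -x ^ 3 := by rw [show 6 = 2 * 3 by rfl, pow_mul, hpx]; ring
  rw [← e4, ← e14, ← e8, ← e6]
  refine .trans ?_ (tsum_pairSum hp hp0 hb (pow_ne_zero 4 hp0) (k := 0) (α := 1) (α' := 1) (d := 1)
    (by norm_num) (by norm_num) fun s => ?_)
  · refine tsum_congr fun n => ?_
    rw [e8, Nat.cast_zero, pairSum_G_zero_natCast hp hp0 hpx, e4]
    ring
  · rw [← zpow_natCast p 4, ← zpow_mul]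
    congr 1; push_cast; ring

/-- The Rogers–Selberg identity with `(x², x⁵, x⁷; x⁷)_∞`, after `x ↦ -x`. -/
theorem rogers_selberg_two {x : ℂ} (hx : ‖x‖ < 1) (hx0 : x ≠ 0) :
    ∑' n : ℕ, x ^ (2 * n ^ 2 + 2 * n) * (qPoch (x ^ 4) (x ^ 4) n * qPoch x (x ^ 2) n)⁻¹ =
      (qPochInf (x ^ 2) (x ^ 2))⁻¹ *
        (qPochInf (-x ^ 7) (-x ^ 7) * qPochInf (-x ^ 5) (-x ^ 7) * qPochInf (x ^ 2) (-x ^ 7)) := by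
  obtain ⟨p, hp, hp0, hpx⟩ := exists_sq_eq_neg hx hx0
  have hb : ‖p ^ 4‖ < 1 := by rw [norm_pow]; exact pow_lt_one₀ (norm_nonneg _) hp four_ne_zero
  have e4 : p ^ 4 = x ^ 2 := by rw [show 4 = 2 * 2 by rfl, pow_mul, hpx]; ring
  have e14 : p ^ 14 = -x ^ 7 := by rw [show 14 = 2 * 7 by rfl, pow_mul, hpx]; ring
  have e10 : p ^ 10 = -x ^ 5 := by rw [show 10 = 2 * 5 by rfl, pow_mul, hpx]; ring
  rw [← e4, ← e14, ← e10]
  refine .trans ?_ (tsum_pairSum hp hp0 hb (pow_ne_zero 4 hp0) (k := 1) (α := 3) (α' := -1) (d := 1)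
    (by norm_num) (by norm_num) fun s => ?_)
  · refine tsum_congr fun n => ?_
    rw [Nat.cast_one, pairSum_G_neg_one_one hp hp0, pairSum_G_zero_natCast hp hp0 hpx, e4]
    ring
  · rw [← zpow_natCast p 4, ← zpow_mul]
    congr 1; push_cast; ring

/-- The Rogers–Selberg identity with `(x, x⁶, x⁷; x⁷)_∞`, after `x ↦ -x`. -/
theorem rogers_selberg_three {x : ℂ} (hx : ‖x‖ < 1) (hx0 : x ≠ 0) :
    ∑' n : ℕ, x ^ (2 * n ^ 2 + 2 * n) * (qPoch (x ^ 4) (x ^ 4) n * qPoch x (x ^ 2) (n + 1))⁻¹ =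
      (qPochInf (x ^ 2) (x ^ 2))⁻¹ *
        (qPochInf (-x ^ 7) (-x ^ 7) * qPochInf (x ^ 6) (-x ^ 7) * qPochInf (-x) (-x ^ 7)) := by
  obtain ⟨p, hp, hp0, hpx⟩ := exists_sq_eq_neg hx hx0
  have hb : ‖p ^ 4‖ < 1 := by rw [norm_pow]; exact pow_lt_one₀ (norm_nonneg _) hp four_ne_zero
  have e4 : p ^ 4 = x ^ 2 := by rw [show 4 = 2 * 2 by rfl, pow_mul, hpx]; ring
  have e14 : p ^ 14 = -x ^ 7 := by rw [show 14 = 2 * 7 by rfl, pow_mul, hpx]; ring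
  have e12 : p ^ 12 = x ^ 6 := by rw [show 12 = 2 * 6 by rfl, pow_mul, hpx]; ring
  rw [← e4, ← e14, ← e12, ← hpx]
  refine .trans ?_ (tsum_pairSum hp hp0 hb (pow_ne_zero 4 hp0) (k := 1) (α := 5) (α' := 1) (d := 1)
    (by norm_num) (by norm_num) fun s => ?_)
  · refine tsum_congr fun n => ?_
    rw [Nat.cast_one, pairSum_G_one_natCast hp hp0 hpx, e4]
    ring
  · rw [← zpow_natCast p 4, ← zpow_mul]
    congr 1; push_cast; ring

/-! ### Reduction of the double sums to Rogers' identities -/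

lemma norm_pow_lt_one {q : ℂ} (hq : ‖q‖ < 1) {n : ℕ} (hn : n ≠ 0) : ‖q ^ n‖ < 1 := by
  rw [norm_pow]; exact pow_lt_one₀ (norm_nonneg _) hq hn

lemma summable_norm_natCast_quad {q : ℂ} (hq : ‖q‖ < 1) (hq0 : q ≠ 0) (c : ℤ) :
    Summable fun i : ℕ => ‖q‖ ^ ((i : ℤ) ^ 2 + c * i) := by
  simpa [Function.comp_def] using
    (summable_norm_zpow_quad c hq hq0).comp_injective (Nat.cast_injective (R := ℤ))

lemma summable_double {q : ℂ} (hq : ‖q‖ < 1) (hq0 : q ≠ 0) (c e : ℤ) :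
    Summable fun p : ℕ × ℕ =>
      q ^ (4 * (p.1 : ℤ) ^ 2 + 3 * (p.2 : ℤ) ^ 2 - 4 * (p.1 : ℤ) * (p.2 : ℤ) + c * p.1 + e * p.2) /
        (qPoch (q ^ 8) (q ^ 8) p.1 * qPoch (q ^ 8) (q ^ 8) p.2) := by
  obtain ⟨M, hM, hle⟩ := exists_norm_inv_qPoch_le (norm_pow_lt_one hq (n := 8) (by norm_num))
  refine .of_norm_bounded (g := fun p : ℕ × ℕ => (‖q‖ ^ ((p.1 : ℤ) ^ 2 + c * p.1) * M) *
      (‖q‖ ^ ((p.2 : ℤ) ^ 2 + e * p.2) * M)) ?_ fun p => ?_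
  · exact ((summable_norm_natCast_quad hq hq0 c).mul_right M).mul_of_nonneg
      ((summable_norm_natCast_quad hq hq0 e).mul_right M)
      (fun _ => by positivity) (fun _ => by positivity)
  · have hpos : 0 < ‖q‖ := norm_pos_iff.mpr hq0
    rw [div_eq_mul_inv, mul_inv, norm_mul, norm_mul, norm_zpow]
    calc _ ≤ ‖q‖ ^ (((p.1 : ℤ) ^ 2 + c * p.1) + ((p.2 : ℤ) ^ 2 + e * p.2)) * (M * M) := by
          gcongr ?_ * (?_ * ?_)
          · refine zpow_le_zpow_right_of_le_one₀ hpos hq.le ?_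
            -- The quadratic form exceeds `i² + j²` by `3 i² - 4 i j + 2 j² = (i - j)² + (2 i - j)²
            -- / 2 + j² / 2`.
            nlinarith [sq_nonneg ((p.1 : ℤ) - p.2), sq_nonneg (2 * (p.1 : ℤ) - p.2)]
          · apply hle
          · apply hle
      _ = _ := by rw [zpow_add₀ hpos.ne']; ring

/-- For fixed `j` the sum over `i` is Euler's series in the base `q ^ 8` at `z = q ^ (4 - 4 j + c)`,
because `4 i² = 8 (i choose 2) + 4 i`. -/
lemma tsum_double {q : ℂ} (hq : ‖q‖ < 1) (hq0 : q ≠ 0) (c e : ℤ) :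
    Summable (fun j : ℕ => q ^ (3 * (j : ℤ) ^ 2 + e * j) * (qPoch (q ^ 8) (q ^ 8) j)⁻¹ *
      qPochInf (-(q ^ (4 - 4 * (j : ℤ) + c))) (q ^ 8)) ∧
    ∑' p : ℕ × ℕ,
      q ^ (4 * (p.1 : ℤ) ^ 2 + 3 * (p.2 : ℤ) ^ 2 - 4 * (p.1 : ℤ) * (p.2 : ℤ) + c * p.1 + e * p.2) /
        (qPoch (q ^ 8) (q ^ 8) p.1 * qPoch (q ^ 8) (q ^ 8) p.2) =
    ∑' j : ℕ, q ^ (3 * (j : ℤ) ^ 2 + e * j) * (qPoch (q ^ 8) (q ^ 8) j)⁻¹ *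
      qPochInf (-(q ^ (4 - 4 * (j : ℤ) + c))) (q ^ 8) := by
  have hs := (summable_double hq hq0 c e).prod_symm
  have hinner : ∀ j : ℕ, ∑' i : ℕ,
      q ^ (4 * (i : ℤ) ^ 2 + 3 * (j : ℤ) ^ 2 - 4 * (i : ℤ) * (j : ℤ) + c * i + e * j) /
        (qPoch (q ^ 8) (q ^ 8) i * qPoch (q ^ 8) (q ^ 8) j) =
      q ^ (3 * (j : ℤ) ^ 2 + e * j) * (qPoch (q ^ 8) (q ^ 8) j)⁻¹ *
        qPochInf (-(q ^ (4 - 4 * (j : ℤ) + c))) (q ^ 8) := by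
    intro j
    rw [← tsum_euler (norm_pow_lt_one hq (by norm_num)), ← tsum_mul_left]
    refine tsum_congr fun i => ?_
    have h1 : q ^ (4 * (i : ℤ) ^ 2 + 3 * (j : ℤ) ^ 2 - 4 * (i : ℤ) * (j : ℤ) + c * i + e * j) =
        q ^ (3 * (j : ℤ) ^ 2 + e * j) * ((q ^ 8) ^ (i.choose 2) * (q ^ (4 - 4 * (j : ℤ) + c)) ^ i) := by
      rw [← pow_mul, ← zpow_natCast, ← zpow_natCast (q ^ (4 - 4 * (j : ℤ) + c)) i, ← zpow_mul,
        ← zpow_add₀ hq0, ← zpow_add₀ hq0]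
      congr 1
      have := sq_eq_two_mul_choose_add i
      zify at this
      push_cast
      linear_combination 4 * this
    rw [h1, div_eq_mul_inv, mul_inv]
    ring
  constructor
  · exact hs.prod.congr hinner
  · rw [← (Equiv.prodComm ℕ ℕ).tsum_eq]
    exact hs.tsum_prod.trans (tsum_congr hinner)

/-- Dividing the argument by `Q` adds one factor at the front of the product; extracting `w` times a
negative power of `Q` from each of the `k` new factors turns them into a product with increasing
powers of `Q`. -/
lemma qPochInf_div_pow {w Q : ℂ} (hQ : ‖Q‖ < 1) (hQ0 : Q ≠ 0) (hw : w ≠ 0) (k : ℕ) :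
    Q ^ ((k + 1).choose 2) * qPochInf (-(w * (Q ^ k)⁻¹)) Q =
      w ^ k * qPoch (-(Q * w⁻¹)) Q k * qPochInf (-w) Q := by
  induction k with
  | zero => simp [qPoch]
  | succ k ih =>
    rw [qPochInf_eq_one_sub_mul _ hQ, qPoch_succ, Nat.choose_succ_succ' (k + 1) 1,
      Nat.choose_one_right, pow_add]
    have h1 : -(w * (Q ^ (k + 1))⁻¹) * Q = -(w * (Q ^ k)⁻¹) := by
      rw [pow_succ]; field_simp
    have h2 : Q ^ (k + 1) * (1 - -(w * (Q ^ (k + 1))⁻¹)) = w * (1 - -(Q * w⁻¹) * Q ^ k) := by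
      rw [pow_succ]; field_simp; ring
    rw [h1]
    linear_combination Q ^ ((k + 1).choose 2) * qPochInf (-(w * (Q ^ k)⁻¹)) Q * h2 +
      w * (1 - -(Q * w⁻¹) * Q ^ k) * ih

lemma zpow_mul_qPochInf_one {q : ℂ} (hq : ‖q‖ < 1) (hq0 : q ≠ 0) (k : ℕ) (a : ℤ) :
    q ^ (a + 4 * (k : ℤ) ^ 2 + 4 * k) * qPochInf (-(q ^ (-8 * (k : ℤ)))) (q ^ 8) =
      q ^ a * (2 * qPochInf (-(q ^ 8)) (q ^ 8) * qPoch (-(q ^ 8)) (q ^ 8) k) := by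
  have hQ := norm_pow_lt_one hq (n := 8) (by norm_num)
  have h := qPochInf_div_pow hQ (pow_ne_zero 8 hq0) one_ne_zero k
  have h1 : qPochInf (-1) (q ^ 8) = 2 * qPochInf (-(q ^ 8)) (q ^ 8) := by
    rw [qPochInf_eq_one_sub_mul _ hQ]; norm_num
  have h2 : (q ^ 8) ^ ((k + 1).choose 2) = q ^ (4 * (k : ℤ) ^ 2 + 4 * k) := by
    rw [← pow_mul, ← zpow_natCast]
    congr 1
    have := sq_eq_two_mul_choose_add (k + 1)
    zify at this
    push_cast
    linear_combination -4 * this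
  have h3 : 1 * ((q ^ 8) ^ k)⁻¹ = q ^ (-8 * (k : ℤ)) := by
    rw [one_mul, ← pow_mul, neg_mul, zpow_neg]; norm_cast
  rw [h1, h2, h3, one_pow, inv_one, mul_one, one_mul] at h
  rw [add_assoc, zpow_add₀ hq0, mul_assoc, h]
  ring

lemma zpow_mul_qPochInf_four {q : ℂ} (hq : ‖q‖ < 1) (hq0 : q ≠ 0) (k : ℕ) (a : ℤ) :
    q ^ (a + 4 * (k : ℤ) ^ 2) * qPochInf (-(q ^ (4 - 8 * (k : ℤ)))) (q ^ 8) =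
      q ^ a * (qPochInf (-(q ^ 4)) (q ^ 8) * qPoch (-(q ^ 4)) (q ^ 8) k) := by
  have hQ := norm_pow_lt_one hq (n := 8) (by norm_num)
  have h := qPochInf_div_pow hQ (pow_ne_zero 8 hq0) (pow_ne_zero 4 hq0) k
  have h2 : (q ^ 8) ^ ((k + 1).choose 2) = q ^ (4 * (k : ℤ) ^ 2) * (q ^ 4) ^ k := by
    rw [← pow_mul, ← pow_mul, ← zpow_natCast, ← zpow_natCast, ← zpow_add₀ hq0]
    congr 1
    have := sq_eq_two_mul_choose_add (k + 1)
    zify at this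
    push_cast
    linear_combination -4 * this
  have h3 : q ^ 4 * ((q ^ 8) ^ k)⁻¹ = q ^ (4 - 8 * (k : ℤ)) := by
    rw [← pow_mul, zpow_sub₀ hq0, div_eq_mul_inv]; norm_cast
  have h4 : q ^ 8 * (q ^ 4)⁻¹ = q ^ 4 := by
    rw [show 8 = 4 + 4 by rfl, pow_add]; field_simp
  rw [h2, h3, h4] at h
  have h5 : q ^ (4 * (k : ℤ) ^ 2) * qPochInf (-(q ^ (4 - 8 * (k : ℤ)))) (q ^ 8) =
      qPochInf (-(q ^ 4)) (q ^ 8) * qPoch (-(q ^ 4)) (q ^ 8) k := by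
    refine mul_left_cancel₀ (pow_ne_zero k (pow_ne_zero 4 hq0)) ?_
    linear_combination h
  rw [zpow_add₀ hq0, mul_assoc, h5]

lemma qPoch_neg_ne_zero {a q : ℂ} (hq : ‖q‖ < 1) (ha : ‖a‖ < 1) (n : ℕ) : qPoch (-a) q n ≠ 0 :=
  qPoch_ne_zero hq (by rwa [norm_neg]) n

/-- Here `(Q; Q)_{2k} = (Q; Q²)_k (Q²; Q²)_k` and `(Q²; Q²)_k = (Q; Q)_k (-Q; Q)_k`, so the finite
product left by the reduction cancels and Rogers' denominators remain. -/
lemma inv_qPoch_two_mul {Q : ℂ} (hQ : ‖Q‖ < 1) (k : ℕ) :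
    (qPoch Q Q (2 * k))⁻¹ * qPoch (-Q) Q k = (qPoch Q Q k * qPoch Q (Q ^ 2) k)⁻¹ := by
  have h1 := qPoch_two_mul Q Q k
  rw [← pow_two, ← qPoch_mul_neg] at h1
  rw [h1, mul_inv, mul_inv, mul_inv]
  field_simp [qPoch_neg_ne_zero hQ hQ k]

lemma inv_qPoch_two_mul_add_one {Q : ℂ} (hQ : ‖Q‖ < 1) (k : ℕ) :
    (qPoch Q Q (2 * k + 1))⁻¹ * qPoch (-Q) Q k = (qPoch Q Q k * qPoch Q (Q ^ 2) (k + 1))⁻¹ := by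
  have h1 := qPoch_two_mul_add_one Q Q k
  rw [← pow_two, ← qPoch_mul_neg Q Q k] at h1
  rw [h1, mul_inv, mul_inv, mul_inv]
  field_simp [qPoch_neg_ne_zero hQ hQ k]

/-- Now the other half splits: `(x²; x⁴)_k = (x; x²)_k (-x; x²)_k`. Cancelling the second factor
leaves the Rogers–Selberg denominators. -/
lemma inv_qPoch_sq_two_mul {x : ℂ} (hx : ‖x‖ < 1) (k : ℕ) :
    (qPoch (x ^ 2) (x ^ 2) (2 * k))⁻¹ * qPoch (-x) (x ^ 2) k =
      (qPoch (x ^ 4) (x ^ 4) k * qPoch x (x ^ 2) k)⁻¹ := by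
  have h1 := qPoch_two_mul (x ^ 2) (x ^ 2) k
  rw [← qPoch_mul_neg x (x ^ 2) k, ← pow_add, ← pow_mul] at h1
  rw [h1, mul_inv, mul_inv, mul_inv]
  field_simp [qPoch_neg_ne_zero (norm_pow_lt_one hx two_ne_zero) hx k]

lemma inv_qPoch_sq_two_mul_add_one {x : ℂ} (hx : ‖x‖ < 1) (k : ℕ) :
    (qPoch (x ^ 2) (x ^ 2) (2 * k + 1))⁻¹ * qPoch (-x) (x ^ 2) (k + 1) =
      (qPoch (x ^ 4) (x ^ 4) k * qPoch x (x ^ 2) (k + 1))⁻¹ := by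
  have h1 := qPoch_two_mul_add_one (x ^ 2) (x ^ 2) k
  rw [← qPoch_mul_neg x (x ^ 2) (k + 1), ← pow_add, ← pow_mul] at h1
  rw [h1, mul_inv, mul_inv, mul_inv]
  field_simp [qPoch_neg_ne_zero (norm_pow_lt_one hx two_ne_zero) hx (k + 1)]

/-- Splitting of the single sum according to the parity of the summation index. -/
lemma hasSum_double {q : ℂ} (hq : ‖q‖ < 1) (hq0 : q ≠ 0) (c e : ℤ) {f g : ℕ → ℂ} {a b : ℂ}
    (hf : ∀ k : ℕ, q ^ (3 * (2 * k : ℤ) ^ 2 + e * (2 * k)) * (qPoch (q ^ 8) (q ^ 8) (2 * k))⁻¹ *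
      qPochInf (-(q ^ (4 - 4 * (2 * k : ℤ) + c))) (q ^ 8) = a * f k)
    (hg : ∀ k : ℕ, q ^ (3 * (2 * k + 1 : ℤ) ^ 2 + e * (2 * k + 1)) *
      (qPoch (q ^ 8) (q ^ 8) (2 * k + 1))⁻¹ *
      qPochInf (-(q ^ (4 - 4 * (2 * k + 1 : ℤ) + c))) (q ^ 8) = b * g k) :
    HasSum (fun p : ℕ × ℕ =>
      q ^ (4 * (p.1 : ℤ) ^ 2 + 3 * (p.2 : ℤ) ^ 2 - 4 * (p.1 : ℤ) * (p.2 : ℤ) + c * p.1 + e * p.2) /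
        (qPoch (q ^ 8) (q ^ 8) p.1 * qPoch (q ^ 8) (q ^ 8) p.2))
      (a * ∑' k, f k + b * ∑' k, g k) := by
  obtain ⟨hs, ht⟩ := tsum_double hq hq0 c e
  convert (summable_double hq hq0 c e).hasSum using 1
  rw [ht]
  generalize hF : (fun j : ℕ => q ^ (3 * (j : ℤ) ^ 2 + e * j) * (qPoch (q ^ 8) (q ^ 8) j)⁻¹ *
    qPochInf (-(q ^ (4 - 4 * (j : ℤ) + c))) (q ^ 8)) = F at hs
  have hf' : ∀ k, F (2 * k) = a * f k := fun k => by
    rw [← hf, ← hF]; push_cast; rfl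
  have hg' : ∀ k, F (2 * k + 1) = b * g k := fun k => by
    rw [← hg, ← hF]; push_cast; rfl
  rw [← tsum_even_add_odd (f := F) (hs.comp_injective (mul_right_injective₀ two_ne_zero))
    (hs.comp_injective ((add_left_injective 1).comp (mul_right_injective₀ two_ne_zero))),
    ← tsum_mul_left, ← tsum_mul_left, tsum_congr hf', tsum_congr hg']

/-- The first double sum as a combination of two infinite products. -/
lemma hasSum_double_one {q : ℂ} (hq : ‖q‖ < 1) (hq0 : q ≠ 0) :
    HasSum (fun p : ℕ × ℕ =>
      q ^ (4 * (p.1 : ℤ) ^ 2 + 3 * (p.2 : ℤ) ^ 2 - 4 * (p.1 : ℤ) * (p.2 : ℤ) - 4 * (p.1 : ℤ)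
        + 2 * (p.2 : ℤ)) /
        (qPoch (q ^ 8) (q ^ 8) p.1 * qPoch (q ^ 8) (q ^ 8) p.2))
      (2 * qPochInf (-(q ^ 8)) (q ^ 8) *
        ∑' k : ℕ, (q ^ 8) ^ (k ^ 2) * (qPoch (q ^ 8) (q ^ 8) k * qPoch (q ^ 8) ((q ^ 8) ^ 2) k)⁻¹ +
      q * qPochInf (-(q ^ 4)) (q ^ 8) * ∑' k : ℕ, (q ^ 4) ^ (2 * k ^ 2 + 2 * k) *
        (qPoch ((q ^ 4) ^ 4) ((q ^ 4) ^ 4) k * qPoch (q ^ 4) ((q ^ 4) ^ 2) (k + 1))⁻¹) := by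
  have hx := norm_pow_lt_one hq (n := 4) (by norm_num)
  have hQ := norm_pow_lt_one hq (n := 8) (by norm_num)
  have h := hasSum_double hq hq0 (-4) 2 (a := 2 * qPochInf (-(q ^ 8)) (q ^ 8))
    (b := q * qPochInf (-(q ^ 4)) (q ^ 8))
    (f := fun k => (q ^ 8) ^ (k ^ 2) * (qPoch (q ^ 8) (q ^ 8) k * qPoch (q ^ 8) ((q ^ 8) ^ 2) k)⁻¹)
    (g := fun k => (q ^ 4) ^ (2 * k ^ 2 + 2 * k) *
        (qPoch ((q ^ 4) ^ 4) ((q ^ 4) ^ 4) k * qPoch (q ^ 4) ((q ^ 4) ^ 2) (k + 1))⁻¹)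
    (fun k => ?_) (fun k => ?_)
  · simpa only [neg_mul, ← sub_eq_add_neg] using h
  · have h1 := zpow_mul_qPochInf_one hq hq0 k (8 * (k : ℤ) ^ 2)
    have e1 : q ^ (8 * (k : ℤ) ^ 2) = (q ^ 8) ^ (k ^ 2) := by rw [← pow_mul]; norm_cast
    rw [← inv_qPoch_two_mul hQ, show 3 * (2 * k : ℤ) ^ 2 + 2 * (2 * k) =
      8 * (k : ℤ) ^ 2 + 4 * k ^ 2 + 4 * k by ring,
      show 4 - 4 * (2 * k : ℤ) + -4 = -8 * k by ring, ← e1]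
    linear_combination (qPoch (q ^ 8) (q ^ 8) (2 * k))⁻¹ * h1
  · have h1 := zpow_mul_qPochInf_four hq hq0 (k + 1) (8 * (k : ℤ) ^ 2 + 8 * k + 1)
    have e1 : q ^ (8 * (k : ℤ) ^ 2 + 8 * k + 1) = q * (q ^ 4) ^ (2 * k ^ 2 + 2 * k) := by
      rw [← pow_mul, zpow_add₀ hq0, zpow_one, mul_comm q, ← zpow_natCast]
      congr 2; push_cast; ring
    push_cast at h1
    rw [← inv_qPoch_sq_two_mul_add_one hx, ← pow_mul q 4 2, show 3 * (2 * k + 1 : ℤ) ^ 2 +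
      2 * (2 * k + 1) = 8 * (k : ℤ) ^ 2 + 8 * k + 1 + 4 * (k + 1) ^ 2 by ring,
      show 4 - 4 * (2 * k + 1 : ℤ) + -4 = 4 - 8 * (k + 1) by ring]
    rw [e1] at h1
    linear_combination (qPoch (q ^ 8) (q ^ 8) (2 * k + 1))⁻¹ * h1

/-- The second double sum as a combination of two infinite products. -/
lemma hasSum_double_two {q : ℂ} (hq : ‖q‖ < 1) (hq0 : q ≠ 0) :
    HasSum (fun p : ℕ × ℕ =>
      q ^ (4 * (p.1 : ℤ) ^ 2 + 3 * (p.2 : ℤ) ^ 2 - 4 * (p.1 : ℤ) * (p.2 : ℤ)) /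
        (qPoch (q ^ 8) (q ^ 8) p.1 * qPoch (q ^ 8) (q ^ 8) p.2))
      (qPochInf (-(q ^ 4)) (q ^ 8) * ∑' k : ℕ, (q ^ 4) ^ (2 * k ^ 2) *
        (qPoch ((q ^ 4) ^ 4) ((q ^ 4) ^ 4) k * qPoch (q ^ 4) ((q ^ 4) ^ 2) k)⁻¹ +
      2 * q ^ 3 * qPochInf (-(q ^ 8)) (q ^ 8) * ∑' k : ℕ, (q ^ 8) ^ (k ^ 2 + k) *
        (qPoch (q ^ 8) (q ^ 8) k * qPoch (q ^ 8) ((q ^ 8) ^ 2) (k + 1))⁻¹) := by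
  have hx := norm_pow_lt_one hq (n := 4) (by norm_num)
  have hQ := norm_pow_lt_one hq (n := 8) (by norm_num)
  have h := hasSum_double hq hq0 0 0 (a := qPochInf (-(q ^ 4)) (q ^ 8))
    (b := 2 * q ^ 3 * qPochInf (-(q ^ 8)) (q ^ 8))
    (f := fun k => (q ^ 4) ^ (2 * k ^ 2) *
        (qPoch ((q ^ 4) ^ 4) ((q ^ 4) ^ 4) k * qPoch (q ^ 4) ((q ^ 4) ^ 2) k)⁻¹)
    (g := fun k => (q ^ 8) ^ (k ^ 2 + k) *
        (qPoch (q ^ 8) (q ^ 8) k * qPoch (q ^ 8) ((q ^ 8) ^ 2) (k + 1))⁻¹)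
    (fun k => ?_) (fun k => ?_)
  · simpa only [zero_mul, add_zero] using h
  · have h1 := zpow_mul_qPochInf_four hq hq0 k (8 * (k : ℤ) ^ 2)
    have e1 : q ^ (8 * (k : ℤ) ^ 2) = (q ^ 4) ^ (2 * k ^ 2) := by
      rw [← pow_mul, ← zpow_natCast]; congr 1; push_cast; ring
    rw [← inv_qPoch_sq_two_mul hx, ← pow_mul q 4 2, show 3 * (2 * k : ℤ) ^ 2 + 0 * (2 * k) =
      8 * (k : ℤ) ^ 2 + 4 * k ^ 2 by ring,
      show 4 - 4 * (2 * k : ℤ) + 0 = 4 - 8 * k by ring, ← e1]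
    linear_combination (qPoch (q ^ 8) (q ^ 8) (2 * k))⁻¹ * h1
  · have h1 := zpow_mul_qPochInf_one hq hq0 k (8 * (k : ℤ) ^ 2 + 8 * k + 3)
    have e1 : q ^ (8 * (k : ℤ) ^ 2 + 8 * k + 3) = q ^ 3 * (q ^ 8) ^ (k ^ 2 + k) := by
      rw [← pow_mul, ← pow_add, ← zpow_natCast]
      congr 1; push_cast; ring
    rw [← inv_qPoch_two_mul_add_one hQ, show 3 * (2 * k + 1 : ℤ) ^ 2 +
      0 * (2 * k + 1) = 8 * (k : ℤ) ^ 2 + 8 * k + 3 + 4 * k ^ 2 + 4 * k by ring,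
      show 4 - 4 * (2 * k + 1 : ℤ) + 0 = -8 * k by ring]
    rw [e1] at h1
    linear_combination (qPoch (q ^ 8) (q ^ 8) (2 * k + 1))⁻¹ * h1

/-- The third double sum as a combination of two infinite products. -/
lemma hasSum_double_three {q : ℂ} (hq : ‖q‖ < 1) (hq0 : q ≠ 0) :
    HasSum (fun p : ℕ × ℕ =>
      q ^ (4 * (p.1 : ℤ) ^ 2 + 3 * (p.2 : ℤ) ^ 2 - 4 * (p.1 : ℤ) * (p.2 : ℤ) + 4 * (p.2 : ℤ)) /
        (qPoch (q ^ 8) (q ^ 8) p.1 * qPoch (q ^ 8) (q ^ 8) p.2))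
      (qPochInf (-(q ^ 4)) (q ^ 8) * ∑' k : ℕ, (q ^ 4) ^ (2 * k ^ 2 + 2 * k) *
        (qPoch ((q ^ 4) ^ 4) ((q ^ 4) ^ 4) k * qPoch (q ^ 4) ((q ^ 4) ^ 2) k)⁻¹ +
      2 * q ^ 7 * qPochInf (-(q ^ 8)) (q ^ 8) * ∑' k : ℕ, (q ^ 8) ^ (k ^ 2 + 2 * k) *
        (qPoch (q ^ 8) (q ^ 8) k * qPoch (q ^ 8) ((q ^ 8) ^ 2) (k + 1))⁻¹) := by
  have hx := norm_pow_lt_one hq (n := 4) (by norm_num)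
  have hQ := norm_pow_lt_one hq (n := 8) (by norm_num)
  have h := hasSum_double hq hq0 0 4 (a := qPochInf (-(q ^ 4)) (q ^ 8))
    (b := 2 * q ^ 7 * qPochInf (-(q ^ 8)) (q ^ 8))
    (f := fun k => (q ^ 4) ^ (2 * k ^ 2 + 2 * k) *
        (qPoch ((q ^ 4) ^ 4) ((q ^ 4) ^ 4) k * qPoch (q ^ 4) ((q ^ 4) ^ 2) k)⁻¹)
    (g := fun k => (q ^ 8) ^ (k ^ 2 + 2 * k) *
        (qPoch (q ^ 8) (q ^ 8) k * qPoch (q ^ 8) ((q ^ 8) ^ 2) (k + 1))⁻¹)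
    (fun k => ?_) (fun k => ?_)
  · simpa only [zero_mul, add_zero] using h
  · have h1 := zpow_mul_qPochInf_four hq hq0 k (8 * (k : ℤ) ^ 2 + 8 * k)
    have e1 : q ^ (8 * (k : ℤ) ^ 2 + 8 * k) = (q ^ 4) ^ (2 * k ^ 2 + 2 * k) := by
      rw [← pow_mul, ← zpow_natCast]; congr 1; push_cast; ring
    rw [← inv_qPoch_sq_two_mul hx, ← pow_mul q 4 2, show 3 * (2 * k : ℤ) ^ 2 + 4 * (2 * k) =
      8 * (k : ℤ) ^ 2 + 8 * k + 4 * k ^ 2 by ring,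
      show 4 - 4 * (2 * k : ℤ) + 0 = 4 - 8 * k by ring, ← e1]
    linear_combination (qPoch (q ^ 8) (q ^ 8) (2 * k))⁻¹ * h1
  · have h1 := zpow_mul_qPochInf_one hq hq0 k (8 * (k : ℤ) ^ 2 + 16 * k + 7)
    have e1 : q ^ (8 * (k : ℤ) ^ 2 + 16 * k + 7) = q ^ 7 * (q ^ 8) ^ (k ^ 2 + 2 * k) := by
      rw [← pow_mul, ← pow_add, ← zpow_natCast]
      congr 1; push_cast; ring
    rw [← inv_qPoch_two_mul_add_one hQ, show 3 * (2 * k + 1 : ℤ) ^ 2 +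
      4 * (2 * k + 1) = 8 * (k : ℤ) ^ 2 + 16 * k + 7 + 4 * k ^ 2 + 4 * k by ring,
      show 4 - 4 * (2 * k + 1 : ℤ) + 0 = -8 * k by ring]
    rw [e1] at h1
    linear_combination (qPoch (q ^ 8) (q ^ 8) (2 * k + 1))⁻¹ * h1

/-! ### Infinite products of level 28 -/

/-- The product `(x^k; x^28)_∞`. -/
noncomputable def levelProd (x : ℂ) (k : ℕ) : ℂ := qPochInf (x ^ k) (x ^ 28)

lemma levelProd_ne_zero {x : ℂ} (hx : ‖x‖ < 1) {k : ℕ} (hk : k ≠ 0) : levelProd x k ≠ 0 :=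
  qPochInf_ne_zero_of_norm_lt (norm_pow_lt_one hx (by norm_num)) (norm_pow_lt_one hx hk)

/-- The product `(x^a, x^(28-a); x^28)_∞`. -/
noncomputable def pairProd (x : ℂ) (a : ℕ) : ℂ := levelProd x a * levelProd x (28 - a)

/-- Quotients of products `pairProd x a`. -/
noncomputable def pairQuot (l₁ l₂ : List ℕ) (x : ℂ) : ℂ :=
  (l₁.map (pairProd x)).prod / (l₂.map (pairProd x)).prod

lemma qPochInf_pow_eq_prod_levelProd {x : ℂ} (hx : ‖x‖ < 1) {m c : ℕ} (hmc : m * c = 28) (a : ℕ) :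
    qPochInf (x ^ a) (x ^ m) = ∏ i ∈ range c, levelProd x (a + m * i) := by
  have hm : m ≠ 0 := by rintro rfl; simp at hmc
  have hc : 0 < c := Nat.pos_of_ne_zero (by rintro rfl; simp at hmc)
  rw [qPochInf_eq_prod _ (norm_pow_lt_one hx hm) hc, ← pow_mul, hmc]
  exact prod_congr rfl fun i _ => by rw [levelProd, ← pow_mul, ← pow_add]

lemma J_eq_prod_levelProd {q : ℂ} (hq : ‖q‖ < 1) {m c : ℕ} (hmc : m * c = 28) :
    J q (4 * m) = ∏ i ∈ range c, levelProd (q ^ 4) (m + m * i) := by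
  rw [← qPochInf_pow_eq_prod_levelProd (norm_pow_lt_one hq four_ne_zero) hmc, J, ← pow_mul]

lemma JJ_eq_levelProd (q : ℂ) (a : ℕ) :
    JJ q (4 * a) 112 = levelProd (q ^ 4) a * levelProd (q ^ 4) (28 - a) * levelProd (q ^ 4) 28 := by
  simp only [JJ, levelProd, ← pow_mul, Nat.mul_sub]

lemma qPochInf_neg_seven {x : ℂ} (hx : ‖x‖ < 1) (a : ℂ) :
    qPochInf a (-x ^ 7) = qPochInf a (x ^ 14) * qPochInf (-(a * x ^ 7)) (x ^ 14) := by
  rw [qPochInf_eq_prod a (m := 2) (by rw [norm_neg]; exact norm_pow_lt_one hx (by norm_num))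
    (by norm_num),
    prod_range_succ, prod_range_one]
  congr 2 <;> ring

lemma qPochInf_neg_pow_fourteen {x : ℂ} (hx : ‖x‖ < 1) {a : ℕ} (ha : a ≠ 0) :
    qPochInf (-x ^ a) (x ^ 14) = levelProd x (2 * a) / (levelProd x a * levelProd x (a + 14)) := by
  have h1 := qPochInf_mul_neg (x ^ a) (norm_pow_lt_one hx (n := 14) (by norm_num))
  have h2 := qPochInf_pow_eq_prod_levelProd hx (m := 14) (c := 2) (by norm_num) a
  rw [prod_range_succ, prod_range_one] at h2
  rw [eq_div_iff (mul_ne_zero (levelProd_ne_zero hx ha) (levelProd_ne_zero hx (by omega)))]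
  rw [← pow_mul, ← pow_mul, h2, mul_comm a 2] at h1
  simp only [mul_zero, add_zero, mul_one] at h1
  rw [mul_comm, h1, levelProd]

lemma qPochInf_neg_two {x : ℂ} (hx : ‖x‖ < 1) :
    qPochInf (-x) (x ^ 2) = (∏ i ∈ range 7, levelProd x (2 + 4 * i)) /
      ∏ i ∈ range 14, levelProd x (1 + 2 * i) := by
  have h1 := qPochInf_mul_neg x (norm_pow_lt_one hx (n := 2) (by norm_num))
  have h2 := qPochInf_pow_eq_prod_levelProd hx (m := 2) (c := 14) (by norm_num) 1
  have h3 := qPochInf_pow_eq_prod_levelProd hx (m := 4) (c := 7) (by norm_num) 2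
  rw [pow_one] at h2
  rw [← pow_mul, h2, h3] at h1
  rw [eq_div_iff (prod_ne_zero_iff.mpr fun i _ => levelProd_ne_zero hx (by omega)), ← h1, mul_comm]

lemma J_sixteen_div {q : ℂ} (hq : ‖q‖ < 1) (z : ℂ) :
    J q 16 * z / J q 8 ^ 2 = qPochInf (-(q ^ 8)) (q ^ 8) * ((qPochInf (q ^ 8) (q ^ 8))⁻¹ * z) := by
  have h8 := norm_pow_lt_one hq (n := 8) (by norm_num)
  have h1 := qPochInf_mul_neg (q ^ 8) h8
  rw [← pow_mul] at h1
  have h2 := qPochInf_ne_zero_of_norm_lt h8 h8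
  rw [J, J, ← h1]
  field_simp

/-- The products in the second term of the identities, in terms of pairs of level 28. -/
lemma J_sixteen_div_eq_pairQuot {q : ℂ} (hq : ‖q‖ < 1) :
    J q 16 * JJ q 48 112 / J q 8 ^ 2 = pairQuot [] [2, 2, 6, 6, 10, 10, 4, 8, 14] (q ^ 4) ∧
    J q 16 * JJ q 32 112 / J q 8 ^ 2 = pairQuot [] [2, 2, 6, 6, 10, 10, 4, 12, 14] (q ^ 4) ∧
    J q 16 * JJ q 16 112 / J q 8 ^ 2 = pairQuot [] [2, 2, 6, 6, 10, 10, 8, 12, 14] (q ^ 4) := by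
  have hA := fun k (hk : k ≠ 0) => levelProd_ne_zero (norm_pow_lt_one hq four_ne_zero) (k := k) hk
  have j16 := J_eq_prod_levelProd hq (m := 4) (c := 7) (by norm_num)
  have j8 := J_eq_prod_levelProd hq (m := 2) (c := 14) (by norm_num)
  have k48 := JJ_eq_levelProd q 12
  have k32 := JJ_eq_levelProd q 8
  have k16 := JJ_eq_levelProd q 4
  norm_num only [prod_range_succ, prod_range_zero, Nat.reduceMul, Nat.reduceAdd, one_mul]
    at j16 j8 k48 k32 k16
  simp only [pairQuot, pairProd, List.map_cons, List.map_nil, List.prod_cons, List.prod_nil, j16, j8,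
    k48, k32, k16, Nat.reduceSub]
  -- From here on both sides are monomials in the nonzero quantities `A 1, …, A 28`, and only
  -- exponents have to agree. The factor `A 28` cancels, and `A 14` occurs to even powers, which is
  -- why pairs `a, 28 - a` suffice.
  generalize levelProd (q ^ 4) = A at *
  have h2 := hA 2 (by norm_num)
  have h4 := hA 4 (by norm_num)
  have h6 := hA 6 (by norm_num)
  have h8 := hA 8 (by norm_num)
  have h10 := hA 10 (by norm_num)
  have h12 := hA 12 (by norm_num)
  have h14 := hA 14 (by norm_num)
  have h16 := hA 16 (by norm_num)
  have h18 := hA 18 (by norm_num)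
  have h20 := hA 20 (by norm_num)
  have h22 := hA 22 (by norm_num)
  have h24 := hA 24 (by norm_num)
  have h26 := hA 26 (by norm_num)
  have h28 := hA 28 (by norm_num)
  refine ⟨?_, ?_, ?_⟩ <;> field_simp

/-- The products in the first term of the identities, in terms of pairs of level 28. -/
lemma J_eight_mul_div_eq_pairQuot {q : ℂ} (hq : ‖q‖ < 1) :
    J q 8 * J q 56 ^ 2 * J q 112 * JJ q 8 112 * JJ q 24 112 /
        (J q 4 * JJ q 4 112 * JJ q 16 112 * JJ q 28 112 * JJ q 48 112 * JJ q 52 112) =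
      pairQuot [2, 6, 14] [1, 1, 4, 7, 7, 12, 13, 13, 3, 5, 9, 11] (q ^ 4) ∧
    J q 8 * J q 56 ^ 2 * J q 112 * JJ q 24 112 * JJ q 40 112 /
        (J q 4 * JJ q 12 112 * JJ q 28 112 * JJ q 32 112 * JJ q 44 112 * JJ q 48 112) =
      pairQuot [6, 10, 14] [3, 3, 7, 7, 8, 11, 11, 12, 1, 5, 9, 13] (q ^ 4) ∧
    J q 8 * J q 56 ^ 2 * J q 112 * JJ q 8 112 * JJ q 40 112 /
        (J q 4 * JJ q 16 112 * JJ q 20 112 * JJ q 28 112 * JJ q 32 112 * JJ q 36 112) =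
      pairQuot [2, 10, 14] [4, 5, 7, 8, 9, 1, 3, 5, 7, 9, 11, 13] (q ^ 4) := by
  have hA := fun k (hk : k ≠ 0) => levelProd_ne_zero (norm_pow_lt_one hq four_ne_zero) (k := k) hk
  have j4 := J_eq_prod_levelProd hq (m := 1) (c := 28) (by norm_num)
  have j8 := J_eq_prod_levelProd hq (m := 2) (c := 14) (by norm_num)
  have j56 := J_eq_prod_levelProd hq (m := 14) (c := 2) (by norm_num)
  have j112 := J_eq_prod_levelProd hq (m := 28) (c := 1) (by norm_num)
  have k4 := JJ_eq_levelProd q 1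
  have k8 := JJ_eq_levelProd q 2
  have k12 := JJ_eq_levelProd q 3
  have k16 := JJ_eq_levelProd q 4
  have k20 := JJ_eq_levelProd q 5
  have k24 := JJ_eq_levelProd q 6
  have k28 := JJ_eq_levelProd q 7
  have k32 := JJ_eq_levelProd q 8
  have k36 := JJ_eq_levelProd q 9
  have k40 := JJ_eq_levelProd q 10
  have k44 := JJ_eq_levelProd q 11
  have k48 := JJ_eq_levelProd q 12
  have k52 := JJ_eq_levelProd q 13
  norm_num only [prod_range_succ, prod_range_zero, Nat.reduceMul, Nat.reduceAdd, one_mul]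
    at j4 j8 j56 j112 k4 k8 k12 k16 k20 k24 k28 k32 k36 k40 k44 k48 k52
  simp only [pairQuot, pairProd, List.map_cons, List.map_nil, List.prod_cons, List.prod_nil, j4, j8,
    j56, j112, k4, k8, k12, k16, k20, k24, k28, k32, k36, k40, k44, k48, k52, Nat.reduceSub]
  generalize levelProd (q ^ 4) = A at *
  have h1 := hA 1 (by norm_num)
  have h2 := hA 2 (by norm_num)
  have h3 := hA 3 (by norm_num)
  have h4 := hA 4 (by norm_num)
  have h5 := hA 5 (by norm_num)
  have h6 := hA 6 (by norm_num)
  have h7 := hA 7 (by norm_num)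
  have h8 := hA 8 (by norm_num)
  have h9 := hA 9 (by norm_num)
  have h10 := hA 10 (by norm_num)
  have h11 := hA 11 (by norm_num)
  have h12 := hA 12 (by norm_num)
  have h13 := hA 13 (by norm_num)
  have h14 := hA 14 (by norm_num)
  have h15 := hA 15 (by norm_num)
  have h16 := hA 16 (by norm_num)
  have h17 := hA 17 (by norm_num)
  have h18 := hA 18 (by norm_num)
  have h19 := hA 19 (by norm_num)
  have h20 := hA 20 (by norm_num)
  have h21 := hA 21 (by norm_num)
  have h22 := hA 22 (by norm_num)
  have h23 := hA 23 (by norm_num)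
  have h24 := hA 24 (by norm_num)
  have h25 := hA 25 (by norm_num)
  have h26 := hA 26 (by norm_num)
  have h27 := hA 27 (by norm_num)
  have h28 := hA 28 (by norm_num)
  refine ⟨?_, ?_, ?_⟩ <;> field_simp

/-- The products occurring on the right of the Rogers–Selberg identities. -/
lemma rogers_selberg_prod_eq_pairQuot {x : ℂ} (hx : ‖x‖ < 1) :
    qPochInf (-x) (x ^ 2) * ((qPochInf (x ^ 2) (x ^ 2))⁻¹ *
        (qPochInf (-x ^ 7) (-x ^ 7) * qPochInf (x ^ 6) (-x ^ 7) * qPochInf (-x) (-x ^ 7))) =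
      pairQuot [2, 6, 14] [1, 1, 4, 7, 7, 12, 13, 13, 3, 5, 9, 11] x ∧
    qPochInf (-x) (x ^ 2) * ((qPochInf (x ^ 2) (x ^ 2))⁻¹ *
        (qPochInf (-x ^ 7) (-x ^ 7) * qPochInf (x ^ 4) (-x ^ 7) * qPochInf (-x ^ 3) (-x ^ 7))) =
      pairQuot [6, 10, 14] [3, 3, 7, 7, 8, 11, 11, 12, 1, 5, 9, 13] x ∧
    qPochInf (-x) (x ^ 2) * ((qPochInf (x ^ 2) (x ^ 2))⁻¹ *
        (qPochInf (-x ^ 7) (-x ^ 7) * qPochInf (-x ^ 5) (-x ^ 7) * qPochInf (x ^ 2) (-x ^ 7))) =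
      pairQuot [2, 10, 14] [4, 5, 7, 8, 9, 1, 3, 5, 7, 9, 11, 13] x := by
  have hA := fun k (hk : k ≠ 0) => levelProd_ne_zero hx (k := k) hk
  have e0 := qPochInf_neg_two hx
  have e2 := qPochInf_pow_eq_prod_levelProd hx (m := 2) (c := 14) (by norm_num) 2
  have f14 := fun a => qPochInf_pow_eq_prod_levelProd hx (m := 14) (c := 2) (by norm_num) a
  have s1 : qPochInf (-x) (-x ^ 7) = qPochInf (-x ^ 1) (x ^ 14) * qPochInf (x ^ 8) (x ^ 14) := by
    rw [qPochInf_neg_seven hx]; congr 2 <;> ring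
  have s2 : qPochInf (x ^ 2) (-x ^ 7) = qPochInf (x ^ 2) (x ^ 14) * qPochInf (-x ^ 9) (x ^ 14) := by
    rw [qPochInf_neg_seven hx]; congr 2; ring
  have s3 : qPochInf (-x ^ 3) (-x ^ 7) = qPochInf (-x ^ 3) (x ^ 14) * qPochInf (x ^ 10) (x ^ 14) := by
    rw [qPochInf_neg_seven hx]; congr 2; ring
  have s4 : qPochInf (x ^ 4) (-x ^ 7) = qPochInf (x ^ 4) (x ^ 14) * qPochInf (-x ^ 11) (x ^ 14) := by
    rw [qPochInf_neg_seven hx]; congr 2; ring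
  have s5 : qPochInf (-x ^ 5) (-x ^ 7) = qPochInf (-x ^ 5) (x ^ 14) * qPochInf (x ^ 12) (x ^ 14) := by
    rw [qPochInf_neg_seven hx]; congr 2; ring
  have s6 : qPochInf (x ^ 6) (-x ^ 7) = qPochInf (x ^ 6) (x ^ 14) * qPochInf (-x ^ 13) (x ^ 14) := by
    rw [qPochInf_neg_seven hx]; congr 2; ring
  have s7 : qPochInf (-x ^ 7) (-x ^ 7) = qPochInf (-x ^ 7) (x ^ 14) * qPochInf (x ^ 14) (x ^ 14) := by
    rw [qPochInf_neg_seven hx]; congr 2; ring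
  have g1 := qPochInf_neg_pow_fourteen hx (a := 1) (by norm_num)
  have g3 := qPochInf_neg_pow_fourteen hx (a := 3) (by norm_num)
  have g5 := qPochInf_neg_pow_fourteen hx (a := 5) (by norm_num)
  have g7 := qPochInf_neg_pow_fourteen hx (a := 7) (by norm_num)
  have g9 := qPochInf_neg_pow_fourteen hx (a := 9) (by norm_num)
  have g11 := qPochInf_neg_pow_fourteen hx (a := 11) (by norm_num)
  have g13 := qPochInf_neg_pow_fourteen hx (a := 13) (by norm_num)
  norm_num only [prod_range_succ, prod_range_zero, Nat.reduceMul, Nat.reduceAdd, one_mul]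
    at e0 e2 f14 g1 g3 g5 g7 g9 g11 g13
  rw [s1, s2, s3, s4, s5, s6, s7, g1, g3, g5, g7, g9, g11, g13, e0, e2]
  simp only [f14, pairQuot, pairProd, List.map_cons, List.map_nil, List.prod_cons, List.prod_nil,
    Nat.reduceSub, Nat.reduceAdd]
  generalize levelProd x = A at *
  have h1 := hA 1 (by norm_num)
  have h2 := hA 2 (by norm_num)
  have h3 := hA 3 (by norm_num)
  have h4 := hA 4 (by norm_num)
  have h5 := hA 5 (by norm_num)
  have h6 := hA 6 (by norm_num)
  have h7 := hA 7 (by norm_num)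
  have h8 := hA 8 (by norm_num)
  have h9 := hA 9 (by norm_num)
  have h10 := hA 10 (by norm_num)
  have h11 := hA 11 (by norm_num)
  have h12 := hA 12 (by norm_num)
  have h13 := hA 13 (by norm_num)
  have h14 := hA 14 (by norm_num)
  have h15 := hA 15 (by norm_num)
  have h16 := hA 16 (by norm_num)
  have h17 := hA 17 (by norm_num)
  have h18 := hA 18 (by norm_num)
  have h19 := hA 19 (by norm_num)
  have h20 := hA 20 (by norm_num)
  have h21 := hA 21 (by norm_num)
  have h22 := hA 22 (by norm_num)
  have h23 := hA 23 (by norm_num)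
  have h24 := hA 24 (by norm_num)
  have h25 := hA 25 (by norm_num)
  have h26 := hA 26 (by norm_num)
  have h27 := hA 27 (by norm_num)
  have h28 := hA 28 (by norm_num)
  refine ⟨?_, ?_, ?_⟩ <;> field_simp

/-! ### The three identities -/

lemma JJ_of_sub_eq {q : ℂ} {a b m : ℕ} (h : m - a = b) :
    JJ q a m = qPochInf (q ^ m) (q ^ m) * qPochInf (q ^ b) (q ^ m) * qPochInf (q ^ a) (q ^ m) := by
  rw [JJ, h]; ring

@[simp] lemma qPochInf_zero_zero : qPochInf 0 0 = 1 := by simp [qPochInf]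

lemma J_zero {m : ℕ} (hm : m ≠ 0) : J 0 m = 1 := by simp [J, hm]

lemma JJ_zero {a m : ℕ} (ha : a ≠ 0) (ham : a < m) : JJ 0 a m = 1 := by
  rw [JJ, zero_pow ha, zero_pow (show m ≠ 0 by omega), zero_pow (show m - a ≠ 0 by omega)]
  simp

@[simp] lemma qPoch_zero_zero (n : ℕ) : qPoch 0 0 n = 1 := by simp [qPoch]

theorem hasSum_identity_one {q : ℂ} (hq : ‖q‖ < 1) :
    HasSum (fun p : ℕ × ℕ =>
      q ^ (4 * (p.1 : ℤ) ^ 2 + 3 * (p.2 : ℤ) ^ 2 - 4 * (p.1 : ℤ) * (p.2 : ℤ) - 4 * (p.1 : ℤ)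
        + 2 * (p.2 : ℤ)) / (qPoch (q ^ 8) (q ^ 8) p.1 * qPoch (q ^ 8) (q ^ 8) p.2))
      (2 * (J q 16 * JJ q 48 112 / J q 8 ^ 2)
        + q * (J q 8 * J q 56 ^ 2 * J q 112 * JJ q 8 112 * JJ q 24 112 /
          (J q 4 * JJ q 4 112 * JJ q 16 112 * JJ q 28 112 * JJ q 48 112 * JJ q 52 112))) := by
  rcases eq_or_ne q 0 with rfl | hq0
  -- At `q = 0` only terms of exponent zero survive, `0 ^ m` being `0` for all other integers `m`.
  -- In this identity they are `(0, 0)` and `(1, 0)`, giving the value `2`.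
  · have h := hasSum_sum_of_ne_finset_zero (L := .unconditional _) (s := {((0 : ℕ), (0 : ℕ)), (1, 0)})
      (f := fun p : ℕ × ℕ => (0 : ℂ) ^ (4 * (p.1 : ℤ) ^ 2 + 3 * (p.2 : ℤ) ^ 2
        - 4 * (p.1 : ℤ) * (p.2 : ℤ) - 4 * (p.1 : ℤ) + 2 * (p.2 : ℤ)) /
        (qPoch (0 ^ 8) (0 ^ 8) p.1 * qPoch (0 ^ 8) (0 ^ 8) p.2)) (fun p hp => ?_)
    · rw [sum_pair (by simp)] at h
      convert h using 1
      norm_num [J_zero, JJ_zero]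
    · rw [zero_zpow _ ?_, zero_div]
      obtain ⟨i, j⟩ := p
      simp only [mem_insert, mem_singleton, Prod.mk.injEq, not_or, not_and] at hp ⊢
      intro h
      rcases Nat.eq_zero_or_pos j with rfl | hj
      · rcases i with _ | _ | i
        · simp at hp
        · simp at hp
        · push_cast at h; nlinarith
      · have : (1 : ℤ) ≤ j := by exact_mod_cast hj
        -- The exponent equals `(2 i - j - 1)² + 2 j² - 1`, which is positive for `j ≥ 1`.
        nlinarith [sq_nonneg (2 * (i : ℤ) - j - 1)]
  · have h := hasSum_double_one hq hq0
    have hx := norm_pow_lt_one hq four_ne_zero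
    have hQ := norm_pow_lt_one hq (n := 8) (by norm_num)
    have hx2 : (q ^ 4) ^ 2 = q ^ 8 := by rw [← pow_mul]
    rw [rogers_fourteen_one hQ (pow_ne_zero _ hq0), rogers_selberg_three hx (pow_ne_zero _ hq0),
      mul_assoc 2, mul_assoc q, hx2] at h
    have h1 := (rogers_selberg_prod_eq_pairQuot hx).1
    rw [hx2] at h1
    rw [h1] at h
    rw [J_sixteen_div hq, (J_eight_mul_div_eq_pairQuot hq).1,
      JJ_of_sub_eq (show 112 - 48 = 64 by norm_num)]
    simpa only [← pow_mul, Nat.reduceMul] using h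

theorem hasSum_identity_two {q : ℂ} (hq : ‖q‖ < 1) :
    HasSum (fun p : ℕ × ℕ =>
      q ^ (4 * (p.1 : ℤ) ^ 2 + 3 * (p.2 : ℤ) ^ 2 - 4 * (p.1 : ℤ) * (p.2 : ℤ)) /
        (qPoch (q ^ 8) (q ^ 8) p.1 * qPoch (q ^ 8) (q ^ 8) p.2))
      (J q 8 * J q 56 ^ 2 * J q 112 * JJ q 24 112 * JJ q 40 112 /
          (J q 4 * JJ q 12 112 * JJ q 28 112 * JJ q 32 112 * JJ q 44 112 * JJ q 48 112)
        + 2 * q ^ 3 * (J q 16 * JJ q 32 112 / J q 8 ^ 2)) := by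
  rcases eq_or_ne q 0 with rfl | hq0
  · have h := hasSum_single ((0 : ℕ), (0 : ℕ))
      (f := fun p : ℕ × ℕ => (0 : ℂ) ^ (4 * (p.1 : ℤ) ^ 2 + 3 * (p.2 : ℤ) ^ 2
        - 4 * (p.1 : ℤ) * (p.2 : ℤ)) /
        (qPoch (0 ^ 8) (0 ^ 8) p.1 * qPoch (0 ^ 8) (0 ^ 8) p.2)) (fun p hp => ?_)
    · convert h using 1
      norm_num [J_zero, JJ_zero]
    · rw [zero_zpow _ ?_, zero_div]
      obtain ⟨i, j⟩ := p
      intro h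
      refine hp ?_
      have hj : (j : ℤ) = 0 := by nlinarith [sq_nonneg (2 * (i : ℤ) - j)]
      have hi : (i : ℤ) = 0 := by nlinarith
      simp only [Prod.mk.injEq]
      omega
  · have h := hasSum_double_two hq hq0
    have hx := norm_pow_lt_one hq four_ne_zero
    have hQ := norm_pow_lt_one hq (n := 8) (by norm_num)
    have hx2 : (q ^ 4) ^ 2 = q ^ 8 := by rw [← pow_mul]
    rw [rogers_fourteen_two hQ (pow_ne_zero _ hq0), rogers_selberg_one hx (pow_ne_zero _ hq0),
      mul_assoc (2 * q ^ 3), hx2] at h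
    have h1 := (rogers_selberg_prod_eq_pairQuot hx).2.1
    rw [hx2] at h1
    rw [h1] at h
    rw [J_sixteen_div hq, (J_eight_mul_div_eq_pairQuot hq).2.1,
      JJ_of_sub_eq (show 112 - 32 = 80 by norm_num)]
    simpa only [← pow_mul, Nat.reduceMul] using h

theorem hasSum_identity_three {q : ℂ} (hq : ‖q‖ < 1) :
    HasSum (fun p : ℕ × ℕ =>
      q ^ (4 * (p.1 : ℤ) ^ 2 + 3 * (p.2 : ℤ) ^ 2 - 4 * (p.1 : ℤ) * (p.2 : ℤ) + 4 * (p.2 : ℤ)) /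
        (qPoch (q ^ 8) (q ^ 8) p.1 * qPoch (q ^ 8) (q ^ 8) p.2))
      (J q 8 * J q 56 ^ 2 * J q 112 * JJ q 8 112 * JJ q 40 112 /
          (J q 4 * JJ q 16 112 * JJ q 20 112 * JJ q 28 112 * JJ q 32 112 * JJ q 36 112)
        + 2 * q ^ 7 * (J q 16 * JJ q 16 112 / J q 8 ^ 2)) := by
  rcases eq_or_ne q 0 with rfl | hq0
  · have h := hasSum_single ((0 : ℕ), (0 : ℕ))
      (f := fun p : ℕ × ℕ => (0 : ℂ) ^ (4 * (p.1 : ℤ) ^ 2 + 3 * (p.2 : ℤ) ^ 2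
        - 4 * (p.1 : ℤ) * (p.2 : ℤ) + 4 * (p.2 : ℤ)) /
        (qPoch (0 ^ 8) (0 ^ 8) p.1 * qPoch (0 ^ 8) (0 ^ 8) p.2)) (fun p hp => ?_)
    · convert h using 1
      norm_num [J_zero, JJ_zero]
    · rw [zero_zpow _ ?_, zero_div]
      obtain ⟨i, j⟩ := p
      intro h
      refine hp ?_
      have hj : (j : ℤ) = 0 := by nlinarith [sq_nonneg (2 * (i : ℤ) - j)]
      have hi : (i : ℤ) = 0 := by nlinarith
      simp only [Prod.mk.injEq]
      omega
  · have h := hasSum_double_three hq hq0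
    have hx := norm_pow_lt_one hq four_ne_zero
    have hQ := norm_pow_lt_one hq (n := 8) (by norm_num)
    have hx2 : (q ^ 4) ^ 2 = q ^ 8 := by rw [← pow_mul]
    rw [rogers_fourteen_three hQ (pow_ne_zero _ hq0), rogers_selberg_two hx (pow_ne_zero _ hq0),
      mul_assoc (2 * q ^ 7), hx2] at h
    have h1 := (rogers_selberg_prod_eq_pairQuot hx).2.2
    rw [hx2] at h1
    rw [h1] at h
    rw [J_sixteen_div hq, (J_eight_mul_div_eq_pairQuot hq).2.2,
      JJ_of_sub_eq (show 112 - 16 = 96 by norm_num)]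
    simpa only [← pow_mul, Nat.reduceMul] using h

end Nahm

/-! ### Modularity of the Nahm sums -/

namespace Nahm

open Filter Topology Finset Complex
open scoped Real

/-! ### Theta functions with characteristics -/

/-- The theta function with characteristic `(u, v)`, a multiple of the Siegel function. -/
noncomputable def thetaChar (u v τ : ℂ) : ℂ :=
  cexp (π * Complex.I * (u * (u * τ + v) + τ / 4 - (u * τ + v))) *
    jacobiTheta₂ (u * τ + v - τ / 2 + 1 / 2) τ

/-- Because `n² ≡ n` modulo `2`, the sign `(-1) ^ (n²)` produced by `τ ↦ τ + 1` equals `(-1) ^ n`,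
which is a shift of `z` by `1 / 2`. -/
lemma jacobiTheta₂_add_one_right (z τ : ℂ) :
    jacobiTheta₂ z (τ + 1) = jacobiTheta₂ (z + 1 / 2) τ := by
  unfold jacobiTheta₂
  refine tsum_congr fun n => ?_
  unfold jacobiTheta₂_term
  obtain ⟨k, hk⟩ : ∃ k : ℤ, n ^ 2 = n + 2 * k := by
    obtain ⟨k, hk⟩ := (Int.even_mul_pred_self n).two_dvd
    exact ⟨k, by linear_combination hk⟩
  rw [exp_eq_exp_iff_exists_int]
  refine ⟨k, ?_⟩
  have : (n : ℂ) ^ 2 = n + 2 * k := by exact_mod_cast hk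
  linear_combination π * Complex.I * this

lemma thetaChar_add_one_right (u v τ : ℂ) :
    thetaChar u v (τ + 1) = cexp (π * Complex.I / 4) * thetaChar u (u + v) τ := by
  unfold thetaChar
  rw [jacobiTheta₂_add_one_right, ← mul_assoc, ← Complex.exp_add]
  congr 2
  · ring
  · ring

lemma thetaChar_neg_one_div (u v : ℂ) {τ : ℂ} (hτ : τ ≠ 0) :
    thetaChar u v (-1 / τ) = cexp (-π * Complex.I / 2) * (-Complex.I * τ) ^ (1 / 2 : ℂ) * thetaChar v (-u) τ := by
  unfold thetaChar
  have h0 : (-Complex.I * τ) ^ (1 / 2 : ℂ) ≠ 0 := by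
    rw [Ne, cpow_eq_zero_iff]; simp [hτ]
  -- This point divided by `τ` is the argument occurring on the left. It exceeds the argument of
  -- `thetaChar v (-u) τ` by `τ`, which quasi-periodicity then removes.
  have h1 := jacobiTheta₂_functional_equation (v * τ - u + 1 / 2 + τ / 2) τ
  have e1 : (v * τ - u + 1 / 2 + τ / 2) / τ = u * (-1 / τ) + v - -1 / τ / 2 + 1 / 2 := by
    field_simp; ring
  rw [e1] at h1
  have h2 := jacobiTheta₂_add_left' (v * τ + -u - τ / 2 + 1 / 2) τ
  rw [show v * τ + -u - τ / 2 + 1 / 2 + τ = v * τ - u + 1 / 2 + τ / 2 by ring, h1] at h2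
  have h3 : jacobiTheta₂ (u * (-1 / τ) + v - -1 / τ / 2 + 1 / 2) (-1 / τ) =
      (-Complex.I * τ) ^ (1 / 2 : ℂ) * (cexp (π * Complex.I * (v * τ - u + 1 / 2 + τ / 2) ^ 2 / τ) *
      cexp (-π * Complex.I * (τ + 2 * (v * τ + -u - τ / 2 + 1 / 2)))) *
        jacobiTheta₂ (v * τ + -u - τ / 2 + 1 / 2) τ := by
    have h4 : cexp (π * Complex.I * (v * τ - u + 1 / 2 + τ / 2) ^ 2 / τ) *
        cexp (-π * Complex.I * (v * τ - u + 1 / 2 + τ / 2) ^ 2 / τ) = 1 := by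
      rw [← Complex.exp_add, ← Complex.exp_zero]; congr 1; ring
    calc _ = (cexp (π * Complex.I * (v * τ - u + 1 / 2 + τ / 2) ^ 2 / τ) *
        cexp (-π * Complex.I * (v * τ - u + 1 / 2 + τ / 2) ^ 2 / τ)) *
        jacobiTheta₂ (u * (-1 / τ) + v - -1 / τ / 2 + 1 / 2) (-1 / τ) := by rw [h4, one_mul]
      _ = _ := by
        rw [one_div, mul_assoc, inv_mul_eq_iff_eq_mul₀ h0] at h2
        linear_combination cexp (π * Complex.I * (v * τ - u + 1 / 2 + τ / 2) ^ 2 / τ) * h2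
  rw [h3]
  have h5 : cexp (π * Complex.I * (u * (u * (-1 / τ) + v) + -1 / τ / 4 - (u * (-1 / τ) + v))) *
      (cexp (π * Complex.I * (v * τ - u + 1 / 2 + τ / 2) ^ 2 / τ) *
      cexp (-π * Complex.I * (τ + 2 * (v * τ + -u - τ / 2 + 1 / 2)))) =
      cexp (-π * Complex.I / 2) * cexp (π * Complex.I * (v * (v * τ + -u) + τ / 4 - (v * τ + -u))) := by
    rw [← Complex.exp_add, ← Complex.exp_add, ← Complex.exp_add]
    congr 1
    field_simp
    ring
  linear_combination (-Complex.I * τ) ^ (1 / 2 : ℂ) * jacobiTheta₂ (v * τ + -u - τ / 2 + 1 / 2) τ * h5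

/-- The theta functions with characteristics are permuted by `SL(2, ℤ)`, up to a factor which does
not depend on the characteristic. -/
theorem exists_thetaChar_smul (γ : SL(2, ℤ)) : ∃ μ : ℍ → ℂ, (∀ τ, μ τ ≠ 0) ∧
    ∀ (u v : ℂ) (τ : ℍ), thetaChar u v ((γ • τ : ℍ) : ℂ) =
      μ τ * thetaChar (u * (γ 0 0 : ℤ) + v * (γ 1 0 : ℤ)) (u * (γ 0 1 : ℤ) + v * (γ 1 1 : ℤ)) τ := by
  -- It suffices to treat `S` and `T`: the relation is stable under products and inverses because
  -- the characteristics transform by right multiplication by `γ`.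
  have hγ : γ ∈ Subgroup.closure {ModularGroup.S, ModularGroup.T} := by
    simp [SpecialLinearGroup.SL2Z_generators]
  induction hγ using Subgroup.closure_induction with
  | mem γ hγ =>
    rcases hγ with rfl | rfl
    · refine ⟨fun τ => cexp (-π * Complex.I / 2) * (-Complex.I * τ) ^ (1 / 2 : ℂ), fun τ => ?_, fun u v τ => ?_⟩
      · refine mul_ne_zero (exp_ne_zero _) ?_
        rw [Ne, cpow_eq_zero_iff]; simp [τ.ne_zero]
      · have := thetaChar_neg_one_div u v τ.ne_zero
        rw [modular_S_smul]
        simp only [ModularGroup.S]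
        convert this using 2
        · simp [neg_div, inv_neg]
        · simp
    · refine ⟨fun τ => cexp (π * Complex.I / 4), fun τ => exp_ne_zero _, fun u v τ => ?_⟩
      have := thetaChar_add_one_right u v τ
      rw [modular_T_smul]
      simp only [ModularGroup.T]
      convert this using 2
      · simp [add_comm]
      · simp
  | one => exact ⟨fun _ => 1, fun _ => one_ne_zero, fun u v τ => by simp⟩
  | mul γ₁ γ₂ _ _ h₁ h₂ =>
    obtain ⟨μ₁, hμ₁, h₁⟩ := h₁
    obtain ⟨μ₂, hμ₂, h₂⟩ := h₂
    refine ⟨fun τ => μ₁ (γ₂ • τ) * μ₂ τ, fun τ => mul_ne_zero (hμ₁ _) (hμ₂ _), fun u v τ => ?_⟩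
    rw [mul_smul, h₁, h₂, ← mul_assoc]
    simp only [Matrix.SpecialLinearGroup.coe_mul, Matrix.mul_apply, Fin.sum_univ_two, Int.cast_add,
      Int.cast_mul]
    congr 2 <;> ring
  | inv γ _ h =>
    obtain ⟨μ, hμ, h⟩ := h
    refine ⟨fun τ => (μ (γ⁻¹ • τ))⁻¹, fun τ => inv_ne_zero (hμ _), fun u v τ => ?_⟩
    have hdet : ((γ 0 0 : ℤ) : ℂ) * (γ 1 1 : ℤ) - (γ 0 1 : ℤ) * (γ 1 0 : ℤ) = 1 := by
      have := γ.det_coe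
      rw [Matrix.det_fin_two] at this
      exact_mod_cast this
    have := h (u * (γ⁻¹ 0 0 : ℤ) + v * (γ⁻¹ 1 0 : ℤ)) (u * (γ⁻¹ 0 1 : ℤ) + v * (γ⁻¹ 1 1 : ℤ)) (γ⁻¹ • τ)
    rw [smul_inv_smul] at this
    rw [this, inv_mul_cancel_left₀ (hμ _)]
    rw [Matrix.SpecialLinearGroup.SL2_inv_expl]
    simp only [Matrix.cons_val', Matrix.cons_val_zero, Matrix.cons_val_one, Matrix.cons_val_fin_one,
      Int.cast_neg]
    congr 1
    · linear_combination -u * hdet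
    · linear_combination -v * hdet

lemma thetaChar_add_one_snd (u v τ : ℂ) :
    thetaChar u (v + 1) τ = cexp (π * Complex.I * (u - 1)) * thetaChar u v τ := by
  unfold thetaChar
  rw [show u * τ + (v + 1) - τ / 2 + 1 / 2 = u * τ + v - τ / 2 + 1 / 2 + 1 by ring,
    jacobiTheta₂_add_left, ← mul_assoc, ← Complex.exp_add]
  congr 2; ring

lemma thetaChar_add_one_fst (u v τ : ℂ) :
    thetaChar (u + 1) v τ = cexp (-(π * Complex.I * (v + 1))) * thetaChar u v τ := by
  unfold thetaChar
  rw [show (u + 1) * τ + v - τ / 2 + 1 / 2 = u * τ + v - τ / 2 + 1 / 2 + τ by ring,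
    jacobiTheta₂_add_left', ← mul_assoc, ← mul_assoc, ← Complex.exp_add, ← Complex.exp_add]
  congr 2; ring

lemma thetaChar_add_int_snd (u v τ : ℂ) (n : ℤ) :
    thetaChar u (v + n) τ = cexp (π * Complex.I * (n * (u - 1))) * thetaChar u v τ := by
  induction n using Int.induction_on with
  | zero => simp
  | succ n ih =>
    rw [show v + ((n + 1 : ℤ) : ℂ) = v + (n : ℤ) + 1 by push_cast; ring, thetaChar_add_one_snd, ih,
      ← mul_assoc, ← Complex.exp_add]
    congr 2; push_cast; ring
  | pred n ih =>
    have h := thetaChar_add_one_snd u (v + ((-n - 1 : ℤ) : ℂ)) τ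
    rw [show v + ((-n - 1 : ℤ) : ℂ) + 1 = v + ((-n : ℤ) : ℂ) by push_cast; ring, ih] at h
    have h2 : cexp (π * Complex.I * (((-n - 1 : ℤ) : ℂ) * (u - 1))) * cexp (π * Complex.I * (u - 1)) =
        cexp (π * Complex.I * (((-n : ℤ) : ℂ) * (u - 1))) := by
      rw [← Complex.exp_add]; congr 1; push_cast; ring
    refine mul_left_cancel₀ (exp_ne_zero (π * Complex.I * (u - 1))) ?_
    linear_combination -h - thetaChar u v τ * h2

lemma thetaChar_add_int_fst (u v τ : ℂ) (n : ℤ) :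
    thetaChar (u + n) v τ = cexp (-(π * Complex.I * (n * (v + 1)))) * thetaChar u v τ := by
  induction n using Int.induction_on with
  | zero => simp
  | succ n ih =>
    rw [show u + ((n + 1 : ℤ) : ℂ) = u + (n : ℤ) + 1 by push_cast; ring, thetaChar_add_one_fst, ih,
      ← mul_assoc, ← Complex.exp_add]
    congr 2; push_cast; ring
  | pred n ih =>
    have h := thetaChar_add_one_fst (u + ((-n - 1 : ℤ) : ℂ)) v τ
    rw [show u + ((-n - 1 : ℤ) : ℂ) + 1 = u + ((-n : ℤ) : ℂ) by push_cast; ring, ih] at h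
    have h2 : cexp (-(π * Complex.I * (((-n - 1 : ℤ) : ℂ) * (v + 1)))) * cexp (-(π * Complex.I * (v + 1))) =
        cexp (-(π * Complex.I * (((-n : ℤ) : ℂ) * (v + 1)))) := by
      rw [← Complex.exp_add]; congr 1; push_cast; ring
    refine mul_left_cancel₀ (exp_ne_zero (-(π * Complex.I * (v + 1)))) ?_
    linear_combination -h - thetaChar u v τ * h2

lemma norm_cexp_two_pi_mul_lt_one {τ : ℂ} (hτ : 0 < τ.im) : ‖cexp (2 * π * Complex.I * τ)‖ < 1 := by
  rw [Complex.norm_exp]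
  simp only [mul_re, re_ofNat, ofReal_re, im_ofNat, ofReal_im, mul_zero, sub_zero, Complex.I_re, mul_im,
    zero_mul, add_zero, Complex.I_im, mul_one, zero_sub]
  rw [Real.exp_lt_one_iff]
  have := Real.pi_pos
  nlinarith [mul_pos this hτ]

/-- The product expansion of the theta functions. -/
theorem thetaChar_eq_prod (u v : ℂ) {τ : ℂ} (hτ : 0 < τ.im) :
    thetaChar u v τ = cexp (π * Complex.I * (u * (u * τ + v) + τ / 4 - (u * τ + v))) *
      (qPochInf (cexp (2 * π * Complex.I * τ)) (cexp (2 * π * Complex.I * τ)) *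
        qPochInf (cexp (2 * π * Complex.I * (u * τ + v))) (cexp (2 * π * Complex.I * τ)) *
        qPochInf (cexp (2 * π * Complex.I * (τ - (u * τ + v)))) (cexp (2 * π * Complex.I * τ))) := by
  have e2 : cexp (π * Complex.I * τ) ^ 2 = cexp (2 * π * Complex.I * τ) := by
    rw [← Complex.exp_nat_mul]; congr 1; push_cast; ring
  have hp : ‖cexp (π * Complex.I * τ)‖ < 1 := by
    have h := norm_cexp_two_pi_mul_lt_one hτ
    rw [← e2, norm_pow] at h
    nlinarith [norm_nonneg (cexp (π * Complex.I * τ))]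
  unfold thetaChar
  congr 1
  have h := jacobi_triple_product hp (exp_ne_zero _)
    (exp_ne_zero (2 * π * Complex.I * (u * τ + v - τ / 2 + 1 / 2)))
  rw [e2] at h
  have e3 : -(cexp (2 * π * Complex.I * (u * τ + v - τ / 2 + 1 / 2)) * cexp (π * Complex.I * τ)) =
      cexp (2 * π * Complex.I * (u * τ + v)) := by
    rw [← Complex.exp_add, show 2 * π * Complex.I * (u * τ + v - τ / 2 + 1 / 2) + π * Complex.I * τ =
      2 * π * Complex.I * (u * τ + v) + π * Complex.I by ring, Complex.exp_add, exp_pi_mul_I]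
    ring
  have e4 : -((cexp (2 * π * Complex.I * (u * τ + v - τ / 2 + 1 / 2)))⁻¹ * cexp (π * Complex.I * τ)) =
      cexp (2 * π * Complex.I * (τ - (u * τ + v))) := by
    rw [← Complex.exp_neg, ← Complex.exp_add,
      show -(2 * π * Complex.I * (u * τ + v - τ / 2 + 1 / 2)) + π * Complex.I * τ =
      2 * π * Complex.I * (τ - (u * τ + v)) - π * Complex.I by ring, Complex.exp_sub, exp_pi_mul_I]
    ring
  rw [e3, e4] at h
  rw [← h, jacobiTheta₂]
  refine tsum_congr fun n => ?_
  rw [jacobiTheta₂_term, ← Complex.exp_int_mul, ← Complex.exp_int_mul, ← Complex.exp_add]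
  congr 1
  push_cast; ring

lemma differentiableAt_thetaChar (u v : ℂ) {τ : ℂ} (hτ : 0 < τ.im) :
    DifferentiableAt ℂ (thetaChar u v) τ := by
  unfold thetaChar
  refine .mul (by fun_prop) ?_
  have h := (hasFDerivAt_jacobiTheta₂ (u * τ + v - τ / 2 + 1 / 2) hτ).differentiableAt
  exact h.comp τ (f := fun τ : ℂ => (u * τ + v - τ / 2 + 1 / 2, τ)) (by fun_prop)

/-! ### Weight zero quotients of theta functions -/

/-- The theta function with characteristic `(n / 28, 0)`. -/
noncomputable def thetaLevel (τ : ℂ) (n : ℕ) : ℂ := thetaChar (n / 28) 0 τ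

/-- The product of the even theta constants. -/
noncomputable def thetaEven (τ : ℂ) : ℂ :=
  thetaChar (1 / 2) 0 τ * thetaChar 0 (1 / 2) τ * thetaChar (1 / 2) (1 / 2) τ

/-- Quotients of theta functions, of weight zero if `l₂.length = l₁.length + 9`. -/
noncomputable def thetaQuot (l₁ l₂ : List ℕ) (τ : ℂ) : ℂ :=
  (l₁.map (thetaLevel τ)).prod * thetaEven τ ^ 3 / (l₂.map (thetaLevel τ)).prod

/-- The order at infinity of a product of theta functions (in units of `q ^ (1/2)`). -/
noncomputable def thetaOrder (l : List ℕ) : ℂ := (l.map fun n : ℕ => ((n : ℂ) / 28 - 1 / 2) ^ 2).sum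

lemma thetaLevel_eq {τ : ℂ} (hτ : 0 < τ.im) {n : ℕ} (hn : n ≤ 28) :
    thetaLevel τ n = cexp (π * Complex.I * (((n : ℂ) / 28 - 1 / 2) ^ 2 * τ)) *
      (levelProd (cexp (2 * π * Complex.I * (τ / 28))) 28 *
        pairProd (cexp (2 * π * Complex.I * (τ / 28))) n) := by
  have e : ∀ k : ℕ, cexp (2 * π * Complex.I * (τ / 28)) ^ k =
      cexp (2 * π * Complex.I * (k / 28 * τ)) := fun k => by
    rw [← Complex.exp_nat_mul]; congr 1; ring
  rw [thetaLevel, thetaChar_eq_prod _ _ hτ, pairProd, levelProd, levelProd, levelProd, e, e, e,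
    Nat.cast_sub hn, ← mul_assoc (qPochInf _ _)]
  congr 2
  · ring
  · congr 2 <;> push_cast <;> ring_nf
  · congr 2 <;> push_cast <;> ring_nf

lemma norm_cexp_div_lt_one {τ : ℂ} (hτ : 0 < τ.im) : ‖cexp (2 * π * Complex.I * (τ / 28))‖ < 1 := by
  refine norm_cexp_two_pi_mul_lt_one ?_
  rw [show τ / 28 = τ / ((28 : ℝ) : ℂ) by norm_num, div_ofReal_im]
  positivity

lemma pairProd_ne_zero {x : ℂ} (hx : ‖x‖ < 1) {n : ℕ} (hn : n ≠ 0) (hn' : n < 28) :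
    pairProd x n ≠ 0 :=
  mul_ne_zero (levelProd_ne_zero hx hn) (levelProd_ne_zero hx (by omega))

lemma thetaLevel_ne_zero {τ : ℂ} (hτ : 0 < τ.im) {n : ℕ} (hn : n ≠ 0) (hn' : n < 28) :
    thetaLevel τ n ≠ 0 := by
  rw [thetaLevel_eq hτ hn'.le]
  have hx := norm_cexp_div_lt_one hτ
  exact mul_ne_zero (exp_ne_zero _)
    (mul_ne_zero (levelProd_ne_zero hx (by norm_num)) (pairProd_ne_zero hx hn hn'))

lemma prod_thetaLevel_eq {τ : ℂ} (hτ : 0 < τ.im) {l : List ℕ} (hl : ∀ n ∈ l, n ≤ 28) :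
    (l.map (thetaLevel τ)).prod = cexp (π * Complex.I * (thetaOrder l * τ)) *
      (levelProd (cexp (2 * π * Complex.I * (τ / 28))) 28 ^ l.length *
        (l.map (pairProd (cexp (2 * π * Complex.I * (τ / 28))))).prod) := by
  induction l with
  | nil => simp [thetaOrder]
  | cons n l ih =>
    rw [List.map_cons, List.prod_cons, ih fun m hm => hl m (List.mem_cons_of_mem _ hm),
      thetaLevel_eq hτ (hl n List.mem_cons_self), List.map_cons, List.prod_cons, List.length_cons,
      thetaOrder, thetaOrder, List.map_cons, List.sum_cons, add_mul, mul_add (π * Complex.I),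
      Complex.exp_add]
    ring

/-- Euler's theorem on partitions into odd and into distinct parts, in product form. -/
lemma qPochInf_sq_mul_neg {q : ℂ} (hq : ‖q‖ < 1) : qPochInf q (q ^ 2) * qPochInf (-q) q = 1 := by
  have h1 := qPochInf_mul_neg q hq
  have h2 := qPochInf_eq_prod q hq (m := 2) (by norm_num)
  have hq2 := norm_pow_lt_one hq two_ne_zero
  rw [prod_range_succ, prod_range_one, pow_zero, mul_one, pow_one, ← pow_two] at h2
  rw [h2] at h1
  refine mul_left_cancel₀ (qPochInf_ne_zero_of_norm_lt hq2 hq2) ?_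
  linear_combination h1

/-- The classical evaluation of the product of the three even theta constants as `2 η³`, up to a
root of unity. All products other than `(q; q)_∞³` cancel by `(q; q²)_∞ (-q; q)_∞ = 1`. -/
lemma thetaEven_eq {τ : ℂ} (hτ : 0 < τ.im) :
    thetaEven τ = 2 * cexp (-(3 * π * Complex.I / 4)) * cexp (π * Complex.I * (1 / 4 * τ)) *
      levelProd (cexp (2 * π * Complex.I * (τ / 28))) 28 ^ 3 := by
  have hq := norm_cexp_two_pi_mul_lt_one hτ
  have es : cexp (π * Complex.I * τ) ^ 2 = cexp (2 * π * Complex.I * τ) := by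
    rw [← Complex.exp_nat_mul]; congr 1; push_cast; ring
  have e28 : cexp (2 * π * Complex.I * (τ / 28)) ^ 28 = cexp (2 * π * Complex.I * τ) := by
    rw [← Complex.exp_nat_mul]; congr 1; push_cast; ring
  have e1 : cexp (2 * π * Complex.I * (1 / 2 * τ + 0)) = cexp (π * Complex.I * τ) := by
    congr 1; ring
  have e2 : cexp (2 * π * Complex.I * (τ - (1 / 2 * τ + 0))) = cexp (π * Complex.I * τ) := by
    congr 1; ring
  have e3 : cexp (2 * π * Complex.I * (0 * τ + 1 / 2)) = -1 := by
    rw [← exp_pi_mul_I]; congr 1; ring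
  have e4 : cexp (2 * π * Complex.I * (τ - (0 * τ + 1 / 2))) = -cexp (2 * π * Complex.I * τ) := by
    rw [show 2 * π * Complex.I * (τ - (0 * τ + 1 / 2)) = 2 * π * Complex.I * τ - π * Complex.I by ring,
      Complex.exp_sub, exp_pi_mul_I]; ring
  have e5 : cexp (2 * π * Complex.I * (1 / 2 * τ + 1 / 2)) = -cexp (π * Complex.I * τ) := by
    rw [show 2 * π * Complex.I * (1 / 2 * τ + 1 / 2) = π * Complex.I * τ + π * Complex.I by ring,
      Complex.exp_add, exp_pi_mul_I]; ring
  have e6 : cexp (2 * π * Complex.I * (τ - (1 / 2 * τ + 1 / 2))) = -cexp (π * Complex.I * τ) := by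
    rw [show 2 * π * Complex.I * (τ - (1 / 2 * τ + 1 / 2)) = π * Complex.I * τ - π * Complex.I by ring,
      Complex.exp_sub, exp_pi_mul_I]; ring
  rw [thetaEven, thetaChar_eq_prod _ _ hτ, thetaChar_eq_prod _ _ hτ, thetaChar_eq_prod _ _ hτ,
    e1, e2, e3, e4, e5, e6, levelProd, e28]
  have e7 : cexp (π * Complex.I * (1 / 2 * (1 / 2 * τ + 0) + τ / 4 - (1 / 2 * τ + 0))) *
      cexp (π * Complex.I * (0 * (0 * τ + 1 / 2) + τ / 4 - (0 * τ + 1 / 2))) *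
      cexp (π * Complex.I * (1 / 2 * (1 / 2 * τ + 1 / 2) + τ / 4 - (1 / 2 * τ + 1 / 2))) =
      cexp (-(3 * π * Complex.I / 4)) * cexp (π * Complex.I * (1 / 4 * τ)) := by
    rw [← Complex.exp_add, ← Complex.exp_add, ← Complex.exp_add]; congr 1; ring
  have h1 := qPochInf_mul_neg (cexp (π * Complex.I * τ)) hq
  rw [es] at h1
  have h2 := qPochInf_sq_mul_neg hq
  rw [← h1] at h2
  have h3 : qPochInf (-1) (cexp (2 * π * Complex.I * τ)) =
      2 * qPochInf (-cexp (2 * π * Complex.I * τ)) (cexp (2 * π * Complex.I * τ)) := by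
    rw [qPochInf_eq_one_sub_mul _ hq]; norm_num
  rw [h3]
  generalize cexp (2 * π * Complex.I * τ) = q at *
  generalize cexp (π * Complex.I * τ) = s at *
  generalize qPochInf s q = a at *
  generalize qPochInf (-s) q = b at *
  generalize qPochInf (-q) q = c at *
  generalize qPochInf q q = d at *
  linear_combination 2 * a ^ 2 * b ^ 2 * c ^ 2 * d ^ 3 * e7 +
    2 * d ^ 3 * cexp (-(3 * π * Complex.I / 4)) * cexp (π * Complex.I * (1 / 4 * τ)) *
      (a * b * c + 1) * h2

/-- Each `thetaLevel` carries one factor `(q; q)_∞` and `thetaEven ^ 3` carries nine, so the length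
condition that makes the weight zero also removes every such factor, leaving a power of `q` and
`pairQuot`. -/
theorem thetaQuot_eq {τ : ℂ} (hτ : 0 < τ.im) {l₁ l₂ : List ℕ} (hl₁ : ∀ n ∈ l₁, n ≤ 28)
    (hl₂ : ∀ n ∈ l₂, n ≤ 28) (hlen : l₂.length = l₁.length + 9) :
    thetaQuot l₁ l₂ τ = (2 * cexp (-(3 * π * Complex.I / 4))) ^ 3 *
      cexp (π * Complex.I * ((thetaOrder l₁ - thetaOrder l₂ + 3 / 4) * τ)) *
        pairQuot l₁ l₂ (cexp (2 * π * Complex.I * (τ / 28))) := by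
  rw [thetaQuot, prod_thetaLevel_eq hτ hl₁, prod_thetaLevel_eq hτ hl₂, thetaEven_eq hτ, pairQuot,
    hlen]
  have h28 := levelProd_ne_zero (norm_cexp_div_lt_one hτ) (k := 28) (by norm_num)
  have e : cexp (π * Complex.I * ((thetaOrder l₁ - thetaOrder l₂ + 3 / 4) * τ)) =
      cexp (π * Complex.I * (thetaOrder l₁ * τ)) * cexp (π * Complex.I * (1 / 4 * τ)) ^ 3 /
        cexp (π * Complex.I * (thetaOrder l₂ * τ)) := by
    rw [← Complex.exp_nat_mul, ← Complex.exp_add, ← Complex.exp_sub]; congr 1; push_cast; ring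
  rw [e, pow_add]
  have e2 := exp_ne_zero (π * Complex.I * (thetaOrder l₂ * τ))
  generalize levelProd (cexp (2 * π * Complex.I * (τ / 28))) 28 = L at *
  generalize (l₁.map (pairProd (cexp (2 * π * Complex.I * (τ / 28))))).prod = X
  generalize (l₂.map (pairProd (cexp (2 * π * Complex.I * (τ / 28))))).prod = Y
  generalize cexp (π * Complex.I * (thetaOrder l₁ * τ)) = E₁
  generalize cexp (π * Complex.I * (thetaOrder l₂ * τ)) = E₂ at *
  rcases eq_or_ne Y 0 with rfl | hY
  · simp
  · field_simp

/-! ### Invariance under congruence subgroups -/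

lemma cexp_pi_mul_I_mul_even {n : ℤ} (hn : Even n) : cexp (π * Complex.I * n) = 1 := by
  obtain ⟨k, rfl⟩ := hn
  rw [Complex.exp_eq_one_iff]
  exact ⟨k, by push_cast; ring⟩

lemma cexp_eq_one_of_even {x : ℂ} (n : ℤ) (hn : Even n) (h : x = π * Complex.I * n) :
    cexp x = 1 := by
  rw [h, cexp_pi_mul_I_mul_even hn]

lemma cexp_eq_of_even {x y : ℂ} (n : ℤ) (hn : Even n) (h : x = y + π * Complex.I * n) :
    cexp x = cexp y := by
  rw [h, Complex.exp_add, cexp_pi_mul_I_mul_even hn, mul_one]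

lemma cexp_pi_mul_I_mul_sq (n : ℕ) (b : ℤ) :
    cexp (π * Complex.I * ((n ^ 2 * b : ℤ) : ℂ)) = cexp (π * Complex.I * b) ^ n := by
  rw [← Complex.exp_nat_mul, exp_eq_exp_iff_exists_int]
  obtain ⟨k, hk⟩ := (Int.even_mul_pred_self (n : ℤ)).two_dvd
  refine ⟨k * b, ?_⟩
  have : (n : ℂ) * (n - 1) = 2 * k := by exact_mod_cast hk
  push_cast
  linear_combination (π * Complex.I * b) * this

/-- The behaviour of the theta functions of level 28 under the conjugate of `Γ₁(3136)` by
`diag(784, 1)`. -/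
lemma exists_theta_smul (γ : SL(2, ℤ)) {b c k l : ℤ} (h00 : γ 0 0 = 1 + 3136 * k)
    (h01 : γ 0 1 = 784 * b) (h10 : γ 1 0 = 4 * c) (h11 : γ 1 1 = 1 + 3136 * l) :
    ∃ μ : ℍ → ℂ, (∀ τ, μ τ ≠ 0) ∧ (∀ τ : ℍ, thetaEven ((γ • τ : ℍ) : ℂ) = μ τ ^ 3 * thetaEven τ) ∧
      ∀ (n : ℕ) (τ : ℍ), thetaLevel ((γ • τ : ℍ) : ℂ) n =
        μ τ * cexp (π * Complex.I * b) ^ n * thetaLevel τ n := by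
  obtain ⟨μ, hμ, h⟩ := exists_thetaChar_smul γ
  refine ⟨μ, hμ, fun τ => ?_, fun n τ => ?_⟩
  · have t1 : thetaChar (1 / 2) 0 ((γ • τ : ℍ) : ℂ) = μ τ * thetaChar (1 / 2) 0 τ := by
      rw [h, h00, h01, h10, h11]
      rw [show 1 / 2 * ((1 + 3136 * k : ℤ) : ℂ) + 0 * ((4 * c : ℤ) : ℂ) =
          1 / 2 + ((1568 * k : ℤ) : ℂ) by push_cast; ring,
        show 1 / 2 * ((784 * b : ℤ) : ℂ) + 0 * ((1 + 3136 * l : ℤ) : ℂ) =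
          0 + ((392 * b : ℤ) : ℂ) by push_cast; ring,
        thetaChar_add_int_fst, thetaChar_add_int_snd]
      have e1 : cexp (-(π * Complex.I * (((1568 * k : ℤ) : ℂ) * (0 + ((392 * b : ℤ) : ℂ) + 1)))) = 1 := by
        refine cexp_eq_one_of_even (2 * -(784 * k * (392 * b + 1))) (even_two_mul _) ?_
        push_cast; ring
      have e2 : cexp (π * Complex.I * (((392 * b : ℤ) : ℂ) * (1 / 2 - 1))) = 1 := by
        refine cexp_eq_one_of_even (2 * (-98 * b)) (even_two_mul _) ?_
        push_cast; ring
      rw [e1, e2, one_mul, one_mul]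
    have t2 : thetaChar 0 (1 / 2) ((γ • τ : ℍ) : ℂ) =
        μ τ * (cexp (π * Complex.I * c) * thetaChar 0 (1 / 2) τ) := by
      rw [h, h00, h01, h10, h11]
      rw [show 0 * ((1 + 3136 * k : ℤ) : ℂ) + 1 / 2 * ((4 * c : ℤ) : ℂ) =
          0 + ((2 * c : ℤ) : ℂ) by push_cast; ring,
        show 0 * ((784 * b : ℤ) : ℂ) + 1 / 2 * ((1 + 3136 * l : ℤ) : ℂ) =
          1 / 2 + ((1568 * l : ℤ) : ℂ) by push_cast; ring,
        thetaChar_add_int_fst, thetaChar_add_int_snd]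
      have e1 : cexp (-(π * Complex.I * (((2 * c : ℤ) : ℂ) * (1 / 2 + ((1568 * l : ℤ) : ℂ) + 1)))) =
          cexp (π * Complex.I * c) := by
        refine cexp_eq_of_even (2 * (-c * (1568 * l + 2))) (even_two_mul _) ?_
        push_cast; ring
      have e2 : cexp (π * Complex.I * (((1568 * l : ℤ) : ℂ) * (0 - 1))) = 1 := by
        refine cexp_eq_one_of_even (2 * (-784 * l)) (even_two_mul _) ?_
        push_cast; ring
      rw [e1, e2, one_mul]
    have t3 : thetaChar (1 / 2) (1 / 2) ((γ • τ : ℍ) : ℂ) =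
        μ τ * (cexp (π * Complex.I * c) * thetaChar (1 / 2) (1 / 2) τ) := by
      rw [h, h00, h01, h10, h11]
      rw [show 1 / 2 * ((1 + 3136 * k : ℤ) : ℂ) + 1 / 2 * ((4 * c : ℤ) : ℂ) =
          1 / 2 + ((2 * (784 * k + c) : ℤ) : ℂ) by push_cast; ring,
        show 1 / 2 * ((784 * b : ℤ) : ℂ) + 1 / 2 * ((1 + 3136 * l : ℤ) : ℂ) =
          1 / 2 + ((392 * b + 1568 * l : ℤ) : ℂ) by push_cast; ring,
        thetaChar_add_int_fst, thetaChar_add_int_snd]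
      have e1 : cexp (-(π * Complex.I * (((2 * (784 * k + c) : ℤ) : ℂ) *
          (1 / 2 + ((392 * b + 1568 * l : ℤ) : ℂ) + 1)))) = cexp (π * Complex.I * c) := by
        refine cexp_eq_of_even (2 * (-(784 * k + c) * (392 * b + 1568 * l + 1) - 392 * k - c))
          (even_two_mul _) ?_
        push_cast; ring
      have e2 : cexp (π * Complex.I * (((392 * b + 1568 * l : ℤ) : ℂ) * (1 / 2 - 1))) = 1 := by
        refine cexp_eq_one_of_even (2 * (-98 * b - 392 * l)) (even_two_mul _) ?_
        push_cast; ring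
      rw [e1, e2, one_mul]
    -- The sign `(-1) ^ c` occurs for exactly two of the three even theta constants, so it
    -- disappears from their product.
    have hc : cexp (π * Complex.I * c) * cexp (π * Complex.I * c) = 1 := by
      rw [← Complex.exp_add, ← mul_add, ← cexp_pi_mul_I_mul_even (n := c + c) ⟨c, rfl⟩]
      push_cast; rfl
    rw [thetaEven, t1, t2, t3, thetaEven]
    linear_combination μ τ ^ 3 * thetaChar (1 / 2) 0 τ * thetaChar 0 (1 / 2) τ *
      thetaChar (1 / 2) (1 / 2) τ * hc
  · rw [thetaLevel, h, h00, h01, h10, h11, thetaLevel, mul_assoc]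
    congr 1
    rw [show (n : ℂ) / 28 * ((1 + 3136 * k : ℤ) : ℂ) + 0 * ((4 * c : ℤ) : ℂ) =
        (n : ℂ) / 28 + ((112 * n * k : ℤ) : ℂ) by push_cast; ring,
      show (n : ℂ) / 28 * ((784 * b : ℤ) : ℂ) + 0 * ((1 + 3136 * l : ℤ) : ℂ) =
        0 + ((28 * n * b : ℤ) : ℂ) by push_cast; ring,
      thetaChar_add_int_fst, thetaChar_add_int_snd, ← cexp_pi_mul_I_mul_sq]
    have e1 : cexp (-(π * Complex.I * (((112 * n * k : ℤ) : ℂ) *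
        (0 + ((28 * n * b : ℤ) : ℂ) + 1)))) = 1 := by
      refine cexp_eq_one_of_even (2 * (-56 * n * k * (28 * n * b + 1))) (even_two_mul _) ?_
      push_cast; ring
    have e2 : cexp (π * Complex.I * (((28 * n * b : ℤ) : ℂ) * ((n : ℂ) / 28 - 1))) =
        cexp (π * Complex.I * ((n ^ 2 * b : ℤ) : ℂ)) := by
      refine cexp_eq_of_even (2 * (-14 * n * b)) (even_two_mul _) ?_
      push_cast; ring
    rw [e1, e2, one_mul]

lemma prod_map_eq_of_forall {f g : ℕ → ℂ} {μ ε : ℂ} (h : ∀ n, f n = μ * ε ^ n * g n)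
    (l : List ℕ) : (l.map f).prod = μ ^ l.length * ε ^ l.sum * (l.map g).prod := by
  induction l with
  | nil => simp
  | cons n l ih =>
    rw [List.map_cons, List.prod_cons, ih, h, List.map_cons, List.prod_cons, List.length_cons,
      List.sum_cons]
    ring

/-- The automorphy factors cancel by the length condition: `thetaEven ^ 3` counts for nine theta
functions. The remaining sign `(-1) ^ (b n)` of each `thetaLevel` multiplies to `1` by the parity of
the total of the indices. -/
theorem thetaQuot_smul (γ : SL(2, ℤ)) {b c k l : ℤ} (h00 : γ 0 0 = 1 + 3136 * k)
    (h01 : γ 0 1 = 784 * b) (h10 : γ 1 0 = 4 * c) (h11 : γ 1 1 = 1 + 3136 * l)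
    {l₁ l₂ : List ℕ} (hlen : l₂.length = l₁.length + 9) (hsum : Even (l₁.sum + l₂.sum)) (τ : ℍ) :
    thetaQuot l₁ l₂ ((γ • τ : ℍ) : ℂ) = thetaQuot l₁ l₂ τ := by
  obtain ⟨μ, hμ, h1, h2⟩ := exists_theta_smul γ h00 h01 h10 h11
  have hε : cexp (π * Complex.I * b) ^ 2 = 1 := by
    rw [← Complex.exp_nat_mul, ← cexp_pi_mul_I_mul_even (even_two_mul b)]; push_cast; ring_nf
  have hε0 := exp_ne_zero (π * Complex.I * b)
  have hε1 : cexp (π * Complex.I * b) ^ l₁.sum = cexp (π * Complex.I * b) ^ l₂.sum := by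
    obtain ⟨m, hm⟩ := hsum
    have h3 : cexp (π * Complex.I * b) ^ l₁.sum * cexp (π * Complex.I * b) ^ l₂.sum = 1 := by
      rw [← pow_add, hm, ← two_mul, pow_mul, hε, one_pow]
    have h4 : cexp (π * Complex.I * b) ^ l₂.sum * cexp (π * Complex.I * b) ^ l₂.sum = 1 := by
      rw [← pow_add, ← two_mul, pow_mul, hε, one_pow]
    exact mul_right_cancel₀ (pow_ne_zero l₂.sum hε0) (h3.trans h4.symm)
  rw [thetaQuot, thetaQuot, prod_map_eq_of_forall (h2 · τ), prod_map_eq_of_forall (h2 · τ), h1, hlen,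
    hε1]
  have h5 := hμ τ
  have h6 := pow_ne_zero l₂.sum hε0
  rw [show μ τ ^ l₁.length * cexp (π * Complex.I * b) ^ l₂.sum * (l₁.map (thetaLevel τ)).prod *
      (μ τ ^ 3 * thetaEven τ) ^ 3 = (μ τ ^ (l₁.length + 9) * cexp (π * Complex.I * b) ^ l₂.sum) *
      ((l₁.map (thetaLevel τ)).prod * thetaEven τ ^ 3) by ring,
    mul_div_mul_left _ _ (mul_ne_zero (pow_ne_zero _ h5) h6)]

/-! ### A criterion for modular functions -/

/-- Holomorphic functions on the upper half plane which are invariant under `Γ₁(N)` and grow at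
most exponentially at the cusps. -/
structure IsModerateModular (N : ℕ) (f : ℂ → ℂ) : Prop where
  differentiableAt : ∀ τ : ℂ, 0 < τ.im → DifferentiableAt ℂ f τ
  invariant : ∀ γ ∈ CongruenceSubgroup.Gamma1 N, ∀ τ : ℍ, f ((γ • τ : ℍ) : ℂ) = f τ
  growth : ∃ K C : ℝ, 0 ≤ K ∧ ∀ τ : ℂ, 0 < τ.im → ‖f τ‖ ≤ K * Real.exp (C * (τ.im + 1 / τ.im))

lemma IsModerateModular.add {N : ℕ} {f g : ℂ → ℂ} (hf : IsModerateModular N f)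
    (hg : IsModerateModular N g) : IsModerateModular N fun τ => f τ + g τ where
  differentiableAt τ hτ := (hf.differentiableAt τ hτ).add (hg.differentiableAt τ hτ)
  invariant γ hγ τ := by rw [hf.invariant γ hγ, hg.invariant γ hγ]
  growth := by
    obtain ⟨K, C, hK, h⟩ := hf.growth
    obtain ⟨K', C', hK', h'⟩ := hg.growth
    refine ⟨K + K', max C C', add_nonneg hK hK', fun τ hτ => ?_⟩
    have h0 : 0 ≤ τ.im + 1 / τ.im := by positivity
    rw [add_mul]
    refine (norm_add_le _ _).trans (add_le_add ((h τ hτ).trans ?_) ((h' τ hτ).trans ?_))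
    · gcongr
      exact le_max_left _ _
    · gcongr
      exact le_max_right _ _

lemma IsModerateModular.const_mul {N : ℕ} {f : ℂ → ℂ} (c : ℂ) (hf : IsModerateModular N f) :
    IsModerateModular N fun τ => c * f τ where
  differentiableAt τ hτ := (hf.differentiableAt τ hτ).const_mul c
  invariant γ hγ τ := by rw [hf.invariant γ hγ]
  growth := by
    obtain ⟨K, C, hK, h⟩ := hf.growth
    refine ⟨‖c‖ * K, C, by positivity, fun τ hτ => ?_⟩
    rw [norm_mul, mul_assoc]
    exact mul_le_mul_of_nonneg_left (h τ hτ) (norm_nonneg c)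

lemma IsModerateModular.congr {N : ℕ} {f g : ℂ → ℂ} (hf : IsModerateModular N f)
    (h : ∀ τ : ℂ, 0 < τ.im → g τ = f τ) : IsModerateModular N g where
  differentiableAt τ hτ := (hf.differentiableAt τ hτ).congr_of_eventuallyEq <| by
    filter_upwards [(isOpen_lt continuous_const Complex.continuous_im).mem_nhds hτ] with z hz using h z hz
  invariant γ hγ τ := by rw [h _ (γ • τ).im_pos, h _ τ.im_pos, hf.invariant γ hγ]
  growth := by
    obtain ⟨K, C, hK, h'⟩ := hf.growth
    exact ⟨K, C, hK, fun τ hτ => by rw [h τ hτ]; exact h' τ hτ⟩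

/-- `Γ(N)` is normal, so `γ T ^ N γ⁻¹` lies in `Γ(N)`, hence in `Γ₁(N)`. This makes every translate
by `γ` periodic with period `N`. -/
lemma smul_vadd_eq (γ : SL(2, ℤ)) (N : ℕ) (τ : ℍ) :
    ∃ δ ∈ CongruenceSubgroup.Gamma1 N, γ • ((N : ℝ) +ᵥ τ) = δ • γ • τ := by
  refine ⟨γ * ModularGroup.T ^ (N : ℤ) * γ⁻¹, ?_, ?_⟩
  · have h := (CongruenceSubgroup.Gamma_normal (N := N)).conj_mem _
      (CongruenceSubgroup.ModularGroup_T_pow_mem_Gamma N N dvd_rfl) γ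
    rw [CongruenceSubgroup.Gamma_mem] at h
    rw [CongruenceSubgroup.Gamma1_mem]
    exact ⟨h.1, h.2.2.2, h.2.2.1⟩
  · rw [← mul_smul, inv_mul_cancel_right, mul_smul, modular_T_zpow_smul]
    simp

lemma periodic_smul_comp_ofComplex {N : ℕ} {f : ℂ → ℂ} (hf : IsModerateModular N f)
    (γ : SL(2, ℤ)) :
    Function.Periodic ((fun τ : ℍ => f ((γ • τ : ℍ) : ℂ)) ∘ ofComplex) ((N : ℝ) : ℂ) := by
  intro w
  by_cases hw : 0 < w.im
  · have hw' : 0 < (w + ((N : ℝ) : ℂ)).im := by simpa using hw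
    rw [comp_ofComplex_of_im_pos _ _ hw, comp_ofComplex_of_im_pos _ _ hw']
    have : (⟨w + ((N : ℝ) : ℂ), hw'⟩ : ℍ) = (N : ℝ) +ᵥ (⟨w, hw⟩ : ℍ) := by
      ext; simp [add_comm]
    rw [this]
    obtain ⟨δ, hδ, e⟩ := smul_vadd_eq γ N ⟨w, hw⟩
    rw [e, hf.invariant δ hδ]
  · exact comp_ofComplex_of_im_le_zero _ _ _ (by simpa using hw) (by simpa using hw)

lemma differentiableAt_smul_comp_ofComplex {f : ℂ → ℂ}
    (hf : ∀ τ : ℂ, 0 < τ.im → DifferentiableAt ℂ f τ) (γ : SL(2, ℤ)) {τ : ℂ} (hτ : 0 < τ.im) :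
    DifferentiableAt ℂ ((fun τ : ℍ => f ((γ • τ : ℍ) : ℂ)) ∘ ofComplex) τ := by
  have h1 : DifferentiableAt ℂ (fun z : ℂ => f ((γ 0 0 * z + γ 0 1) / (γ 1 0 * z + γ 1 1))) τ := by
    have e := specialLinearGroup_apply γ ⟨τ, hτ⟩
    have hd : (γ 1 0 * τ + γ 1 1 : ℂ) ≠ 0 := by
      have := denom_ne_zero (γ : GL (Fin 2) ℝ) (⟨τ, hτ⟩ : ℍ)
      simpa [denom] using this
    refine DifferentiableAt.comp (g := f) τ (hf _ ?_) (.div (by fun_prop) (by fun_prop) hd)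
    have h2 := (γ • (⟨τ, hτ⟩ : ℍ)).im_pos
    rw [← UpperHalfPlane.coe_im, e] at h2
    simpa using h2
  refine h1.congr_of_eventuallyEq ?_
  filter_upwards [(isOpen_lt continuous_const Complex.continuous_im).mem_nhds hτ] with z hz
  rw [comp_ofComplex_of_im_pos _ _ hz, specialLinearGroup_apply]
  simp

/-- The growth of the imaginary part under a modular transformation on a vertical strip. -/
lemma exists_im_smul_add_le (γ : SL(2, ℤ)) (B : ℝ) : ∃ D : ℝ, ∀ τ : ℍ, |τ.re| ≤ B → 1 ≤ τ.im →
    (γ • τ).im + 1 / (γ • τ).im ≤ D * τ.im := by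
  have h0 : γ 1 0 ≠ 0 ∨ γ 1 0 = 0 ∧ |γ 1 1| = 1 := by
    rcases eq_or_ne (γ 1 0) 0 with h | h
    · refine .inr ⟨h, ?_⟩
      have hdet := γ.det_coe
      rw [Matrix.det_fin_two, h, mul_zero, sub_zero] at hdet
      exact Int.isUnit_iff_abs_eq.mp (.of_mul_eq_one_right _ hdet)
    · exact .inl h
  -- With `(c, d)` the bottom row, `Im (γτ) = Im τ / |cτ + d|²`. For `Im τ ≥ 1` the denominator is
  -- at least `1`, and on the strip it is at most the bracketed constant times `(Im τ)²`.
  refine ⟨1 + ((|(γ 1 0 : ℝ)| * B + |(γ 1 1 : ℝ)|) ^ 2 + (γ 1 0 : ℝ) ^ 2), fun τ hx hy => ?_⟩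
  have e : Complex.normSq (denom γ τ) =
      ((γ 1 0 : ℝ) * τ.re + γ 1 1) ^ 2 + ((γ 1 0 : ℝ) * τ.im) ^ 2 := by
    rw [ModularGroup.denom_apply, Complex.normSq_apply]
    simp [pow_two]
  have hy2 : 1 ≤ τ.im ^ 2 := one_le_pow₀ hy
  have hn : 1 ≤ Complex.normSq (denom γ τ) := by
    rw [e]
    rcases h0 with h | ⟨h, h'⟩
    · have h1 : (1 : ℝ) ≤ (γ 1 0 : ℝ) ^ 2 := by
        exact_mod_cast (one_le_sq_iff_one_le_abs _).mpr (Int.one_le_abs h)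
      rw [mul_pow]
      nlinarith [sq_nonneg ((γ 1 0 : ℝ) * τ.re + γ 1 1)]
    · have h1 : (γ 1 1 : ℝ) ^ 2 = 1 := by
        rw [← sq_abs, ← Int.cast_abs, h', Int.cast_one, one_pow]
      rw [h]
      simp [h1]
  have hn' : Complex.normSq (denom γ τ) ≤
      ((|(γ 1 0 : ℝ)| * B + |(γ 1 1 : ℝ)|) ^ 2 + (γ 1 0 : ℝ) ^ 2) * τ.im ^ 2 := by
    rw [e, add_mul, mul_pow (γ 1 0 : ℝ)]
    have h1 : ((γ 1 0 : ℝ) * τ.re + γ 1 1) ^ 2 ≤ (|(γ 1 0 : ℝ)| * B + |(γ 1 1 : ℝ)|) ^ 2 := by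
      rw [← sq_abs]
      gcongr
      refine (abs_add_le _ _).trans ?_
      rw [abs_mul]
      gcongr
    nlinarith [sq_nonneg (|(γ 1 0 : ℝ)| * B + |(γ 1 1 : ℝ)|)]
  rw [ModularGroup.im_smul_eq_div_normSq, one_div_div, add_mul, one_mul]
  have hy0 := τ.im_pos
  refine add_le_add (div_le_self hy0.le hn) ?_
  rw [div_le_iff₀ hy0]
  linarith [hn']

/-- On a strip of width `N` each translate is `O(exp (C' Im τ))`, that is, bounded by a power of `1
/ |q_N|`, where `q_N = exp (2πiτ / N)`. Multiplication by a higher power of `q_N` gives a function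
tending to `0`, and Riemann's removable singularity theorem applies. -/
theorem IsModerateModular.isModularFunctionGammaOne {N : ℕ} (hN : N ≠ 0) {f : ℂ → ℂ}
    (hf : IsModerateModular N f) : IsModularFunctionGammaOne N fun τ : ℍ => f τ where
  meromorphic := by
    refine AnalyticOnNhd.meromorphicNFOn ?_
    have h : DifferentiableOn ℂ ((fun τ : ℍ => f τ) ∘ ofComplex) upperHalfPlaneSet := by
      intro τ hτ
      refine ((hf.differentiableAt τ hτ).congr_of_eventuallyEq ?_).differentiableWithinAt
      filter_upwards [(isOpen_lt continuous_const Complex.continuous_im).mem_nhds hτ] with z hz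
      rw [comp_ofComplex_of_im_pos _ _ hz]
    exact h.analyticOnNhd (isOpen_lt continuous_const Complex.continuous_im)
  invariant := hf.invariant
  meromorphic_cusps γ := by
    have hN' : (0 : ℝ) < N := by positivity
    obtain ⟨K, C, hK, hC⟩ := hf.growth
    obtain ⟨D, hD⟩ := exists_im_smul_add_le γ (N / 2)
    -- With this `k`, the power `|q_N| ^ k = exp (-2πk Im τ / N)` absorbs the growth `exp (|C| D Im
    -- τ)`; one further power forces the limit `0`.
    obtain ⟨k, hk⟩ := exists_nat_ge (|C| * D * N / (2 * π))
    rw [div_le_iff₀ (by positivity)] at hk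
    refine ⟨k + 1, analyticAt_of_differentiable_on_punctured_nhds_of_continuousAt ?_ ?_⟩
    · have h := Function.Periodic.eventually_differentiableAt_cuspFunction_nhds_ne_zero hN'
        (periodic_smul_comp_ofComplex hf γ) ?_
      · filter_upwards [h] with z hz
        exact ((differentiableAt_id.sub_const 0).pow (k + 1)).smul hz
      · filter_upwards [tendsto_comap.eventually (eventually_gt_atTop (0 : ℝ))] with z hz
        exact differentiableAt_smul_comp_ofComplex hf.differentiableAt γ hz
    · rw [continuousAt_iff_punctured_nhds, sub_self, zero_pow k.succ_ne_zero, zero_smul]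
      have hlim : Tendsto (fun z : ℂ => K * ‖z‖) (𝓝[≠] 0) (𝓝 0) := by
        have : ContinuousAt (fun z : ℂ => K * ‖z‖) 0 := by fun_prop
        have h := this.tendsto.mono_left (nhdsWithin_le_nhds (s := {0}ᶜ))
        simpa using h
      refine squeeze_zero_norm' ?_ hlim
      have him := (Function.Periodic.invQParam_tendsto hN').eventually
        (tendsto_comap.eventually (eventually_ge_atTop (1 : ℝ)))
      filter_upwards [him, self_mem_nhdsWithin] with z hz hz0
      rw [Function.Periodic.cuspFunction_eq_of_nonzero _ _ hz0, sub_zero, norm_smul, norm_pow]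
      -- The inverse parameter is built from the principal logarithm, so its real part stays in the
      -- strip on which the growth was estimated.
      have hre : |(Function.Periodic.invQParam N z).re| ≤ N / 2 := by
        have e : Function.Periodic.invQParam N z =
            ((N / (2 * π) : ℝ) : ℂ) * (-Complex.I * Complex.log z) := by
          have hI : (Complex.I : ℂ)⁻¹ = -Complex.I := Complex.inv_I
          rw [Function.Periodic.invQParam, div_mul_eq_div_div, div_eq_mul_inv _ Complex.I, hI]
          push_cast
          ring
        rw [e, re_ofReal_mul, neg_mul, neg_re, I_mul_re, neg_neg, Complex.log_im, abs_mul,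
          abs_of_nonneg (by positivity)]
        calc N / (2 * π) * |z.arg| ≤ N / (2 * π) * π := by gcongr; exact abs_arg_le_pi z
          _ = N / 2 := by field_simp
      have hnorm : ‖z‖ = Real.exp (-2 * π * (Function.Periodic.invQParam N z).im / N) := by
        rw [← Function.Periodic.norm_qParam, Function.Periodic.qParam_right_inv hN'.ne' hz0]
      generalize Function.Periodic.invQParam N z = τ at *
      have hτ : 0 < τ.im := by linarith
      rw [comp_ofComplex_of_im_pos _ _ hτ]
      have h1 := hC _ (γ • (⟨τ, hτ⟩ : ℍ)).im_pos
      have h2 := hD ⟨τ, hτ⟩ hre hz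
      have h3 : ‖f ((γ • (⟨τ, hτ⟩ : ℍ) : ℍ) : ℂ)‖ ≤ K * Real.exp (|C| * (D * τ.im)) := by
        refine h1.trans ?_
        refine mul_le_mul_of_nonneg_left (Real.exp_le_exp.mpr ?_) hK
        refine mul_le_mul (le_abs_self C) h2 ?_ (abs_nonneg C)
        have := (γ • (⟨τ, hτ⟩ : ℍ)).im_pos
        rw [UpperHalfPlane.coe_im]
        positivity
      have h4 : ‖z‖ ^ k * Real.exp (|C| * (D * τ.im)) ≤ 1 := by
        rw [hnorm, ← Real.exp_nat_mul, ← Real.exp_add, Real.exp_le_one_iff]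
        have h5 : k * (-2 * π * τ.im / N) + |C| * (D * τ.im) =
            τ.im / N * (|C| * D * N - k * (2 * π)) := by
          field_simp
          ring
        rw [h5]
        exact mul_nonpos_of_nonneg_of_nonpos (by positivity) (by linarith)
      calc ‖z‖ ^ (k + 1) * ‖f ((γ • (⟨τ, hτ⟩ : ℍ) : ℍ) : ℂ)‖
          ≤ ‖z‖ ^ (k + 1) * (K * Real.exp (|C| * (D * τ.im))) := by gcongr
        _ = K * ‖z‖ * (‖z‖ ^ k * Real.exp (|C| * (D * τ.im))) := by ring
        _ ≤ K * ‖z‖ := mul_le_of_le_one_right (by positivity) h4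

/-! ### Growth of the infinite products -/

/-- The constant `∑ 1 / n ^ 2`. -/
noncomputable def sumInvSq : ℝ := ∑' n : ℕ, 1 / ((n : ℝ) + 1) ^ 2

lemma hasSum_sumInvSq : HasSum (fun n : ℕ => 1 / ((n : ℝ) + 1) ^ 2) sumInvSq := by
  have h := (summable_nat_add_iff 1).mpr (Real.summable_one_div_nat_pow.mpr one_lt_two)
  simpa [sumInvSq] using h.hasSum

lemma sumInvSq_nonneg : 0 ≤ sumInvSq := hasSum_sumInvSq.nonneg fun n => by positivity

/-- Each of the `m + 1` terms of `1 + r + ⋯ + r ^ m = (1 - r ^ (m + 1)) / (1 - r)` is at least `r ^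
(m + 1)`; this yields the second factor `1 / (m + 1)`. -/
lemma sum_pow_le {r : ℝ} (h0 : 0 ≤ r) (h1 : r < 1) (n m : ℕ) :
    ∑ j ∈ range n, (r ^ (j + 1)) ^ (m + 1) / ((m : ℝ) + 1) ≤ 1 / ((m : ℝ) + 1) ^ 2 / (1 - r) := by
  have hr : 0 < 1 - r := by linarith
  have e : ∑ j ∈ range n, (r ^ (j + 1)) ^ (m + 1) / ((m : ℝ) + 1) =
      r ^ (m + 1) * (∑ j ∈ range n, (r ^ (m + 1)) ^ j) / ((m : ℝ) + 1) := by
    rw [mul_sum, sum_div]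
    refine sum_congr rfl fun j _ => ?_
    rw [← pow_mul, ← pow_mul]
    ring
  have h2 := mul_neg_geom_sum (r ^ (m + 1)) n
  have h3 := mul_neg_geom_sum r (m + 1)
  have h4 : ((m : ℝ) + 1) * r ^ (m + 1) ≤ ∑ i ∈ range (m + 1), r ^ i := by
    have h := card_nsmul_le_sum (range (m + 1)) (fun i => r ^ i) (r ^ (m + 1)) fun i hi =>
      pow_le_pow_of_le_one h0 h1.le (by have := mem_range.mp hi; omega)
    simpa using h
  have hs : 0 ≤ (r ^ (m + 1)) ^ n := by positivity
  have hG : 0 ≤ ∑ j ∈ range n, (r ^ (m + 1)) ^ j := by positivity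
  rw [e, div_div, div_le_div_iff₀ (by positivity) (by positivity)]
  generalize ∑ j ∈ range n, (r ^ (m + 1)) ^ j = G at *
  have h5 : (1 - r) * (((m : ℝ) + 1) * r ^ (m + 1)) ≤ 1 - r ^ (m + 1) := by
    rw [← h3]; gcongr
  have h6 : (1 - r) * (((m : ℝ) + 1) * r ^ (m + 1)) * G ≤ 1 :=
    (mul_le_mul_of_nonneg_right h5 hG).trans (by rw [h2]; linarith)
  have hm : (0 : ℝ) ≤ (m : ℝ) + 1 := by positivity
  calc r ^ (m + 1) * G * (((m : ℝ) + 1) ^ 2 * (1 - r))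
      = ((1 - r) * (((m : ℝ) + 1) * r ^ (m + 1)) * G) * ((m : ℝ) + 1) := by ring
    _ ≤ 1 * ((m : ℝ) + 1) := by gcongr

/-- Expanding every `-log (1 - r ^ j)` as a power series and summing over `j` first bounds the total
by `∑ 1 / m²` divided by `1 - r`. -/
lemma exp_neg_le_prod_one_sub_pow {r : ℝ} (h0 : 0 ≤ r) (h1 : r < 1) (n : ℕ) :
    Real.exp (-(sumInvSq / (1 - r))) ≤ ∏ j ∈ range n, (1 - r ^ (j + 1)) := by
  have hlt : ∀ j : ℕ, r ^ (j + 1) < 1 := fun j => pow_lt_one₀ h0 h1 j.succ_ne_zero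
  have h : ∑ j ∈ range n, -Real.log (1 - r ^ (j + 1)) ≤ sumInvSq / (1 - r) := by
    refine hasSum_le (fun m => sum_pow_le h0 h1 n m)
      (hasSum_sum fun j _ => Real.hasSum_pow_div_log_of_abs_lt_one ?_)
      (hasSum_sumInvSq.div_const (1 - r))
    rw [abs_of_nonneg (by positivity)]
    exact hlt j
  rw [sum_neg_distrib, neg_le] at h
  calc Real.exp (-(sumInvSq / (1 - r))) ≤ Real.exp (∑ j ∈ range n, Real.log (1 - r ^ (j + 1))) :=
        Real.exp_le_exp.mpr h
    _ = _ := by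
        rw [Real.exp_sum]
        exact prod_congr rfl fun j _ => Real.exp_log (by linarith [hlt j])

lemma norm_levelProd_bounds {x : ℂ} (hx : ‖x‖ < 1) {k : ℕ} (hk : k ≠ 0) :
    Real.exp (-(sumInvSq / (1 - ‖x‖))) ≤ ‖levelProd x k‖ ∧
      ‖levelProd x k‖ ≤ Real.exp (sumInvSq / (1 - ‖x‖)) := by
  have hx0 := norm_nonneg x
  have hlt : ∀ j : ℕ, ‖x‖ ^ (j + 1) < 1 := fun j => pow_lt_one₀ hx0 hx j.succ_ne_zero
  have hle : ∀ j : ℕ, ‖x ^ k * (x ^ 28) ^ j‖ ≤ ‖x‖ ^ (j + 1) := fun j => by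
    rw [← pow_mul, ← pow_add, norm_pow]
    exact pow_le_pow_of_le_one hx0 hx.le (by omega)
  have hlim := (tendsto_qPoch (x ^ k) (norm_pow_lt_one hx (by norm_num : 28 ≠ 0))).norm
  have hpos : ∀ n, 0 < ∏ j ∈ range n, (1 - ‖x‖ ^ (j + 1)) := fun n =>
    prod_pos fun j _ => by linarith [hlt j]
  refine ⟨ge_of_tendsto' hlim fun n => ?_, le_of_tendsto' hlim fun n => ?_⟩
  · refine (exp_neg_le_prod_one_sub_pow hx0 hx n).trans ?_
    rw [qPoch, norm_prod]
    refine prod_le_prod (fun j _ => by linarith [hlt j]) fun j _ => ?_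
    have := norm_sub_norm_le (1 : ℂ) (x ^ k * (x ^ 28) ^ j)
    rw [norm_one] at this
    linarith [hle j]
  · rw [← neg_neg (sumInvSq / (1 - ‖x‖)), Real.exp_neg]
    refine le_trans ?_ (inv_anti₀ (Real.exp_pos _) (exp_neg_le_prod_one_sub_pow hx0 hx n))
    rw [qPoch, norm_prod, ← prod_inv_distrib]
    refine prod_le_prod (fun j _ => norm_nonneg _) fun j _ => ?_
    have h1 := norm_sub_le (1 : ℂ) (x ^ k * (x ^ 28) ^ j)
    rw [norm_one] at h1
    have h2 := hlt j
    -- From `(1 + t) (1 - t) ≤ 1`, the upper bound for the product follows from the lower one.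
    have h3 : (1 + ‖x‖ ^ (j + 1)) ≤ (1 - ‖x‖ ^ (j + 1))⁻¹ := by
      rw [le_inv_comm₀ (by positivity) (by linarith), ← one_div, le_div_iff₀ (by positivity)]
      nlinarith [sq_nonneg (‖x‖ ^ (j + 1))]
    linarith [hle j]

lemma norm_prod_pairProd_bounds {x : ℂ} (hx : ‖x‖ < 1) {l : List ℕ}
    (hl : ∀ n ∈ l, n ≠ 0 ∧ n < 28) :
    Real.exp (-(sumInvSq / (1 - ‖x‖))) ^ (2 * l.length) ≤ ‖(l.map (pairProd x)).prod‖ ∧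
      ‖(l.map (pairProd x)).prod‖ ≤ Real.exp (sumInvSq / (1 - ‖x‖)) ^ (2 * l.length) := by
  induction l with
  | nil => simp
  | cons n l ih =>
    obtain ⟨h1, h2⟩ := ih fun m hm => hl m (List.mem_cons_of_mem _ hm)
    obtain ⟨hn, hn'⟩ := hl n List.mem_cons_self
    obtain ⟨h3, h4⟩ := norm_levelProd_bounds hx hn
    obtain ⟨h5, h6⟩ := norm_levelProd_bounds hx (k := 28 - n) (by omega)
    rw [List.map_cons, List.prod_cons, List.length_cons, mul_add, mul_one, pow_add, pow_add, mul_comm,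
      mul_comm (_ ^ _) (_ ^ 2), norm_mul, pairProd, norm_mul, pow_two, pow_two]
    constructor <;> gcongr

lemma norm_pairQuot_le {x : ℂ} (hx : ‖x‖ < 1) {l₁ l₂ : List ℕ}
    (hl₁ : ∀ n ∈ l₁, n ≠ 0 ∧ n < 28) (hl₂ : ∀ n ∈ l₂, n ≠ 0 ∧ n < 28) :
    ‖pairQuot l₁ l₂ x‖ ≤
      Real.exp (sumInvSq / (1 - ‖x‖) * (2 * (l₁.length + l₂.length) : ℕ)) := by
  rw [pairQuot, norm_div, mul_comm _ (Nat.cast _), Real.exp_nat_mul, mul_add, pow_add, div_eq_mul_inv]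
  refine mul_le_mul (norm_prod_pairProd_bounds hx hl₁).2 ?_ (by positivity) (by positivity)
  have h := inv_anti₀ (by positivity) (norm_prod_pairProd_bounds hx hl₂).1
  rwa [← inv_pow, ← Real.exp_neg, neg_neg] at h

/-! ### Modularity of the theta quotients -/

lemma differentiableAt_thetaEven {τ : ℂ} (hτ : 0 < τ.im) : DifferentiableAt ℂ thetaEven τ :=
  ((differentiableAt_thetaChar _ _ hτ).mul (differentiableAt_thetaChar _ _ hτ)).mul
    (differentiableAt_thetaChar _ _ hτ)

lemma differentiableAt_prod_thetaLevel {τ : ℂ} (hτ : 0 < τ.im) (l : List ℕ) :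
    DifferentiableAt ℂ (fun τ => (l.map (thetaLevel τ)).prod) τ := by
  induction l with
  | nil => simp
  | cons n l ih =>
    simp only [List.map_cons, List.prod_cons]
    exact (differentiableAt_thetaChar _ _ hτ).mul ih

lemma prod_thetaLevel_ne_zero {τ : ℂ} (hτ : 0 < τ.im) {l : List ℕ}
    (hl : ∀ n ∈ l, n ≠ 0 ∧ n < 28) : (l.map (thetaLevel τ)).prod ≠ 0 := by
  simp only [ne_eq, List.prod_eq_zero_iff, List.mem_map, not_exists, not_and]
  exact fun n hn => thetaLevel_ne_zero hτ (hl n hn).1 (hl n hn).2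

lemma differentiableAt_thetaQuot {τ : ℂ} (hτ : 0 < τ.im) {l₁ l₂ : List ℕ}
    (hl₂ : ∀ n ∈ l₂, n ≠ 0 ∧ n < 28) : DifferentiableAt ℂ (thetaQuot l₁ l₂) τ :=
  ((differentiableAt_prod_thetaLevel hτ l₁).mul ((differentiableAt_thetaEven hτ).pow 3)).div
    (differentiableAt_prod_thetaLevel hτ l₂) (prod_thetaLevel_ne_zero hτ hl₂)

lemma thetaOrder_eq_ofReal (l : List ℕ) :
    thetaOrder l = (((l.map fun n : ℕ => ((n : ℝ) / 28 - 1 / 2) ^ 2).sum : ℝ) : ℂ) := by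
  induction l with
  | nil => simp [thetaOrder]
  | cons n l ih =>
    rw [thetaOrder, List.map_cons, List.sum_cons, List.map_cons, List.sum_cons, ofReal_add, ← ih,
      thetaOrder]
    push_cast
    rfl

lemma inv_one_sub_exp_neg_le {t : ℝ} (ht : 0 < t) : 1 / (1 - Real.exp (-t)) ≤ 1 + 1 / t := by
  have h1 : Real.exp (-t) < 1 := by rw [← Real.exp_zero, Real.exp_lt_exp]; linarith
  have h2 : Real.exp (-t) * (1 + t) ≤ 1 := by
    have := mul_le_mul_of_nonneg_left (Real.add_one_le_exp t) (Real.exp_pos (-t)).le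
    rw [← Real.exp_add, neg_add_cancel, Real.exp_zero] at this
    linarith
  rw [div_le_iff₀ (by linarith)]
  have h3 : (1 + 1 / t) * (1 - Real.exp (-t)) = 1 + (1 - Real.exp (-t) * (1 + t)) / t := by
    field_simp
    ring
  rw [h3]
  have : 0 ≤ (1 - Real.exp (-t) * (1 + t)) / t := div_nonneg (by linarith) ht.le
  linarith

/-- The exponential prefactor is controlled by `Im τ`. The products contribute `exp` of a multiple
of `1 / (1 - |x|)` with `|x| = exp (-56 π Im τ)`, which is controlled by `1 + 1 / Im τ`. -/
lemma norm_thetaQuot_le {l₁ l₂ : List ℕ} (hl₁ : ∀ n ∈ l₁, n ≠ 0 ∧ n < 28)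
    (hl₂ : ∀ n ∈ l₂, n ≠ 0 ∧ n < 28) (hlen : l₂.length = l₁.length + 9) :
    ∃ K C : ℝ, 0 ≤ K ∧ ∀ τ : ℂ, 0 < τ.im →
      ‖thetaQuot l₁ l₂ (784 * τ)‖ ≤ K * Real.exp (C * (τ.im + 1 / τ.im)) := by
  obtain ⟨c, hc⟩ : ∃ c : ℝ, thetaOrder l₁ - thetaOrder l₂ + 3 / 4 = c := by
    rw [thetaOrder_eq_ofReal, thetaOrder_eq_ofReal]
    exact ⟨(l₁.map fun n : ℕ => ((n : ℝ) / 28 - 1 / 2) ^ 2).sum -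
      (l₂.map fun n : ℕ => ((n : ℝ) / 28 - 1 / 2) ^ 2).sum + 3 / 4, by push_cast; rfl⟩
  set n : ℕ := 2 * (l₁.length + l₂.length)
  refine ⟨‖(2 * cexp (-(3 * π * Complex.I / 4))) ^ 3‖, π * (|c| * 784) + sumInvSq * n,
    norm_nonneg _, fun τ hτ => ?_⟩
  have hτ' : 0 < (784 * τ).im := by
    have : (784 * τ).im = 784 * τ.im := by simp
    rw [this]; positivity
  have hx := norm_cexp_div_lt_one hτ'
  rw [thetaQuot_eq hτ' (fun m hm => (hl₁ m hm).2.le) (fun m hm => (hl₂ m hm).2.le) hlen, hc,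
    norm_mul, norm_mul, mul_assoc, add_mul, Real.exp_add]
  have e1 : ‖cexp (π * Complex.I * (c * (784 * τ)))‖ = Real.exp (-(π * (c * 784) * τ.im)) := by
    rw [norm_exp]
    congr 1
    rw [show π * Complex.I * (c * (784 * τ)) = ((π * (c * 784) : ℝ) : ℂ) * (Complex.I * τ) by
      push_cast; ring, re_ofReal_mul, I_mul_re]
    ring
  have e2 : ‖cexp (2 * π * Complex.I * (784 * τ / 28))‖ = Real.exp (-(56 * π * τ.im)) := by
    rw [norm_exp]
    congr 1
    rw [show 2 * π * Complex.I * (784 * τ / 28) = ((56 * π : ℝ) : ℂ) * (Complex.I * τ) by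
      push_cast; ring, re_ofReal_mul, I_mul_re]
    ring
  have ht : 0 ≤ 1 / τ.im := by positivity
  gcongr
  · rw [e1, Real.exp_le_exp, mul_assoc, mul_assoc, mul_assoc, mul_assoc, ← mul_neg]
    have h1 : -(c * (784 * τ.im)) ≤ |c| * (784 * τ.im) := by
      rw [← neg_mul]; gcongr; exact neg_le_abs c
    have h2 : |c| * (784 * τ.im) ≤ |c| * (784 * (τ.im + 1 / τ.im)) := by
      gcongr; linarith
    exact mul_le_mul_of_nonneg_left (h1.trans h2) Real.pi_pos.le
  · refine (norm_pairQuot_le hx hl₁ hl₂).trans (Real.exp_le_exp.mpr ?_)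
    rw [e2, div_eq_mul_one_div, mul_right_comm]
    refine mul_le_mul_of_nonneg_left ?_ (mul_nonneg sumInvSq_nonneg n.cast_nonneg)
    have hpi := Real.pi_gt_three
    refine (inv_one_sub_exp_neg_le (by positivity)).trans ?_
    have h1 : 1 / (56 * π * τ.im) ≤ 1 / (2 * τ.im) := by
      gcongr
      linarith
    have h2 : 1 + 1 / (2 * τ.im) ≤ τ.im + 1 / τ.im := by
      have : τ.im + 1 / τ.im - (1 + 1 / (2 * τ.im)) =
          ((2 * τ.im - 1) ^ 2 + 1) / (4 * τ.im) := by
        field_simp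
        ring
      have h3 : 0 ≤ ((2 * τ.im - 1) ^ 2 + 1) / (4 * τ.im) := by positivity
      linarith
    linarith

/-- Conjugation by `diag(784, 1)` multiplies the upper right entry by `784` and divides the lower
left one by `784`. As `3136 = 4 · 784`, the latter remains divisible by `4`, as needed for the
half-integral characteristics in `thetaEven`. -/
lemma exists_conj_of_mem_gammaOne {γ : SL(2, ℤ)} (hγ : γ ∈ CongruenceSubgroup.Gamma1 3136) :
    ∃ (δ : SL(2, ℤ)) (b c k l : ℤ), δ 0 0 = 1 + 3136 * k ∧ δ 0 1 = 784 * b ∧ δ 1 0 = 4 * c ∧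
      δ 1 1 = 1 + 3136 * l ∧ ∀ τ τ' : ℍ, (τ' : ℂ) = 784 * τ →
        ((δ • τ' : ℍ) : ℂ) = 784 * ((γ • τ : ℍ) : ℂ) := by
  rw [CongruenceSubgroup.Gamma1_mem] at hγ
  obtain ⟨h1, h2, h3⟩ := hγ
  obtain ⟨k, hk⟩ : (3136 : ℤ) ∣ γ 0 0 - 1 :=
    (ZMod.intCast_zmod_eq_zero_iff_dvd _ 3136).mp (by push_cast; rw [h1, sub_self])
  obtain ⟨l, hl⟩ : (3136 : ℤ) ∣ γ 1 1 - 1 :=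
    (ZMod.intCast_zmod_eq_zero_iff_dvd _ 3136).mp (by push_cast; rw [h2, sub_self])
  obtain ⟨c, hc⟩ : (3136 : ℤ) ∣ γ 1 0 := (ZMod.intCast_zmod_eq_zero_iff_dvd _ 3136).mp h3
  have hdet := γ.det_coe
  rw [Matrix.det_fin_two, hc] at hdet
  obtain ⟨δ, hδ⟩ : ∃ δ : SL(2, ℤ), (δ : Matrix (Fin 2) (Fin 2) ℤ) =
      !![γ 0 0, 784 * γ 0 1; 4 * c, γ 1 1] :=
    ⟨⟨_, by rw [Matrix.det_fin_two_of]; linear_combination hdet⟩, rfl⟩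
  refine ⟨δ, γ 0 1, c, k, l, ?_, ?_, ?_, ?_, ?_⟩
  · rw [hδ]; change γ 0 0 = _; linarith
  · rw [hδ]; rfl
  · rw [hδ]; rfl
  · rw [hδ]; change γ 1 1 = _; linarith
  · intro τ τ' h
    rw [coe_specialLinearGroup_apply, coe_specialLinearGroup_apply, h, hc, hδ]
    simp
    ring_nf

theorem isModerateModular_thetaQuot {l₁ l₂ : List ℕ} (hl₁ : ∀ n ∈ l₁, n ≠ 0 ∧ n < 28)
    (hl₂ : ∀ n ∈ l₂, n ≠ 0 ∧ n < 28) (hlen : l₂.length = l₁.length + 9)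
    (hsum : Even (l₁.sum + l₂.sum)) :
    IsModerateModular 3136 fun τ => thetaQuot l₁ l₂ (784 * τ) where
  differentiableAt τ hτ := by
    have hτ' : 0 < (784 * τ).im := by
      have : (784 * τ).im = 784 * τ.im := by simp
      rw [this]; positivity
    exact DifferentiableAt.comp (g := thetaQuot l₁ l₂) τ (differentiableAt_thetaQuot hτ' hl₂)
      (by fun_prop)
  invariant γ hγ τ := by
    obtain ⟨δ, b, c, k, l, h00, h01, h10, h11, h⟩ := exists_conj_of_mem_gammaOne hγ
    have hτ' : 0 < (784 * (τ : ℂ)).im := by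
      have : (784 * (τ : ℂ)).im = 784 * τ.im := by simp
      rw [this]; have := τ.im_pos; positivity
    rw [← h τ ⟨784 * τ, hτ'⟩ rfl]
    exact thetaQuot_smul δ h00 h01 h10 h11 hlen hsum _
  growth := norm_thetaQuot_le hl₁ hl₂ hlen

lemma thetaOrder_mul (l : List ℕ) :
    784 * thetaOrder l = (((l.map fun n : ℕ => ((n : ℤ) - 14) ^ 2).sum : ℤ) : ℂ) := by
  induction l with
  | nil => simp [thetaOrder]
  | cons n l ih =>
    rw [thetaOrder, List.map_cons, List.sum_cons, List.map_cons, List.sum_cons, Int.cast_add, ← ih,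
      thetaOrder]
    push_cast
    ring

/-- The condition `hc` says that the order of the theta quotient is `c`: multiplication by `784 =
28²` turns `(n / 28 - 1 / 2)²` into `(n - 14)²` and the `3 / 4` from `thetaEven ^ 3` into `588`. The
variable `e(7τ) ^ 4` is the `28`th root of the nome at `784 τ`. -/
theorem isModerateModular_pairQuot {l₁ l₂ : List ℕ} (c : ℤ) (hl₁ : ∀ n ∈ l₁, n ≠ 0 ∧ n < 28)
    (hl₂ : ∀ n ∈ l₂, n ≠ 0 ∧ n < 28) (hlen : l₂.length = l₁.length + 9)
    (hsum : Even (l₁.sum + l₂.sum))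
    (hc : (l₁.map fun n : ℕ => ((n : ℤ) - 14) ^ 2).sum -
      (l₂.map fun n : ℕ => ((n : ℤ) - 14) ^ 2).sum + 588 = 2 * c) :
    IsModerateModular 3136 fun τ => cexp (2 * π * Complex.I * (c * τ)) *
      pairQuot l₁ l₂ (cexp (2 * π * Complex.I * (7 * τ)) ^ 4) := by
  refine ((isModerateModular_thetaQuot hl₁ hl₂ hlen hsum).const_mul
    (((2 * cexp (-(3 * π * Complex.I / 4))) ^ 3)⁻¹)).congr fun τ hτ => ?_
  have hτ' : 0 < (784 * τ).im := by
    have : (784 * τ).im = 784 * τ.im := by simp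
    rw [this]; positivity
  have e1 : cexp (2 * π * Complex.I * (7 * τ)) ^ 4 = cexp (2 * π * Complex.I * (784 * τ / 28)) := by
    rw [← Complex.exp_nat_mul]; congr 1; push_cast; ring
  have e2 : π * Complex.I * ((thetaOrder l₁ - thetaOrder l₂ + 3 / 4) * (784 * τ)) =
      2 * π * Complex.I * (c * τ) := by
    have h := congrArg (fun n : ℤ => (n : ℂ)) hc
    simp only [Int.cast_add, Int.cast_sub, Int.cast_mul, Int.cast_ofNat, ← thetaOrder_mul] at h
    linear_combination π * Complex.I * τ * h
  rw [thetaQuot_eq hτ' (fun m hm => (hl₁ m hm).2.le) (fun m hm => (hl₂ m hm).2.le) hlen, e1, e2,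
    mul_assoc (_ ^ 3), inv_mul_cancel_left₀ (by simp)]

/-! ### The Nahm sums -/

/-- The double sums are in the base `q ^ 8` and the Nahm sum in `q`, so evaluation at `56 τ`
corresponds to `e(7τ)` in the double sum; `c` is `56 C`. -/
lemma nahmSum_eq_of_hasSum {A : Matrix (Fin 2) (Fin 2) ℝ} {B : Fin 2 → ℝ} {C : ℝ} {e : ℕ × ℕ → ℤ}
    {c : ℤ} {S τ : ℂ} (h : ∀ i j : ℕ, 56 * nahmExponent A B C ![i, j] = 7 * e (i, j) + c)
    (hS : HasSum (fun p : ℕ × ℕ => cexp (2 * π * Complex.I * (7 * τ)) ^ e p /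
      (qPoch (cexp (2 * π * Complex.I * (7 * τ)) ^ 8) (cexp (2 * π * Complex.I * (7 * τ)) ^ 8) p.1 *
        qPoch (cexp (2 * π * Complex.I * (7 * τ)) ^ 8) (cexp (2 * π * Complex.I * (7 * τ)) ^ 8) p.2))
      S) :
    nahmSum A B C (56 * τ) = cexp (2 * π * Complex.I * (c * τ)) * S := by
  rw [nahmSum, ← (finTwoArrowEquiv ℕ).symm.tsum_eq, ← (hS.mul_left _).tsum_eq]
  refine tsum_congr fun p => ?_
  obtain ⟨i, j⟩ := p
  have e8 : cexp (2 * π * Complex.I * (7 * τ)) ^ 8 = cexp (2 * π * Complex.I * (56 * τ)) := by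
    rw [← Complex.exp_nat_mul]; congr 1; push_cast; ring
  have h' : (56 : ℂ) * (nahmExponent A B C ![i, j] : ℂ) = 7 * e (i, j) + c := by
    exact_mod_cast congrArg (fun x : ℝ => (x : ℂ)) (h i j)
  have hexp : cexp (2 * π * Complex.I * (nahmExponent A B C ![i, j] : ℂ) * (56 * τ)) =
      cexp (2 * π * Complex.I * (c * τ)) * cexp (2 * π * Complex.I * (7 * τ)) ^ e (i, j) := by
    rw [← Complex.exp_int_mul, ← Complex.exp_add]
    congr 1
    linear_combination 2 * π * Complex.I * τ * h'
  rw [e8, ← mul_div_assoc, ← hexp]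
  simp [finTwoArrowEquiv, Fin.prod_univ_two]

lemma nahmExponent_eq (B : Fin 2 → ℝ) (C : ℝ) (i j : ℕ) :
    56 * nahmExponent !![1, -1 / 2; -1 / 2, 3 / 4] B C ![i, j] =
      7 * (4 * (i : ℝ) ^ 2 + 3 * (j : ℝ) ^ 2 - 4 * i * j) + 56 * (i * B 0 + j * B 1 + C) := by
  simp [nahmExponent, Matrix.mulVec, dotProduct, Fin.sum_univ_two]
  ring

lemma norm_cexp_seven_lt_one {τ : ℂ} (hτ : 0 < τ.im) : ‖cexp (2 * π * Complex.I * (7 * τ))‖ < 1 := by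
  refine norm_cexp_two_pi_mul_lt_one ?_
  have : (7 * τ).im = 7 * τ.im := by simp
  rw [this]; positivity

lemma cexp_mul_cexp_seven_pow (c : ℤ) (n : ℕ) (τ : ℂ) :
    cexp (2 * π * Complex.I * (c * τ)) * cexp (2 * π * Complex.I * (7 * τ)) ^ n =
      cexp (2 * π * Complex.I * ((c + 7 * n : ℤ) * τ)) := by
  rw [← Complex.exp_nat_mul, ← Complex.exp_add]
  congr 1
  push_cast
  ring

theorem isModularFunctionGammaOne_nahmSum_one :
    IsModularFunctionGammaOne 3136 fun τ : ℍ =>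
      nahmSum !![1, -1 / 2; -1 / 2, 3 / 4] ![-1 / 2, 1 / 4] (1 / 28) (56 * (τ : ℂ)) := by
  refine IsModerateModular.isModularFunctionGammaOne (f := fun τ => nahmSum _ _ _ (56 * τ))
    (by norm_num) ?_
  -- The order `2` is `56 / 28`; the other term has order `2 + 7 = 9` because of its prefactor `q`,
  -- evaluated at `e(7τ)`.
  have hR := isModerateModular_pairQuot (l₁ := []) (l₂ := [2, 2, 6, 6, 10, 10, 4, 8, 14]) 2
    (by decide) (by decide) rfl (by decide) (by decide)
  have hP := isModerateModular_pairQuot (l₁ := [2, 6, 14])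
    (l₂ := [1, 1, 4, 7, 7, 12, 13, 13, 3, 5, 9, 11]) 9
    (by decide) (by decide) rfl (by decide) (by decide)
  refine ((hR.const_mul 2).add hP).congr fun τ hτ => ?_
  have hq := norm_cexp_seven_lt_one hτ
  have h := hasSum_identity_one hq
  rw [(J_sixteen_div_eq_pairQuot hq).1, (J_eight_mul_div_eq_pairQuot hq).1] at h
  rw [nahmSum_eq_of_hasSum (c := 2) (fun i j => ?_) h]
  · have h1 := cexp_mul_cexp_seven_pow 2 1 τ
    norm_num only [pow_one] at h1 ⊢
    rw [mul_add, ← mul_assoc _ (cexp _), h1]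
    ring
  · rw [nahmExponent_eq]
    push_cast
    simp
    ring

theorem isModularFunctionGammaOne_nahmSum_two :
    IsModularFunctionGammaOne 3136 fun τ : ℍ =>
      nahmSum !![1, -1 / 2; -1 / 2, 3 / 4] ![0, 0] (-3 / 56) (56 * (τ : ℂ)) := by
  refine IsModerateModular.isModularFunctionGammaOne (f := fun τ => nahmSum _ _ _ (56 * τ))
    (by norm_num) ?_
  -- Here `-3 = 56 C`, and the prefactor `q ^ 3` raises the order of this term to `-3 + 21 = 18`.
  have hR := isModerateModular_pairQuot (l₁ := []) (l₂ := [2, 2, 6, 6, 10, 10, 4, 12, 14]) 18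
    (by decide) (by decide) rfl (by decide) (by decide)
  have hP := isModerateModular_pairQuot (l₁ := [6, 10, 14])
    (l₂ := [3, 3, 7, 7, 8, 11, 11, 12, 1, 5, 9, 13]) (-3)
    (by decide) (by decide) rfl (by decide) (by decide)
  refine (hP.add (hR.const_mul 2)).congr fun τ hτ => ?_
  have hq := norm_cexp_seven_lt_one hτ
  have h := hasSum_identity_two hq
  rw [(J_sixteen_div_eq_pairQuot hq).2.1, (J_eight_mul_div_eq_pairQuot hq).2.1] at h
  rw [nahmSum_eq_of_hasSum (c := -3) (fun i j => ?_) h]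
  · have h1 := cexp_mul_cexp_seven_pow (-3) 3 τ
    norm_num only at h1 ⊢
    rw [← h1]
    ring
  · rw [nahmExponent_eq]
    push_cast
    simp
    ring

theorem isModularFunctionGammaOne_nahmSum_three :
    IsModularFunctionGammaOne 3136 fun τ : ℍ =>
      nahmSum !![1, -1 / 2; -1 / 2, 3 / 4] ![0, 1 / 2] (1 / 56) (56 * (τ : ℂ)) := by
  refine IsModerateModular.isModularFunctionGammaOne (f := fun τ => nahmSum _ _ _ (56 * τ))
    (by norm_num) ?_
  -- Here `1 = 56 C`, and the prefactor `q ^ 7` raises the order of this term to `1 + 49 = 50`.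
  have hR := isModerateModular_pairQuot (l₁ := []) (l₂ := [2, 2, 6, 6, 10, 10, 8, 12, 14]) 50
    (by decide) (by decide) rfl (by decide) (by decide)
  have hP := isModerateModular_pairQuot (l₁ := [2, 10, 14])
    (l₂ := [4, 5, 7, 8, 9, 1, 3, 5, 7, 9, 11, 13]) 1
    (by decide) (by decide) rfl (by decide) (by decide)
  refine (hP.add (hR.const_mul 2)).congr fun τ hτ => ?_
  have hq := norm_cexp_seven_lt_one hτ
  have h := hasSum_identity_three hq
  rw [(J_sixteen_div_eq_pairQuot hq).2.2, (J_eight_mul_div_eq_pairQuot hq).2.2] at h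
  rw [nahmSum_eq_of_hasSum (c := 1) (fun i j => ?_) h]
  · have h1 := cexp_mul_cexp_seven_pow 1 7 τ
    norm_num only at h1 ⊢
    rw [← h1]
    ring
  · rw [nahmExponent_eq]
    push_cast
    simp
    ring

end Nahm
theorem theorem9 :
    -- the three double-sum identities (with convergence of the double series), for `|q| < 1`
    (∀ q : ℂ, ‖q‖ < 1 →
      HasSum (fun p : ℕ × ℕ =>
          q ^ (4 * (p.1 : ℤ) ^ 2 + 3 * (p.2 : ℤ) ^ 2 - 4 * (p.1 : ℤ) * (p.2 : ℤ)
              - 4 * (p.1 : ℤ) + 2 * (p.2 : ℤ)) /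
            (Nahm.qPoch (q ^ 8) (q ^ 8) p.1 * Nahm.qPoch (q ^ 8) (q ^ 8) p.2))
        (2 * (Nahm.J q 16 * Nahm.JJ q 48 112 / Nahm.J q 8 ^ 2)
          + q * (Nahm.J q 8 * Nahm.J q 56 ^ 2 * Nahm.J q 112 * Nahm.JJ q 8 112 * Nahm.JJ q 24 112 /
              (Nahm.J q 4 * Nahm.JJ q 4 112 * Nahm.JJ q 16 112 * Nahm.JJ q 28 112
                * Nahm.JJ q 48 112 * Nahm.JJ q 52 112)))) ∧
    (∀ q : ℂ, ‖q‖ < 1 →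
      HasSum (fun p : ℕ × ℕ =>
          q ^ (4 * (p.1 : ℤ) ^ 2 + 3 * (p.2 : ℤ) ^ 2 - 4 * (p.1 : ℤ) * (p.2 : ℤ)) /
            (Nahm.qPoch (q ^ 8) (q ^ 8) p.1 * Nahm.qPoch (q ^ 8) (q ^ 8) p.2))
        (Nahm.J q 8 * Nahm.J q 56 ^ 2 * Nahm.J q 112 * Nahm.JJ q 24 112 * Nahm.JJ q 40 112 /
            (Nahm.J q 4 * Nahm.JJ q 12 112 * Nahm.JJ q 28 112 * Nahm.JJ q 32 112
              * Nahm.JJ q 44 112 * Nahm.JJ q 48 112)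
          + 2 * q ^ 3 * (Nahm.J q 16 * Nahm.JJ q 32 112 / Nahm.J q 8 ^ 2))) ∧
    (∀ q : ℂ, ‖q‖ < 1 →
      HasSum (fun p : ℕ × ℕ =>
          q ^ (4 * (p.1 : ℤ) ^ 2 + 3 * (p.2 : ℤ) ^ 2 - 4 * (p.1 : ℤ) * (p.2 : ℤ)
              + 4 * (p.2 : ℤ)) /
            (Nahm.qPoch (q ^ 8) (q ^ 8) p.1 * Nahm.qPoch (q ^ 8) (q ^ 8) p.2))
        (Nahm.J q 8 * Nahm.J q 56 ^ 2 * Nahm.J q 112 * Nahm.JJ q 8 112 * Nahm.JJ q 40 112 /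
            (Nahm.J q 4 * Nahm.JJ q 16 112 * Nahm.JJ q 20 112 * Nahm.JJ q 28 112
              * Nahm.JJ q 32 112 * Nahm.JJ q 36 112)
          + 2 * q ^ 7 * (Nahm.J q 16 * Nahm.JJ q 16 112 / Nahm.J q 8 ^ 2))) ∧
    -- modularity of `f_{A,B,C}(q^56)`, `q = exp (2πiτ)`, on `Γ₁(3136)`
    Nahm.IsModularFunctionGammaOne 3136 (fun τ : ℍ =>
      Nahm.nahmSum !![1, -1 / 2; -1 / 2, 3 / 4] ![-1 / 2, 1 / 4] (1 / 28) (56 * (τ : ℂ))) ∧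
    Nahm.IsModularFunctionGammaOne 3136 (fun τ : ℍ =>
      Nahm.nahmSum !![1, -1 / 2; -1 / 2, 3 / 4] ![0, 0] (-3 / 56) (56 * (τ : ℂ))) ∧
    Nahm.IsModularFunctionGammaOne 3136 (fun τ : ℍ =>
      Nahm.nahmSum !![1, -1 / 2; -1 / 2, 3 / 4] ![0, 1 / 2] (1 / 56) (56 * (τ : ℂ))) := by
  exact ⟨fun q hq => Nahm.hasSum_identity_one hq, fun q hq => Nahm.hasSum_identity_two hq,
    fun q hq => Nahm.hasSum_identity_three hq, Nahm.isModularFunctionGammaOne_nahmSum_one,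
    Nahm.isModularFunctionGammaOne_nahmSum_two, Nahm.isModularFunctionGammaOne_nahmSum_three⟩
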